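/- For $\beta>1$ let $\tau_\beta:[0,1]\to[0,1]$, $\tau_\beta(x)=\beta x-\lfloor\beta x\rfloor$, be the beta-map, let $a_n(\beta,1)=\lfloor\beta\,\tau_\beta^{\,n-1}(1)\rfloor$ ($n\ge 1$) be the greedy digits of $1$, and let $$\phi_\beta(z)=\sum_{n=1}^\infty \frac{a_n(\beta,1)}{\beta^n}z^n ,\qquad |z|<\beta .$$ Let $BV$ be the Banach space of functions $f:[0,1]\to\mathbb C$ of bounded variation with norm $\operatorname{var}(f)+\sup|f|$, let $\widehat{BV}$ be its quotient by the closed subspace of the functions in $BV$ that vanish outside a countable set, and let $\mathcal L_\beta$ be the Perron–Frobenius operator $$\mathcal L_\beta f(x)=\frac1\beta\sum_{y\in[0,1]:\ \tau_\beta(y)=x}f(y)$$ on $BV$, as well as the operator it induces on $\widehat{BV}$. An isolated eigenvalue of $\mathcal L_\beta$ is an eigenvalue of finite algebraic multiplicity that is an isolated point of the spectrum. The essential spectral radius of $\mathcal L_\beta$ is the infimum of the $r\ge 0$ such that every spectral value of modulus greater than $r$ is an isolated eigenvalue. A non-leading eigenvalue of $\mathcal L_\beta$ is an isolated eigenvalue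 $\lambda\ne 1$ whose modulus is greater than the essential spectral radius. Theorem. For every integer $N\ge 1$, the set of $\beta>1$ for which the function $z\mapsto 1-\phi_\beta(\beta z)$ has at least $N$ zeros in the open unit disk $\{|z|<1\}$ is open and dense in $(1,\infty)$; this holds when the zeros are counted without multiplicity and also when they are counted with multiplicity. Moreover, the set of $\beta>1$ for which $\mathcal L_\beta$ has at least one non-leading eigenvalue is open and dense in $(1,\infty)$; this holds for $\mathcal L_\beta$ on $BV$ and also for $\mathcal L_\beta$ on $\widehat{BV}$. -/

import Mathlib

open Set Topology

namespace BetaMap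

noncomputable section

/-! ### Beta-maps, greedy digits of `1` and their generating function -/

/-- The beta-map `x ↦ βx - [βx]` on `[0,1]`. -/
def betaMap (β : ℝ) (x : unitInterval) : unitInterval :=
  ⟨Int.fract (β * (x : ℝ)), Int.fract_nonneg _, (Int.fract_lt_one _).le⟩

/-- `greedyDigit β x n` is the `(n+1)`-st digit `[β τ^n(x)]` of the greedy expansion of `x`. -/
def greedyDigit (β : ℝ) (x : unitInterval) (n : ℕ) : ℕ :=
  ⌊β * (((betaMap β)^[n] x : unitInterval) : ℝ)⌋₊

/-- The generating function `φ_β(z) = ∑_{n ≥ 1} a_n(β,1) β^{-n} z^n` of the greedy digits of `1`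
(the sum is shifted: the term of index `n` here is the term of index `n + 1` there). The series
converges absolutely for `‖z‖ < β`. -/
def phi (β : ℝ) (z : ℂ) : ℂ :=
  ∑' n : ℕ, (greedyDigit β 1 n : ℂ) / (β : ℂ) ^ (n + 1) * z ^ (n + 1)

/-! ### Functions of bounded variation on `[0,1]` -/

/-- The space of all functions `[0,1] → ℂ` of bounded variation. -/
def BV : Submodule ℂ (unitInterval → ℂ) where
  carrier := {f | BoundedVariationOn f univ}
  zero_mem' := by
    have h : eVariationOn (0 : unitInterval → ℂ) univ = 0 :=
      eVariationOn.constant_on (by rintro _ ⟨_, _, rfl⟩ _ ⟨_, _, rfl⟩; rfl)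
    simp [BoundedVariationOn, h]
  add_mem' := by
    intro f g hf hg
    have h : eVariationOn (f + g) univ ≤ eVariationOn f univ + eVariationOn g univ := by
      apply iSup_le
      rintro ⟨n, u, hu, hmem⟩
      calc ∑ i ∈ Finset.range n, edist ((f + g) (u (i + 1))) ((f + g) (u i))
          ≤ ∑ i ∈ Finset.range n,
              (edist (f (u (i + 1))) (f (u i)) + edist (g (u (i + 1))) (g (u i))) :=
            Finset.sum_le_sum fun i _ => edist_add_add_le _ _ _ _
        _ = _ := Finset.sum_add_distrib
        _ ≤ _ := add_le_add (eVariationOn.sum_le hu hmem) (eVariationOn.sum_le hu hmem)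
    exact ne_top_of_le_ne_top (ENNReal.add_ne_top.2 ⟨hf, hg⟩) h
  smul_mem' := by
    intro c f hf
    have hc : BoundedVariationOn (fun _ : unitInterval => c) univ := by
      have h : eVariationOn (fun _ : unitInterval => c) univ = 0 :=
        eVariationOn.constant_on (by rintro _ ⟨_, _, rfl⟩ _ ⟨_, _, rfl⟩; rfl)
      simp [BoundedVariationOn, h]
    exact hc.smul hf

/-- The functions of bounded variation that vanish outside a countable set. -/
def nullBV : Submodule ℂ BV where
  carrier := {f | ∃ N : Set unitInterval, N.Countable ∧ ∀ x ∉ N, (f : unitInterval → ℂ) x = 0}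
  zero_mem' := ⟨∅, countable_empty, fun _ _ => rfl⟩
  add_mem' := by
    rintro f g ⟨A, hA, hf⟩ ⟨B, hB, hg⟩
    refine ⟨A ∪ B, hA.union hB, fun x hx => ?_⟩
    rw [mem_union, not_or] at hx
    simp [hf x hx.1, hg x hx.2]
  smul_mem' := by
    rintro c f ⟨A, hA, hf⟩
    exact ⟨A, hA, fun x hx => by simp [hf x hx]⟩

/-- The quotient of `BV` in which functions are identified if they agree outside a countable
set. -/
abbrev BVHat : Type := BV ⧸ nullBV

/-! ### The Perron-Frobenius operator -/

/-- The pointwise formula `(L_β f)(x) = β⁻¹ ∑_{τ_β(y) = x} f(y)`. The sum is finite. -/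
def transfer (β : ℝ) (f : unitInterval → ℂ) (x : unitInterval) : ℂ :=
  (β : ℂ)⁻¹ * ∑ᶠ y ∈ betaMap β ⁻¹' {x}, f y

/-- The inverse branch `x ↦ (x + k) / β`, truncated to `[0,1]`. -/
def branch (β : ℝ) (k : ℕ) (x : unitInterval) : unitInterval :=
  projIcc 0 1 zero_le_one (((x : ℝ) + k) / β)

/-- The set on which the inverse branch of index `k` is defined. -/
def branchDom (β : ℝ) (k : ℕ) : Set unitInterval :=
  {x | (x : ℝ) < 1 ∧ (x : ℝ) + k ≤ β}

lemma branch_coe {β : ℝ} (hβ : 1 < β) {k : ℕ} {x : unitInterval} (hx : x ∈ branchDom β k) :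
    (branch β k x : ℝ) = ((x : ℝ) + k) / β := by
  have h0 : 0 < β := by linarith
  have hx0 : 0 ≤ (x : ℝ) := x.2.1
  have : ((x : ℝ) + k) / β ∈ Icc (0 : ℝ) 1 :=
    ⟨by positivity, (div_le_one h0).2 hx.2⟩
  simp [branch, projIcc_of_mem zero_le_one this]

lemma preimage_eq {β : ℝ} (hβ : 1 < β) (x : unitInterval) [DecidablePred fun k => x ∈ branchDom β k] :
    betaMap β ⁻¹' {x} =
      (((Finset.range (⌊β⌋₊ + 1)).filter fun k => x ∈ branchDom β k).image
        fun k => branch β k x : Finset unitInterval) := by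
  have h0 : 0 < β := by linarith
  ext y
  simp only [mem_preimage, mem_singleton_iff, Finset.coe_image, Finset.coe_filter, mem_image,
    mem_ofPred_eq, Finset.mem_range]
  constructor
  · intro h
    have hx : Int.fract (β * (y : ℝ)) = x := congrArg Subtype.val h
    have hy0 : 0 ≤ β * (y : ℝ) := mul_nonneg h0.le y.2.1
    have hy1 : β * (y : ℝ) ≤ β := mul_le_of_le_one_right h0.le y.2.2
    have hk : (x : ℝ) + (⌊β * (y : ℝ)⌋₊ : ℝ) = β * (y : ℝ) := by
      rw [← hx, natCast_floor_eq_intCast_floor hy0]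
      exact Int.fract_add_floor _
    have hdom : x ∈ branchDom β ⌊β * (y : ℝ)⌋₊ :=
      ⟨by rw [← hx]; exact Int.fract_lt_one _, by rw [hk]; exact hy1⟩
    refine ⟨⌊β * (y : ℝ)⌋₊, ⟨Nat.lt_succ_of_le (Nat.floor_le_floor hy1), hdom⟩, ?_⟩
    apply Subtype.ext
    rw [branch_coe hβ hdom, hk]
    field_simp
  · rintro ⟨k, ⟨-, hdom⟩, rfl⟩
    apply Subtype.ext
    change Int.fract (β * (branch β k x : ℝ)) = x
    rw [branch_coe hβ hdom, mul_div_cancel₀ _ h0.ne', Int.fract_add_natCast]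
    exact Int.fract_eq_self.2 ⟨x.2.1, hdom.1⟩

lemma finite_preimage {β : ℝ} (hβ : 1 < β) (x : unitInterval) : (betaMap β ⁻¹' {x}).Finite := by
  classical
  rw [preimage_eq hβ]
  exact Finset.finite_toSet _

lemma transfer_eq_sum {β : ℝ} (hβ : 1 < β) (f : unitInterval → ℂ) :
    transfer β f = (β : ℂ)⁻¹ • ∑ k ∈ Finset.range (⌊β⌋₊ + 1),
      (branchDom β k).indicator (fun x => f (branch β k x)) := by
  classical
  have h0 : 0 < β := by linarith
  ext x
  simp only [transfer, Pi.smul_apply, Finset.sum_apply, smul_eq_mul, indicator_apply]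
  rw [preimage_eq hβ, finsum_mem_coe_finset, Finset.sum_image, Finset.sum_filter]
  intro k hk l hl hkl
  have hk' := (Finset.mem_filter.1 hk).2
  have hl' := (Finset.mem_filter.1 hl).2
  have h := congrArg Subtype.val hkl
  simp only [branch_coe hβ hk', branch_coe hβ hl'] at h
  have h' : (x : ℝ) + k = x + l := by
    field_simp at h
    exact h
  exact_mod_cast add_left_cancel h'

lemma branch_indicator_mem_BV {β : ℝ} (hβ : 1 < β) {f : unitInterval → ℂ} (hf : f ∈ BV) (k : ℕ) :
    (branchDom β k).indicator (fun x => f (branch β k x)) ∈ BV := by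
  classical
  have h0 : 0 < β := by linarith
  have hmono : Monotone (branch β k) := by
    intro x y hxy
    apply monotone_projIcc
    have : (x : ℝ) ≤ y := hxy
    gcongr
  have h1 : BoundedVariationOn (f ∘ branch β k) univ :=
    ne_top_of_le_ne_top hf
      (eVariationOn.comp_le_of_monotoneOn f _ (hmono.monotoneOn _) (fun _ _ => mem_univ _))
  have h2 : BoundedVariationOn (fun x => -(branchDom β k).indicator (fun _ => (1 : ℝ)) x) univ := by
    have hm : MonotoneOn (fun x => -(branchDom β k).indicator (fun _ => (1 : ℝ)) x) univ := by
      intro x _ y _ hxy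
      have hxy' : (x : ℝ) ≤ y := hxy
      by_cases hy : y ∈ branchDom β k
      · have hx : x ∈ branchDom β k := ⟨by linarith [hy.1], by linarith [hy.2]⟩
        simp [hx, hy]
      · simp only [indicator_of_notMem hy, neg_zero, Left.neg_nonpos_iff]
        exact indicator_nonneg (fun _ _ => zero_le_one) _
    refine hm.boundedVariationOn (C := 1) fun x _ => ?_
    by_cases hx : x ∈ branchDom β k <;> simp [hx]
  have h3 : (fun x => -(branchDom β k).indicator (fun x => f (branch β k x)) x) ∈ BV := by
    have h4 := h2.smul h1
    change BoundedVariationOn _ _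
    convert h4 using 1
    ext x
    by_cases hx : x ∈ branchDom β k <;> simp [hx]
  have h5 := BV.neg_mem h3
  convert h5 using 1
  ext x
  simp

lemma transfer_mem_BV {β : ℝ} (hβ : 1 < β) {f : unitInterval → ℂ} (hf : f ∈ BV) :
    transfer β f ∈ BV := by
  rw [transfer_eq_sum hβ]
  exact BV.smul_mem _ (BV.sum_mem fun k _ => branch_indicator_mem_BV hβ hf k)

/-- The Perron-Frobenius operator `L_β : BV → BV`, for `β > 1`. -/
def perronFrobenius (β : Ioi (1 : ℝ)) : Module.End ℂ BV where
  toFun f := ⟨transfer β f, transfer_mem_BV β.2 f.2⟩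
  map_add' f g := by
    ext x
    change (β : ℂ)⁻¹ * ∑ᶠ y ∈ betaMap β ⁻¹' {x}, ((f : unitInterval → ℂ) y + (g : unitInterval → ℂ) y)
      = transfer β f x + transfer β g x
    rw [finsum_mem_add_distrib (finite_preimage β.2 x), mul_add]
    rfl
  map_smul' c f := by
    ext x
    change (β : ℂ)⁻¹ * ∑ᶠ y ∈ betaMap β ⁻¹' {x}, c * (f : unitInterval → ℂ) y = c * transfer β f x
    rw [← mul_finsum_mem, mul_left_comm]
    rfl

lemma nullBV_le_comap (β : Ioi (1 : ℝ)) : nullBV ≤ nullBV.comap (perronFrobenius β) := by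
  rintro f ⟨N, hN, hf⟩
  refine ⟨betaMap β '' N, hN.image _, fun x hx => ?_⟩
  have : ∑ᶠ y ∈ betaMap β ⁻¹' {x}, (f : unitInterval → ℂ) y = 0 := by
    apply finsum_mem_eq_zero_of_forall_eq_zero
    intro y hy
    exact hf y fun hyN => hx ⟨y, hyN, hy⟩
  change (β : ℂ)⁻¹ * _ = 0
  rw [this, mul_zero]

/-- The operator induced by `L_β` on the quotient `BVHat`. -/
def perronFrobeniusHat (β : Ioi (1 : ℝ)) : Module.End ℂ BVHat :=
  nullBV.mapQ nullBV (perronFrobenius β) (nullBV_le_comap β)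

/-! ### Isolated eigenvalues

Spectra are those of linear endomorphisms: `lam` is in the spectrum of `T` iff `lam I - T` is not
bijective. Both `BV` (with `var f + sup |f|`) and `BVHat` (with the quotient norm) are Banach spaces
on which the operators above are bounded, so by the bounded inverse theorem these spectra are
the spectra of the bounded operators. -/

/-- `lam` is an isolated eigenvalue of `T` (of finite algebraic multiplicity): an eigenvalue with a
finite-dimensional generalized eigenspace that is an isolated point of the spectrum. -/
def IsIsolatedEigenvalue {V : Type*} [AddCommGroup V] [Module ℂ V] (T : Module.End ℂ V)
    (lam : ℂ) : Prop :=
  T.HasEigenvalue lam ∧ FiniteDimensional ℂ (T.maxGenEigenspace lam) ∧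
    ∃ ε > 0, ∀ μ ∈ spectrum ℂ T, dist μ lam < ε → μ = lam

/-- The essential spectral radius: the infimum of the `r ≥ 0` such that every spectral value of
modulus greater than `r` is an isolated eigenvalue of finite multiplicity. -/
def essSpectralRadius {V : Type*} [AddCommGroup V] [Module ℂ V] (T : Module.End ℂ V) : ℝ :=
  sInf {r : ℝ | 0 ≤ r ∧ ∀ μ ∈ spectrum ℂ T, r < ‖μ‖ → IsIsolatedEigenvalue T μ}

/-- A non-leading eigenvalue: an isolated eigenvalue of modulus greater than the essential
spectral radius, other than the leading eigenvalue `1`. -/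
def IsNonLeadingEigenvalue {V : Type*} [AddCommGroup V] [Module ℂ V] (T : Module.End ℂ V)
    (lam : ℂ) : Prop :=
  lam ≠ 1 ∧ IsIsolatedEigenvalue T lam ∧ essSpectralRadius T < ‖lam‖

end

end BetaMap

/-!
For `β > 1` write `F_β(z) = 1 - φ_β(βz) = 1 - ∑ a_n zⁿ`. The power series `F_β` has bounded coefficients,
and `F_β(z) = (1 - βz) ∑ τ_β^n(1) zⁿ` on the unit disc (`digitSeries_of_orbit`).

*Openness.* The greedy digits of `1` are not continuous in `β`, but they have limits from both sides.
The right limit is `F_β` itself. From the left, the orbit of `1` tends to the orbit under the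
left-continuous version of `τ_β`; if `τ_β^m(1) = 0` for the first time at `m`, this orbit is periodic,
and the limit of the `F_γ` is `F_β(z) / (1 - z^m)`, which has the same zeros in the disc
(`exists_one_sided_limits`). Hurwitz's theorem, for distinct zeros and with multiplicities
(`eventually_le_encard_zeros`, `HasZeros.eventually`), then gives openness.

*Density.* The `β` with `τ_β^m(1) = 0` for some `m` are dense (`exists_orbit_eq_zero`). For `γ` slightly
above such a `β`, the expansion of `1` starts with the same word, and the intermediate value theorem lets
one prescribe that it goes on with a long block of zeros and then with a fixed periodic word
(`exists_family`). Then the zeros of `F_γ` in the disc include the solutions of `G(z) = z^K`, where `G`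
does not depend on `K` and `G(1) = 0`; as `K → ∞` these accumulate at a root of unity close to `1`, where
`0 < |G| < 1` (`eventually_many_solutions`).

*Eigenvalues.* With `h_y` the indicator function of `[0,y)`, `L_β h_y = β⁻¹ (⌊βy⌋ h_1 + h_{τ_β(y)})`. More
generally `L_β = A + β⁻¹ ℓ(·) h_1`, where `ℓ(f)` is the sum of the left limits of `f` at the right ends of
the branches and `A` contracts the norm `var(f) + |f(1)|` by the factor `β⁻¹`
(`totalVar_contractionPart_le`). As `ℓ(Aⁿ h_1) = β⁻ⁿ a_{n+1}`, for `|λ| > β⁻¹` the operator `λ - L_β` is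
invertible unless `F_β(1/(βλ)) = 0`, and then `λ` is an isolated eigenvalue
(`IsRankOnePerturbation.mem_spectrum_iff`, `IsRankOnePerturbation.isIsolatedEigenvalue`). All of this
passes to the quotient, since `ℓ` vanishes on functions with countable support
(`IsRankOnePerturbation.mapQ`). Every `λ` with `|λ| < β⁻¹` is an eigenvalue (`exists_eigenfunction`), so
the essential spectral radius is `β⁻¹`, and a non-leading eigenvalue exists iff `F_β` has a zero in the
disc other than `1/β`, that is, at least two zeros.
-/

namespace BetaMap

noncomputable section

section

open Filter Metric

/-! ### Zeros of holomorphic functions under locally uniform convergence -/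

/-- If `F i → f` uniformly on a closed disc, `f` vanishes at the centre and nowhere on the boundary
circle, then `F i` eventually has a zero in that disc. -/
lemma eventually_exists_zero_of_tendstoUniformlyOn {ι : Type*} {l : Filter ι} {F : ι → ℂ → ℂ}
    {f : ℂ → ℂ} {c : ℂ} {r : ℝ} (hr : 0 < r)
    (hF : ∀ᶠ i in l, DiffContOnCl ℂ (F i) (ball c r))
    (hlim : TendstoUniformlyOn F f l (closedBall c r)) (hf : ContinuousOn f (sphere c r))
    (hc : f c = 0) (hne : ∀ z ∈ sphere c r, f z ≠ 0) :
    ∀ᶠ i in l, ∃ z ∈ closedBall c r, F i z = 0 := by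
  obtain ⟨w, hw, hmin⟩ := (isCompact_sphere c r).exists_isMinOn
    (NormedSpace.sphere_nonempty.2 hr.le) hf.norm
  have hm : 0 < ‖f w‖ := norm_pos_iff.2 (hne w hw)
  set m := ‖f w‖ with hmdef
  filter_upwards [hF, Metric.tendstoUniformlyOn_iff.1 hlim (m / 5) (by positivity)] with i hd hu
  have hc' : ‖F i c‖ < m / 5 := by
    have := hu c (mem_closedBall_self hr.le)
    rwa [hc, dist_zero_left] at this
  have hsph : ∀ z ∈ sphere c r, m / 2 ≤ ‖F i z - F i c‖ := by
    intro z hz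
    have h1 := hu z (sphere_subset_closedBall hz)
    have h2 : m ≤ ‖f z‖ := hmin hz
    rw [dist_eq_norm] at h1
    have h3 : ‖f z‖ ≤ ‖f z - F i z‖ + ‖F i z - F i c‖ + ‖F i c‖ := by
      calc ‖f z‖ = ‖(f z - F i z) + (F i z - F i c) + F i c‖ := by congr 1; ring
        _ ≤ _ := norm_add₃_le
    linarith
  have hnc : ∃ᶠ z in 𝓝 c, F i z ≠ F i c := by
    intro hcon
    have hcon' : F i =ᶠ[𝓝 c] fun _ => F i c := by
      filter_upwards [hcon] with z hz
      simpa using hz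
    have han : AnalyticOnNhd ℂ (F i) (ball c r) := hd.differentiableOn.analyticOnNhd isOpen_ball
    have heq : EqOn (F i) (fun _ => F i c) (ball c r) :=
      han.eqOn_of_preconnected_of_eventuallyEq analyticOnNhd_const
        (convex_ball c r).isPreconnected (mem_ball_self hr) hcon'
    have heq' : EqOn (F i) (fun _ => F i c) (closure (ball c r)) :=
      heq.of_subset_closure hd.continuousOn continuousOn_const subset_closure subset_rfl
    have h1 := heq' (by rw [closure_ball c hr.ne']; exact sphere_subset_closedBall hw : w ∈ _)
    have h2 := hsph w hw
    rw [h1, sub_self, norm_zero] at h2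
    linarith
  have := hd.ball_subset_image_closedBall hr hsph hnc
  obtain ⟨z, hz, hz0⟩ := this (show (0 : ℂ) ∈ _ by rw [mem_ball, dist_zero_left]; linarith)
  exact ⟨z, hz, hz0⟩

lemma eventually_exists_zero_near {ι : Type*} {l : Filter ι} {F : ι → ℂ → ℂ} {f : ℂ → ℂ}
    {U : Set ℂ} (hU : IsOpen U) (hF : ∀ᶠ i in l, DifferentiableOn ℂ (F i) U)
    (hf : DifferentiableOn ℂ f U) (hlim : TendstoLocallyUniformlyOn F f l U)
    {a : ℂ} (ha : a ∈ U) (ha0 : f a = 0) (hord : analyticOrderAt f a ≠ ⊤) {ε : ℝ} (hε : 0 < ε) :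
    ∀ᶠ i in l, ∃ z ∈ U, dist z a < ε ∧ F i z = 0 := by
  have han : AnalyticAt ℂ f a := hf.analyticAt (hU.mem_nhds ha)
  have hne : ∀ᶠ z in 𝓝[≠] a, f z ≠ 0 := by
    rcases han.eventually_eq_zero_or_eventually_ne_zero with h | h
    · exact absurd (analyticOrderAt_eq_top.2 h) hord
    · exact h
  obtain ⟨δ, hδ, hδU⟩ := Metric.isOpen_iff.1 hU a ha
  obtain ⟨η, hη, hη'⟩ := Metric.mem_nhdsWithin_iff.1 hne
  set r := min δ (min ε η) / 2 with hr
  have hm : 0 < min δ (min ε η) := lt_min hδ (lt_min hε hη)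
  have hr0 : 0 < r := by positivity
  have hrδ : r < δ := by linarith [min_le_left δ (min ε η)]
  have hrε : r < ε := by linarith [min_le_right δ (min ε η), min_le_left ε η]
  have hrη : r < η := by linarith [min_le_right δ (min ε η), min_le_right ε η]
  have hsub : closedBall a r ⊆ U := (closedBall_subset_ball hrδ).trans hδU
  have hu : TendstoUniformlyOn F f l (closedBall a r) :=
    (tendstoLocallyUniformlyOn_iff_forall_isCompact hU).1 hlim _ hsub (isCompact_closedBall a r)
  have := eventually_exists_zero_of_tendstoUniformlyOn hr0
    (hF.mono fun i hi => (hi.mono (closure_ball_subset_closedBall.trans hsub)).diffContOnCl) hu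
    ((hf.continuousOn.mono hsub).mono sphere_subset_closedBall) ha0 (by
      intro z hz
      refine hη' ⟨?_, ?_⟩
      · rw [mem_ball, mem_sphere.1 hz]; exact hrη
      · rintro rfl
        simp [hr0.ne] at hz)
  filter_upwards [this] with i ⟨z, hz, hz0⟩
  exact ⟨z, hsub hz, lt_of_le_of_lt hz hrε, hz0⟩

/-- Dividing out zeros `a i → a` preserves locally uniform convergence on the unit disc: on circles
around `0` this is clear, and the maximum principle does the rest. -/
lemma tendstoLocallyUniformlyOn_dslope {ι : Type*} {l : Filter ι} {F : ι → ℂ → ℂ} {f : ℂ → ℂ}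
    {a : ι → ℂ} {a₀ : ℂ} (hF : ∀ᶠ i in l, DifferentiableOn ℂ (F i) (ball 0 1))
    (hf : DifferentiableOn ℂ f (ball 0 1)) (hlim : TendstoLocallyUniformlyOn F f l (ball 0 1))
    (ha : Tendsto a l (𝓝 a₀)) (ha₀ : a₀ ∈ ball (0 : ℂ) 1) (hFa : ∀ᶠ i in l, F i (a i) = 0)
    (hfa : f a₀ = 0) :
    TendstoLocallyUniformlyOn (fun i => dslope (F i) (a i)) (dslope f a₀) l (ball 0 1) := by
  rw [tendstoLocallyUniformlyOn_iff_forall_isCompact isOpen_ball]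
  intro K hK hKc
  obtain ⟨r₀, hr₀, hKr⟩ : ∃ r₀ < (1 : ℝ), K ⊆ closedBall 0 r₀ := by
    rcases K.eq_empty_or_nonempty with rfl | hne
    · exact ⟨0, one_pos, empty_subset _⟩
    · obtain ⟨w, hw, hmax⟩ := hKc.exists_isMaxOn hne continuous_norm.continuousOn
      exact ⟨‖w‖, by simpa using hK hw, fun z hz => by simpa using hmax hz⟩
  rw [mem_ball_zero_iff] at ha₀
  obtain ⟨r, hr, hr1⟩ := exists_between (max_lt hr₀ ha₀)
  have hr₀r : r₀ < r := (le_max_left _ _).trans_lt hr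
  have har : ‖a₀‖ < r := (le_max_right _ _).trans_lt hr
  have hrpos : 0 < r := (norm_nonneg _).trans_lt har
  have hsub : closedBall (0 : ℂ) r ⊆ ball 0 1 := closedBall_subset_ball hr1
  have hu := (tendstoLocallyUniformlyOn_iff_forall_isCompact isOpen_ball).1 hlim _ hsub
    (isCompact_closedBall _ _)
  obtain ⟨M, hM⟩ := (isCompact_closedBall (0 : ℂ) r).exists_bound_of_continuousOn
    (hf.continuousOn.mono hsub)
  have hM0 : 0 ≤ M := (norm_nonneg _).trans (hM 0 (mem_closedBall_self hrpos.le))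
  set δ := r - ‖a₀‖ with hδ
  have hδ0 : 0 < δ := sub_pos.2 har
  rw [Metric.tendstoUniformlyOn_iff]
  intro ε hε
  -- both error terms on the circle of radius `r` are below `ε / 4`
  have hη : 0 < ε * δ / 8 := by positivity
  have hη' : 0 < min (δ / 2) (ε * δ ^ 2 / (8 * (M + 1))) := by positivity
  filter_upwards [hF, hFa, Metric.tendstoUniformlyOn_iff.1 hu _ hη,
    Metric.tendsto_nhds.1 ha _ hη'] with i hFi hFai hui hai
  have hai1 : ‖a i - a₀‖ < δ / 2 := by
    rw [← dist_eq_norm]; exact hai.trans_le (min_le_left _ _)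
  have hai2 : ‖a i - a₀‖ < ε * δ ^ 2 / (8 * (M + 1)) := by
    rw [← dist_eq_norm]; exact hai.trans_le (min_le_right _ _)
  have hai3 : ‖a i‖ < r := by
    have := norm_le_norm_add_norm_sub' (a i) a₀
    linarith
  have hd1 : DifferentiableOn ℂ (dslope (F i) (a i)) (ball 0 1) :=
    (Complex.differentiableOn_dslope (isOpen_ball.mem_nhds (hsub (by simpa using hai3.le)))).2 hFi
  have hd2 : DifferentiableOn ℂ (dslope f a₀) (ball 0 1) :=
    (Complex.differentiableOn_dslope (isOpen_ball.mem_nhds (by simpa using ha₀))).2 hf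
  have hfr : ∀ z ∈ frontier (ball (0 : ℂ) r), ‖dslope f a₀ z - dslope (F i) (a i) z‖ ≤ ε / 2 := by
    intro z hz
    rw [frontier_ball _ hrpos.ne'] at hz
    have hzn : ‖z‖ = r := by simpa using hz
    have h1 : δ ≤ ‖z - a₀‖ := by
      have := norm_sub_norm_le z a₀
      linarith
    have h2 : δ / 2 ≤ ‖z - a i‖ := by
      have : ‖z - a₀‖ ≤ ‖z - a i‖ + ‖a i - a₀‖ := by
        simpa using norm_add_le (z - a i) (a i - a₀)
      linarith
    have hz1 : z - a₀ ≠ 0 := norm_pos_iff.1 (hδ0.trans_le h1)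
    have hz2 : z - a i ≠ 0 := norm_pos_iff.1 (by linarith)
    have e1 : dslope f a₀ z = f z / (z - a₀) := by
      have := sub_smul_dslope_of_zero hfa z
      rw [← this, smul_eq_mul, mul_div_cancel_left₀ _ hz1]
    have e2 : dslope (F i) (a i) z = F i z / (z - a i) := by
      have := sub_smul_dslope_of_zero hFai z
      rw [← this, smul_eq_mul, mul_div_cancel_left₀ _ hz2]
    have e3 : f z / (z - a₀) - F i z / (z - a i) =
        (f z - F i z) / (z - a i) - f z * (a i - a₀) / ((z - a₀) * (z - a i)) := by
      field_simp
      ring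
    have hzc : z ∈ closedBall (0 : ℂ) r := sphere_subset_closedBall hz
    have b1 : ‖(f z - F i z) / (z - a i)‖ ≤ ε / 4 := by
      rw [norm_div, div_le_iff₀ (by positivity)]
      have := hui z hzc
      rw [dist_eq_norm] at this
      nlinarith
    have b2 : ‖f z * (a i - a₀) / ((z - a₀) * (z - a i))‖ ≤ ε / 4 := by
      rw [norm_div, norm_mul, norm_mul, div_le_iff₀ (by positivity)]
      have h3 : δ * (δ / 2) ≤ ‖z - a₀‖ * ‖z - a i‖ := by gcongr
      have h4 : ‖f z‖ * ‖a i - a₀‖ ≤ (M + 1) * (ε * δ ^ 2 / (8 * (M + 1))) := by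
        gcongr
        linarith [hM z hzc]
      have h5 : (M + 1) * (ε * δ ^ 2 / (8 * (M + 1))) = ε / 4 * (δ * (δ / 2)) := by
        field_simp
        ring
      rw [h5] at h4
      exact h4.trans (by gcongr)
    rw [e1, e2, e3]
    exact (norm_sub_le _ _).trans (by linarith)
  intro z hz
  have hcl : closure (ball (0 : ℂ) r) ⊆ ball 0 1 := closure_ball_subset_closedBall.trans hsub
  have := Complex.norm_le_of_forall_mem_frontier_norm_le isBounded_ball
    ((hd2.sub hd1).mono hcl).diffContOnCl hfr
    (subset_closure (by simpa using (mem_closedBall_zero_iff.1 (hKr hz)).trans_lt hr₀r : z ∈ _))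
  rw [dist_eq_norm]
  exact this.trans_lt (by linarith)

/-- `f` has at least `N` zeros in the open unit disc, counted with multiplicity: zeros can be divided
out successively `N` times. -/
def HasZeros : ℕ → (ℂ → ℂ) → Prop
  | 0, _ => True
  | N + 1, f => ∃ a ∈ ball (0 : ℂ) 1, f a = 0 ∧ HasZeros N (dslope f a)

lemma analyticOrderAt_eq_dslope {f : ℂ → ℂ} (hf : DifferentiableOn ℂ f (ball 0 1)) {a z : ℂ}
    (ha : a ∈ ball (0 : ℂ) 1) (hz : z ∈ ball (0 : ℂ) 1) (h0 : f a = 0) :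
    analyticOrderAt f z = analyticOrderAt (dslope f a) z + if z = a then 1 else 0 := by
  have hd : DifferentiableOn ℂ (dslope f a) (ball 0 1) :=
    (Complex.differentiableOn_dslope (isOpen_ball.mem_nhds ha)).2 hf
  have he : f = (fun w => w - a) * dslope f a := by
    ext w
    exact (sub_smul_dslope_of_zero h0 w).symm
  have h1 : analyticOrderAt (fun w : ℂ => w - a) z = if z = a then 1 else 0 := by
    split_ifs with h
    · subst h
      exact analyticOrderAt_id_sub_const_self
    · exact analyticOrderAt_id_sub_const_of_ne h
  conv_lhs => rw [he]
  rw [analyticOrderAt_mul (by fun_prop) (hd.analyticAt (isOpen_ball.mem_nhds hz)), h1, add_comm]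

lemma hasZeros_iff {N : ℕ} {f : ℂ → ℂ} (hf : DifferentiableOn ℂ f (ball 0 1)) :
    HasZeros N f ↔ ∃ S : Finset ℂ, (∀ z ∈ S, ‖z‖ < 1) ∧ (N : ℕ∞) ≤ ∑ z ∈ S, analyticOrderAt f z := by
  classical
  induction N generalizing f with
  | zero => simpa [HasZeros] using ⟨∅, by simp⟩
  | succ N ih =>
    have hd : ∀ a ∈ ball (0 : ℂ) 1, DifferentiableOn ℂ (dslope f a) (ball 0 1) := fun a ha =>
      (Complex.differentiableOn_dslope (isOpen_ball.mem_nhds ha)).2 hf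
    have hsum : ∀ a ∈ ball (0 : ℂ) 1, f a = 0 → ∀ S : Finset ℂ, (∀ z ∈ S, ‖z‖ < 1) → a ∈ S →
        ∑ z ∈ S, analyticOrderAt f z = ∑ z ∈ S, analyticOrderAt (dslope f a) z + 1 := by
      intro a ha h0 S hS haS
      rw [Finset.sum_congr rfl fun z hz => analyticOrderAt_eq_dslope hf ha
        (mem_ball_zero_iff.2 (hS z hz)) h0, Finset.sum_add_distrib]
      simp [haS]
    constructor
    · rintro ⟨a, ha, h0, hN⟩
      obtain ⟨S, hS, hle⟩ := (ih (hd a ha)).1 hN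
      have hS' : ∀ z ∈ insert a S, ‖z‖ < 1 := by
        intro z hz
        rcases Finset.mem_insert.1 hz with rfl | hz
        · simpa using ha
        · exact hS z hz
      refine ⟨insert a S, hS', ?_⟩
      rw [hsum a ha h0 _ hS' (Finset.mem_insert_self _ _)]
      push_cast
      gcongr
      exact hle.trans (Finset.sum_le_sum_of_subset (Finset.subset_insert _ _))
    · rintro ⟨S, hS, hle⟩
      obtain ⟨a, haS, ha⟩ : ∃ a ∈ S, analyticOrderAt f a ≠ 0 := by
        by_contra! hcon
        rw [Finset.sum_eq_zero hcon] at hle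
        simp at hle
      have haD : a ∈ ball (0 : ℂ) 1 := mem_ball_zero_iff.2 (hS a haS)
      have h0 := apply_eq_zero_of_analyticOrderAt_ne_zero ha
      refine ⟨a, haD, h0, (ih (hd a haD)).2 ⟨S, hS, ?_⟩⟩
      rw [hsum a haD h0 S hS haS] at hle
      push_cast at hle
      exact (ENat.add_le_add_iff_right ENat.one_ne_top).1 hle

/-- Hurwitz's theorem with multiplicities: the number of zeros in the open unit disc is lower
semicontinuous under locally uniform convergence. -/
lemma HasZeros.eventually {N : ℕ} {ι : Type} {l : Filter ι} {F : ι → ℂ → ℂ} {f : ℂ → ℂ}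
    (hF : ∀ᶠ i in l, DifferentiableOn ℂ (F i) (ball 0 1)) (hf : DifferentiableOn ℂ f (ball 0 1))
    (hlim : TendstoLocallyUniformlyOn F f l (ball 0 1))
    (hord : ∀ z ∈ ball (0 : ℂ) 1, analyticOrderAt f z ≠ ⊤) (hN : HasZeros N f) :
    ∀ᶠ i in l, HasZeros N (F i) := by
  induction N generalizing ι f with
  | zero => exact Eventually.of_forall fun _ => trivial
  | succ N ih =>
    obtain ⟨a, ha, h0, hN⟩ := hN
    -- the pairs `(i, z)` with `z` a zero of `F i` near `a`
    set l' : Filter (ι × ℂ) := (l ×ˢ 𝓝 a) ⊓ 𝓟 {p | p.2 ∈ ball (0 : ℂ) 1 ∧ F p.1 p.2 = 0} with hl'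
    have hfst : Tendsto Prod.fst l' l := tendsto_fst.mono_left inf_le_left
    have hsnd : Tendsto Prod.snd l' (𝓝 a) := tendsto_snd.mono_left inf_le_left
    have hmem : ∀ᶠ p : ι × ℂ in l', p.2 ∈ ball (0 : ℂ) 1 ∧ F p.1 p.2 = 0 :=
      eventually_inf_principal.2 (Eventually.of_forall fun _ h => h)
    have hF' := hfst.eventually hF
    have hlim' : TendstoLocallyUniformlyOn (fun p : ι × ℂ => F p.1) f l' (ball 0 1) := by
      intro u hu x hx
      obtain ⟨t, ht, h⟩ := hlim u hu x hx
      exact ⟨t, ht, hfst.eventually h⟩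
    have key := ih (l := l') (F := fun p => dslope (F p.1) p.2) (f := dslope f a)
      (by
        filter_upwards [hF', hmem] with p hp hp'
        exact (Complex.differentiableOn_dslope (isOpen_ball.mem_nhds hp'.1)).2 hp)
      ((Complex.differentiableOn_dslope (isOpen_ball.mem_nhds ha)).2 hf)
      (tendstoLocallyUniformlyOn_dslope hF' hf hlim' hsnd ha (hmem.mono fun _ h => h.2) h0)
      (by
        intro z hz htop
        apply hord z hz
        rw [analyticOrderAt_eq_dslope hf ha hz h0, htop, top_add])
      hN
    rw [hl', eventually_inf_principal, eventually_prod_iff] at key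
    obtain ⟨p, hp, q, hq, hpq⟩ := key
    obtain ⟨ε, hε, hεq⟩ := Metric.eventually_nhds_iff.1 hq
    filter_upwards [hp, eventually_exists_zero_near isOpen_ball hF hf hlim ha h0 (hord a ha) hε]
      with i hi ⟨z, hz, hza, hz0⟩
    exact ⟨z, hz, hz0, hpq hi (hεq hza) ⟨hz, hz0⟩⟩

/-- Hurwitz's theorem for distinct zeros in an open set. -/
lemma eventually_le_encard_zeros {N : ℕ} {ι : Type*} {l : Filter ι} {F : ι → ℂ → ℂ} {f : ℂ → ℂ}
    {U : Set ℂ} (hU : IsOpen U)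
    (hF : ∀ᶠ i in l, DifferentiableOn ℂ (F i) U) (hf : DifferentiableOn ℂ f U)
    (hlim : TendstoLocallyUniformlyOn F f l U)
    (hord : ∀ z ∈ U, analyticOrderAt f z ≠ ⊤) (hN : (N : ℕ∞) ≤ {z | z ∈ U ∧ f z = 0}.encard) :
    ∀ᶠ i in l, (N : ℕ∞) ≤ {z | z ∈ U ∧ F i z = 0}.encard := by
  obtain ⟨T, hT, hTN⟩ := Set.exists_subset_encard_eq hN
  have hTfin : T.Finite := Set.finite_of_encard_eq_coe hTN
  obtain ⟨ε, hε, hsep⟩ : ∃ ε > 0, ∀ a ∈ T, ∀ b ∈ T, a ≠ b → 2 * ε ≤ dist a b := by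
    have := hTfin.to_subtype
    obtain ⟨C, hC, h⟩ := Set.relatively_discrete_of_finite (s := T)
    obtain ⟨c, hc, hcC⟩ := ENNReal.lt_iff_exists_real_btwn.1 hC
    have hc0 : 0 < c := ENNReal.ofReal_pos.1 hcC.1
    refine ⟨c / 2, by positivity, fun a ha b hb hab => ?_⟩
    have h1 := hcC.2.le.trans (h a ha b hb hab)
    rw [edist_dist, ENNReal.ofReal_le_ofReal_iff dist_nonneg] at h1
    linarith
  have hev : ∀ᶠ i in l, ∀ a ∈ T, ∃ z ∈ U, dist z a < ε ∧ F i z = 0 := by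
    rw [eventually_all_finite hTfin]
    intro a ha
    exact eventually_exists_zero_near hU hF hf hlim (hT ha).1 (hT ha).2 (hord a (hT ha).1) hε
  filter_upwards [hev] with i hi
  choose! g hgU hgd hg0 using hi
  have hinj : InjOn g T := by
    intro a ha b hb hab
    by_contra hne
    have h1 := hsep a ha b hb hne
    have h2 := dist_triangle_left a b (g a)
    have h3 := hgd a ha
    have h4 := hgd b hb
    rw [← hab] at h4
    linarith
  rw [← hTN, ← hinj.encard_image]
  apply Set.encard_le_encard
  rintro _ ⟨a, ha, rfl⟩
  exact ⟨hgU a ha, hg0 a ha⟩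

/-! ### Power series with bounded coefficients -/

/-- The function `z ↦ 1 - ∑ d_n z^{n+1}` attached to a digit sequence `d`. -/
def digitSeries (d : ℕ → ℝ) (z : ℂ) : ℂ := 1 - ∑' n, (d n : ℂ) * z ^ (n + 1)

lemma norm_digit_mul_pow_le {d : ℕ → ℝ} {B r : ℝ} (hd : ∀ n, |d n| ≤ B) {z : ℂ} (hz : ‖z‖ ≤ r)
    (n : ℕ) : ‖(d n : ℂ) * z ^ (n + 1)‖ ≤ B * r ^ (n + 1) := by
  rw [norm_mul, norm_pow, Complex.norm_real, Real.norm_eq_abs]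
  have := (abs_nonneg _).trans (hd 0)
  gcongr
  exact hd n

lemma summable_const_mul_pow_succ {B r : ℝ} (hr0 : 0 ≤ r) (hr : r < 1) :
    Summable fun n : ℕ => B * r ^ (n + 1) := by
  have := (summable_geometric_of_lt_one hr0 hr).mul_left (B * r)
  refine this.congr fun n => ?_
  ring

lemma summable_digit_mul_pow {d : ℕ → ℝ} {B : ℝ} (hd : ∀ n, |d n| ≤ B) {z : ℂ} (hz : ‖z‖ < 1) :
    Summable fun n => (d n : ℂ) * z ^ (n + 1) :=
  Summable.of_norm_bounded (summable_const_mul_pow_succ (norm_nonneg z) hz)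
    fun n => norm_digit_mul_pow_le hd le_rfl n

lemma differentiableOn_digitSeries {d : ℕ → ℝ} {B : ℝ} (hd : ∀ n, |d n| ≤ B) :
    DifferentiableOn ℂ (digitSeries d) (ball 0 1) := by
  intro z hz
  rw [mem_ball_zero_iff] at hz
  obtain ⟨r, hzr, hr⟩ := exists_between hz
  have h := Complex.differentiableOn_tsum_of_summable_norm
    (F := fun n (z : ℂ) => (d n : ℂ) * z ^ (n + 1)) (U := ball 0 r)
    (summable_const_mul_pow_succ (B := B) ((norm_nonneg z).trans hzr.le) hr)
    (fun n => by fun_prop) isOpen_ball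
    fun n w hw => norm_digit_mul_pow_le hd (mem_ball_zero_iff.1 hw).le n
  have h' := (h z (by simpa using hzr)).differentiableAt (isOpen_ball.mem_nhds (by simpa using hzr))
  exact ((differentiableAt_const 1).sub h').differentiableWithinAt

lemma digitSeries_zero (d : ℕ → ℝ) : digitSeries d 0 = 1 := by
  simp [digitSeries]

lemma analyticOrderAt_digitSeries_ne_top {d : ℕ → ℝ} {B : ℝ} (hd : ∀ n, |d n| ≤ B) {z : ℂ}
    (hz : z ∈ ball (0 : ℂ) 1) : analyticOrderAt (digitSeries d) z ≠ ⊤ := by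
  have han : AnalyticOnNhd ℂ (digitSeries d) (ball 0 1) :=
    (differentiableOn_digitSeries hd).analyticOnNhd isOpen_ball
  refine han.analyticOrderAt_ne_top_of_isPreconnected (x := 0)
    (convex_ball 0 1).isPreconnected (by simp) hz ?_
  have : analyticOrderAt (digitSeries d) 0 = 0 :=
    analyticOrderAt_eq_zero.2 (Or.inr (by simp [digitSeries_zero]))
  simp [this]

lemma tendstoLocallyUniformlyOn_digitSeries {ι : Type*} {l : Filter ι} {d : ι → ℕ → ℝ}
    {d₀ : ℕ → ℝ} {B : ℝ} (hd : ∀ᶠ i in l, ∀ n, |d i n| ≤ B) (hd₀ : ∀ n, |d₀ n| ≤ B)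
    (hlim : ∀ n, Tendsto (fun i => d i n) l (𝓝 (d₀ n))) :
    TendstoLocallyUniformlyOn (fun i => digitSeries (d i)) (digitSeries d₀) l (ball 0 1) := by
  rw [tendstoLocallyUniformlyOn_iff_forall_isCompact isOpen_ball]
  intro K hK hKc
  obtain ⟨r, hr, hr0, hKr⟩ : ∃ r < (1 : ℝ), 0 ≤ r ∧ ∀ z ∈ K, ‖z‖ ≤ r := by
    rcases K.eq_empty_or_nonempty with rfl | hne
    · exact ⟨0, one_pos, le_rfl, by simp⟩
    · obtain ⟨w, hw, hmax⟩ := hKc.exists_isMaxOn hne continuous_norm.continuousOn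
      exact ⟨‖w‖, by simpa using hK hw, norm_nonneg _, fun z hz => hmax hz⟩
  have hs : Tendsto (fun i => ∑' n, |d₀ n - d i n| * r ^ (n + 1)) l (𝓝 0) := by
    have h := tendsto_tsum_of_dominated_convergence (𝓕 := l)
      (f := fun i n => |d₀ n - d i n| * r ^ (n + 1)) (g := fun _ => 0)
      (bound := fun n => (2 * B) * r ^ (n + 1)) (summable_const_mul_pow_succ hr0 hr)
      (fun n => by
        have := (((tendsto_const_nhds (x := d₀ n)).sub (hlim n)).abs).mul_const (r ^ (n + 1))
        simpa using this)
      (by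
        filter_upwards [hd] with i hi n
        rw [Real.norm_eq_abs, abs_mul, abs_abs, abs_of_nonneg (pow_nonneg hr0 _)]
        gcongr
        have := abs_sub (d₀ n) (d i n)
        linarith [hd₀ n, hi n])
    simpa using h
  rw [Metric.tendstoUniformlyOn_iff]
  intro ε hε
  filter_upwards [hd, hs.eventually (gt_mem_nhds hε)] with i hi hlt z hz
  have hz1 : ‖z‖ < 1 := (hKr z hz).trans_lt hr
  have hdiff : ∀ n, |d₀ n - d i n| ≤ 2 * B := fun n => by
    have := abs_sub (d₀ n) (d i n)
    linarith [hd₀ n, hi n]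
  rw [dist_eq_norm, digitSeries, digitSeries, sub_sub_sub_cancel_left, norm_sub_rev,
    ← (summable_digit_mul_pow hd₀ hz1).tsum_sub (summable_digit_mul_pow hi hz1)]
  refine (tsum_of_norm_bounded (g := fun n => |d₀ n - d i n| * r ^ (n + 1)) (Summable.hasSum ?_)
    fun n => ?_).trans_lt hlt
  · refine Summable.of_nonneg_of_le (fun n => by positivity) (fun n => ?_)
      (summable_const_mul_pow_succ (B := 2 * B) hr0 hr)
    exact mul_le_mul_of_nonneg_right (hdiff n) (by positivity)
  · rw [← sub_mul, ← Complex.ofReal_sub, norm_mul, norm_pow, Complex.norm_real, Real.norm_eq_abs]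
    gcongr
    exact hKr z hz

lemma summable_mul_pow_of_abs_le_one {s : ℕ → ℝ} (hs : ∀ n, |s n| ≤ 1) {z : ℂ} (hz : ‖z‖ < 1) :
    Summable fun n => (s n : ℂ) * z ^ n := by
  refine Summable.of_norm_bounded (summable_geometric_of_lt_one (norm_nonneg z) hz) fun n => ?_
  rw [norm_mul, norm_pow, Complex.norm_real, Real.norm_eq_abs]
  exact mul_le_of_le_one_left (by positivity) (hs n)

/-- If the digits come from an orbit `s`, that is `d_n = β s_n - s_{n+1}`, then the digit series is
`(1 - βz) ∑ s_n zⁿ`. -/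
lemma digitSeries_of_orbit {β : ℝ} {s : ℕ → ℝ} (h0 : s 0 = 1) (hs : ∀ n, |s n| ≤ 1) {z : ℂ}
    (hz : ‖z‖ < 1) :
    digitSeries (fun n => β * s n - s (n + 1)) z = (1 - β * z) * ∑' n, (s n : ℂ) * z ^ n := by
  have hS := summable_mul_pow_of_abs_le_one hs hz
  have hS1 := (summable_nat_add_iff 1).2 hS
  have hd : ∀ n, ((β * s n - s (n + 1) : ℝ) : ℂ) * z ^ (n + 1) =
      (β * z) * ((s n : ℂ) * z ^ n) - (s (n + 1) : ℂ) * z ^ (n + 1) := by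
    intro n
    push_cast
    ring
  rw [digitSeries]
  simp only [hd]
  rw [(hS.mul_left _).tsum_sub hS1, tsum_mul_left, hS.tsum_eq_zero_add, h0]
  simp
  ring

/-! ### The orbit of `1` and its one-sided limits in `β` -/

/-- The orbit `τ_β^n(1)`, as a sequence of real numbers. -/
def orbit (β : ℝ) (n : ℕ) : ℝ := ((betaMap β)^[n] 1 : unitInterval)

/-- The orbit of `1` under the left-continuous version `x ↦ βx - (⌈βx⌉ - 1)` of the beta-map. -/
def leftOrbit (β : ℝ) : ℕ → ℝ
  | 0 => 1
  | n + 1 => β * leftOrbit β n - (⌈β * leftOrbit β n⌉ - 1)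

@[simp] lemma orbit_zero (β : ℝ) : orbit β 0 = 1 := rfl

lemma orbit_succ (β : ℝ) (n : ℕ) : orbit β (n + 1) = Int.fract (β * orbit β n) := by
  rw [orbit, Function.iterate_succ_apply']
  rfl

lemma orbit_nonneg (β : ℝ) (n : ℕ) : 0 ≤ orbit β n := ((betaMap β)^[n] 1).2.1

lemma orbit_le_one (β : ℝ) (n : ℕ) : orbit β n ≤ 1 := ((betaMap β)^[n] 1).2.2

lemma abs_orbit_le_one (β : ℝ) (n : ℕ) : |orbit β n| ≤ 1 :=
  abs_le.2 ⟨by linarith [orbit_nonneg β n], orbit_le_one β n⟩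

lemma leftOrbit_succ (β : ℝ) (n : ℕ) :
    leftOrbit β (n + 1) = β * leftOrbit β n - (⌈β * leftOrbit β n⌉ - 1) := rfl

lemma leftOrbit_pos (β : ℝ) (n : ℕ) : 0 < leftOrbit β n := by
  cases n with
  | zero => exact one_pos
  | succ n => rw [leftOrbit_succ]; linarith [Int.ceil_lt_add_one (β * leftOrbit β n)]

lemma leftOrbit_le_one (β : ℝ) (n : ℕ) : leftOrbit β n ≤ 1 := by
  cases n with
  | zero => exact le_rfl
  | succ n => rw [leftOrbit_succ]; linarith [Int.le_ceil (β * leftOrbit β n)]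

lemma abs_leftOrbit_le_one (β : ℝ) (n : ℕ) : |leftOrbit β n| ≤ 1 :=
  abs_le.2 ⟨by linarith [leftOrbit_pos β n], leftOrbit_le_one β n⟩

lemma digit_eq {β : ℝ} (hβ : 0 ≤ β) (n : ℕ) :
    (greedyDigit β 1 n : ℝ) = β * orbit β n - orbit β (n + 1) := by
  rw [orbit_succ, Int.self_sub_fract, greedyDigit, ← orbit,
    natCast_floor_eq_intCast_floor (mul_nonneg hβ (orbit_nonneg β n))]

lemma abs_mul_sub_le {β : ℝ} (hβ : 0 ≤ β) {x y : ℝ} (hx : |x| ≤ 1) (hy : |y| ≤ 1) :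
    |β * x - y| ≤ β + 1 := by
  have := abs_sub (β * x) y
  rw [abs_mul, abs_of_nonneg hβ] at this
  nlinarith

/-- The function of the theorem is the digit series of the greedy digits of `1`. -/
lemma one_sub_phi_eq {β : ℝ} (hβ : 1 < β) (z : ℂ) :
    1 - phi β (β * z) = digitSeries (fun n => β * orbit β n - orbit β (n + 1)) z := by
  have h0 : (β : ℂ) ≠ 0 := by
    have : β ≠ 0 := by linarith
    exact_mod_cast this
  rw [phi, digitSeries]
  congr 1
  refine tsum_congr fun n => ?_
  rw [← digit_eq (by linarith : (0 : ℝ) ≤ β), mul_pow]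
  push_cast
  field_simp

lemma differentiableOn_one_sub_phi {β : ℝ} (hβ : 1 < β) :
    DifferentiableOn ℂ (fun z : ℂ => 1 - phi β (β * z)) (ball 0 1) := by
  rw [funext fun z => one_sub_phi_eq hβ z]
  exact differentiableOn_digitSeries fun n =>
    abs_mul_sub_le (by linarith) (abs_orbit_le_one β n) (abs_orbit_le_one β (n + 1))

lemma tendsto_orbit_right {β : ℝ} (hβ : 1 < β) (n : ℕ) :
    Tendsto (fun γ => orbit γ n) (𝓝[≥] β) (𝓝[≥] (orbit β n)) := by
  induction n with
  | zero => exact tendsto_const_nhdsWithin (mem_Ici.2 (orbit_zero β).le)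
  | succ n ih =>
    have hprod : Tendsto (fun γ => γ * orbit γ n) (𝓝[≥] β) (𝓝 (β * orbit β n)) :=
      (tendsto_id.mono_left nhdsWithin_le_nhds).mul (ih.mono_right nhdsWithin_le_nhds)
    have hge : ∀ᶠ γ in 𝓝[≥] β, β * orbit β n ≤ γ * orbit γ n := by
      filter_upwards [self_mem_nhdsWithin, tendsto_nhdsWithin_iff.1 ih |>.2] with γ hγ hγ'
      exact mul_le_mul hγ hγ' (orbit_nonneg β n) (by linarith [mem_Ici.1 hγ])
    have hfl : ∀ᶠ γ in 𝓝[≥] β, ⌊γ * orbit γ n⌋ = ⌊β * orbit β n⌋ := by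
      filter_upwards [hge, hprod.eventually (gt_mem_nhds (Int.lt_floor_add_one (β * orbit β n)))]
        with γ h1 h2
      exact Int.floor_eq_iff.2 ⟨(Int.floor_le _).trans h1, h2⟩
    have heq : (fun γ => orbit γ (n + 1)) =ᶠ[𝓝[≥] β]
        fun γ => γ * orbit γ n - ⌊β * orbit β n⌋ := by
      filter_upwards [hfl] with γ hγ
      rw [orbit_succ, Int.fract, hγ]
    refine tendsto_nhdsWithin_iff.2 ⟨?_, ?_⟩
    · rw [tendsto_congr' heq, orbit_succ, Int.fract]
      exact hprod.sub_const _
    · filter_upwards [heq, hge] with γ h1 h2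
      rw [mem_Ici, h1, orbit_succ, Int.fract]
      linarith

lemma tendsto_orbit_left {β : ℝ} (hβ : 1 < β) (n : ℕ) :
    Tendsto (fun γ => orbit γ n) (𝓝[<] β) (𝓝[≤] (leftOrbit β n)) := by
  induction n with
  | zero => exact tendsto_const_nhdsWithin (mem_Iic.2 (le_refl (1 : ℝ)))
  | succ n ih =>
    have hprod : Tendsto (fun γ => γ * orbit γ n) (𝓝[<] β) (𝓝 (β * leftOrbit β n)) :=
      (tendsto_id.mono_left nhdsWithin_le_nhds).mul (ih.mono_right nhdsWithin_le_nhds)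
    have hlt : ∀ᶠ γ in 𝓝[<] β, γ * orbit γ n < β * leftOrbit β n := by
      filter_upwards [self_mem_nhdsWithin, tendsto_nhdsWithin_iff.1 ih |>.2,
        nhdsWithin_le_nhds (lt_mem_nhds hβ)] with γ hγ hγ' hγ1
      have hγ' : orbit γ n ≤ leftOrbit β n := hγ'
      have hγ : γ < β := hγ
      calc γ * orbit γ n ≤ γ * leftOrbit β n := by gcongr
        _ < _ := mul_lt_mul_of_pos_right hγ (leftOrbit_pos β n)
    have hfl : ∀ᶠ γ in 𝓝[<] β, ⌊γ * orbit γ n⌋ = ⌈β * leftOrbit β n⌉ - 1 := by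
      have h : ((⌈β * leftOrbit β n⌉ - 1 : ℤ) : ℝ) < β * leftOrbit β n := by
        push_cast
        linarith [Int.ceil_lt_add_one (β * leftOrbit β n)]
      filter_upwards [hlt, hprod.eventually (lt_mem_nhds h)] with γ h1 h2
      refine Int.floor_eq_iff.2 ⟨h2.le, h1.trans_le ?_⟩
      push_cast
      linarith [Int.le_ceil (β * leftOrbit β n)]
    have heq : (fun γ => orbit γ (n + 1)) =ᶠ[𝓝[<] β]
        fun γ => γ * orbit γ n - (⌈β * leftOrbit β n⌉ - 1) := by
      filter_upwards [hfl] with γ hγ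
      rw [orbit_succ, Int.fract, hγ]
      push_cast
      ring
    refine tendsto_nhdsWithin_iff.2 ⟨?_, ?_⟩
    · rw [tendsto_congr' heq, leftOrbit_succ]
      exact hprod.sub_const _
    · filter_upwards [heq, hlt] with γ h1 h2
      rw [mem_Iic, h1, leftOrbit_succ]
      linarith

lemma leftOrbit_eq_orbit {β : ℝ} {n : ℕ} (h : ∀ k ≤ n, orbit β k ≠ 0) :
    leftOrbit β n = orbit β n := by
  induction n with
  | zero => rfl
  | succ n ih =>
    have hn := h (n + 1) le_rfl
    rw [leftOrbit_succ, ih fun k hk => h k (hk.trans n.le_succ), orbit_succ]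
    rw [orbit_succ] at hn
    have : ⌈β * orbit β n⌉ = ⌊β * orbit β n⌋ + 1 := by
      rw [Int.ceil_eq_iff]
      have h1 : 0 < Int.fract (β * orbit β n) := lt_of_le_of_ne (Int.fract_nonneg _) hn.symm
      rw [Int.fract] at h1
      push_cast
      exact ⟨by linarith, (Int.lt_floor_add_one _).le⟩
    rw [this, Int.fract]
    push_cast
    ring

lemma orbit_eq_zero_of_le {β : ℝ} {m n : ℕ} (hm : orbit β m = 0) (hmn : m ≤ n) :
    orbit β n = 0 := by
  induction n, hmn using Nat.le_induction with
  | base => exact hm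
  | succ n _ ih => rw [orbit_succ, ih]; simp

/-- The generating functions of the orbit of `1` and of its left limit have the same zeros in the
disc: they agree if the orbit never hits `0`; if it first does so at time `m`, then the left limit is
`m`-periodic, so that the two differ by the factor `1 - z^m`. -/
lemma exists_tsum_orbit_eq_mul (β : ℝ) :
    ∃ u : ℂ → ℂ, Differentiable ℂ u ∧ (∀ z : ℂ, ‖z‖ < 1 → u z ≠ 0) ∧ ∀ z : ℂ, ‖z‖ < 1 →
      ∑' n, (orbit β n : ℂ) * z ^ n = u z * ∑' n, (leftOrbit β n : ℂ) * z ^ n := by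
  classical
  by_cases hex : ∃ n, orbit β n = 0
  · set m := Nat.find hex with hm
    have hm0 : orbit β m = 0 := Nat.find_spec hex
    have hlt : ∀ k < m, orbit β k ≠ 0 := fun k hk => Nat.find_min hex hk
    have hpos : m ≠ 0 := by
      intro h
      rw [h] at hm0
      simp at hm0
    obtain ⟨j, hj⟩ := Nat.exists_eq_succ_of_ne_zero hpos
    have heq : ∀ k < m, leftOrbit β k = orbit β k := fun k hk =>
      leftOrbit_eq_orbit fun i hi => hlt i (hi.trans_lt hk)
    have hm1 : leftOrbit β m = 1 := by
      rw [hj, leftOrbit_succ, heq j (by omega)]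
      rw [hj, orbit_succ, Int.fract_eq_zero_iff] at hm0
      obtain ⟨k, hk⟩ := hm0
      rw [← hk]
      simp
    have hper : ∀ n, leftOrbit β (n + m) = leftOrbit β n := by
      intro n
      induction n with
      | zero => simpa [leftOrbit] using hm1
      | succ n ih => rw [add_right_comm, leftOrbit_succ, ih, leftOrbit_succ]
    refine ⟨fun z => 1 - z ^ m, by fun_prop, fun z hz h => ?_, fun z hz => ?_⟩
    · have h1 : ‖z ^ m‖ < 1 := by
        rw [norm_pow]
        exact pow_lt_one₀ (norm_nonneg z) hz hpos
      rw [← sub_eq_zero.1 h, norm_one] at h1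
      exact lt_irrefl _ h1
    · have hS := summable_mul_pow_of_abs_le_one (abs_leftOrbit_le_one β) hz
      have h1 : ∑' n, (orbit β n : ℂ) * z ^ n =
          ∑ n ∈ Finset.range m, (leftOrbit β n : ℂ) * z ^ n := by
        rw [tsum_eq_sum (s := Finset.range m)]
        · exact Finset.sum_congr rfl fun n hn => by rw [heq n (Finset.mem_range.1 hn)]
        · intro n hn
          rw [orbit_eq_zero_of_le hm0 (by simpa using hn)]
          simp
      have h2 := hS.sum_add_tsum_nat_add m
      simp only [hper, pow_add, ← mul_assoc] at h2
      rw [tsum_mul_right] at h2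
      rw [h1]
      linear_combination h2
  · push Not at hex
    refine ⟨fun _ => 1, by fun_prop, fun _ _ => one_ne_zero, fun z _ => ?_⟩
    rw [one_mul]
    exact tsum_congr fun n => by rw [leftOrbit_eq_orbit fun k _ => hex k]

/-! ### The sets of `β` with many zeros are open -/

/-- The zeros of `1 - φ_β(βz)` in the disc do not see the discontinuity of the greedy digits in `β`:
the limits of these functions from both sides have the same zeros as the function itself. -/
lemma exists_one_sided_limits {β : ℝ} (hβ : 1 < β) :
    TendstoLocallyUniformlyOn (fun (γ : ℝ) (z : ℂ) => 1 - phi γ (γ * z))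
      (fun z => 1 - phi β (β * z)) (𝓝[≥] β) (ball 0 1) ∧
    ∃ f : ℂ → ℂ, DifferentiableOn ℂ f (ball 0 1) ∧
      TendstoLocallyUniformlyOn (fun (γ : ℝ) (z : ℂ) => 1 - phi γ (γ * z)) f (𝓝[<] β) (ball 0 1) ∧
      ∀ z ∈ ball (0 : ℂ) 1, analyticOrderAt f z = analyticOrderAt (fun z : ℂ => 1 - phi β (β * z)) z := by
  have hnear : ∀ᶠ γ in 𝓝 β, 1 < γ ∧ γ < β + 1 := (lt_mem_nhds hβ).and (gt_mem_nhds (by linarith))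
  have hbd : ∀ᶠ γ in 𝓝 β, ∀ n, |γ * orbit γ n - orbit γ (n + 1)| ≤ β + 2 := by
    filter_upwards [hnear] with γ hγ n
    have := abs_mul_sub_le (by linarith : 0 ≤ γ) (abs_orbit_le_one γ n) (abs_orbit_le_one γ (n + 1))
    linarith
  have hbd' : ∀ n, |β * leftOrbit β n - leftOrbit β (n + 1)| ≤ β + 2 := fun n => by
    have := abs_mul_sub_le (by linarith : 0 ≤ β) (abs_leftOrbit_le_one β n)
      (abs_leftOrbit_le_one β (n + 1))
    linarith
  have hgreedy : ∀ l : Filter ℝ, l ≤ 𝓝 β → ∀ {f : ℂ → ℂ}, TendstoLocallyUniformlyOn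
      (fun γ => digitSeries fun n => γ * orbit γ n - orbit γ (n + 1)) f l (ball 0 1) →
      TendstoLocallyUniformlyOn (fun (γ : ℝ) (z : ℂ) => 1 - phi γ (γ * z)) f l (ball 0 1) := by
    intro l hl f h u hu x hx
    obtain ⟨t, ht, h'⟩ := h u hu x hx
    refine ⟨t, ht, ?_⟩
    filter_upwards [h', hl hnear] with γ hγ hγ1 z hz
    rw [one_sub_phi_eq hγ1.1]
    exact hγ z hz
  refine ⟨hgreedy _ nhdsWithin_le_nhds ?_, _, differentiableOn_digitSeries hbd',
    hgreedy _ nhdsWithin_le_nhds (tendstoLocallyUniformlyOn_digitSeries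
      (nhdsWithin_le_nhds hbd) hbd' fun n => ?_), ?_⟩
  · rw [funext fun z => one_sub_phi_eq hβ z]
    refine tendstoLocallyUniformlyOn_digitSeries (nhdsWithin_le_nhds hbd) hbd.self_of_nhds fun n => ?_
    exact ((tendsto_id.mono_left nhdsWithin_le_nhds).mul
      ((tendsto_orbit_right hβ n).mono_right nhdsWithin_le_nhds)).sub
      ((tendsto_orbit_right hβ (n + 1)).mono_right nhdsWithin_le_nhds)
  · exact ((tendsto_id.mono_left nhdsWithin_le_nhds).mul
      ((tendsto_orbit_left hβ n).mono_right nhdsWithin_le_nhds)).sub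
      ((tendsto_orbit_left hβ (n + 1)).mono_right nhdsWithin_le_nhds)
  · intro z hz
    obtain ⟨u, hu, hu0, hueq⟩ := exists_tsum_orbit_eq_mul β
    have heq : (fun z : ℂ => 1 - phi β (β * z)) =ᶠ[𝓝 z]
        u * digitSeries fun n => β * leftOrbit β n - leftOrbit β (n + 1) := by
      filter_upwards [isOpen_ball.mem_nhds hz] with w hw
      have hw1 : ‖w‖ < 1 := by simpa using hw
      rw [one_sub_phi_eq hβ, Pi.mul_apply, digitSeries_of_orbit (orbit_zero β) (abs_orbit_le_one β) hw1,
        digitSeries_of_orbit rfl (abs_leftOrbit_le_one β) hw1, hueq w hw1]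
      ring
    have hua : AnalyticAt ℂ u z := hu.analyticAt z
    rw [analyticOrderAt_congr heq, analyticOrderAt_mul hua
      ((differentiableOn_digitSeries hbd').analyticAt (isOpen_ball.mem_nhds hz)),
      hua.analyticOrderAt_eq_zero.2 (hu0 z (by simpa using hz)), zero_add]

lemma analyticOrderAt_one_sub_phi_ne_top {β : ℝ} (hβ : 1 < β) {z : ℂ} (hz : z ∈ ball (0 : ℂ) 1) :
    analyticOrderAt (fun z : ℂ => 1 - phi β (β * z)) z ≠ ⊤ := by
  rw [funext fun z => one_sub_phi_eq hβ z]
  exact analyticOrderAt_digitSeries_ne_top (fun n => abs_mul_sub_le (by linarith : 0 ≤ β)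
    (abs_orbit_le_one β n) (abs_orbit_le_one β (n + 1))) hz

/-- A property of holomorphic functions on the disc that depends only on the orders of the zeros and
is stable under small perturbations holds for an open set of parameters. -/
lemma isOpen_of_stable {P : (ℂ → ℂ) → Prop}
    (hcongr : ∀ f g : ℂ → ℂ, DifferentiableOn ℂ f (ball 0 1) → DifferentiableOn ℂ g (ball 0 1) →
      (∀ z ∈ ball (0 : ℂ) 1, analyticOrderAt f z = analyticOrderAt g z) → P f → P g)
    (hstable : ∀ (l : Filter ℝ) (F : ℝ → ℂ → ℂ) (f : ℂ → ℂ),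
      (∀ᶠ γ in l, DifferentiableOn ℂ (F γ) (ball 0 1)) → DifferentiableOn ℂ f (ball 0 1) →
      TendstoLocallyUniformlyOn F f l (ball 0 1) →
      (∀ z ∈ ball (0 : ℂ) 1, analyticOrderAt f z ≠ ⊤) → P f → ∀ᶠ γ in l, P (F γ)) :
    IsOpen {β : Ioi (1 : ℝ) | P fun z : ℂ => 1 - phi β (β * z)} := by
  rw [isOpen_iff_mem_nhds]
  rintro ⟨β, hβ⟩ hP
  have hβ' : 1 < β := hβ
  have hP : P fun z : ℂ => 1 - phi β (β * z) := hP
  obtain ⟨hright, f, hf, hleft, hord⟩ := exists_one_sided_limits hβ'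
  have hdiff : ∀ᶠ γ : ℝ in 𝓝 β, DifferentiableOn ℂ (fun z : ℂ => 1 - phi γ (γ * z)) (ball 0 1) := by
    filter_upwards [lt_mem_nhds hβ'] with γ hγ using differentiableOn_one_sub_phi hγ
  have h0 := differentiableOn_one_sub_phi hβ'
  have key : ∀ᶠ γ : ℝ in 𝓝 β, P fun z : ℂ => 1 - phi γ (γ * z) := by
    rw [← nhdsLT_sup_nhdsGE, eventually_sup]
    constructor
    · exact hstable _ _ _ (nhdsWithin_le_nhds hdiff) hf hleft
        (fun z hz => by rw [hord z hz]; exact analyticOrderAt_one_sub_phi_ne_top hβ' hz)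
        (hcongr _ _ h0 hf (fun z hz => (hord z hz).symm) hP)
    · exact hstable _ _ _ (nhdsWithin_le_nhds hdiff) h0 hright
        (fun z hz => analyticOrderAt_one_sub_phi_ne_top hβ' hz) hP
  exact (continuous_subtype_val.continuousAt (x := (⟨β, hβ⟩ : Ioi (1 : ℝ)))).eventually key

lemma isOpen_le_encard_zeros (N : ℕ) :
    IsOpen {β : Ioi (1 : ℝ) | (N : ℕ∞) ≤ {z : ℂ | ‖z‖ < 1 ∧ 1 - phi β (β * z) = 0}.encard} := by
  have := isOpen_of_stable (P := fun f => (N : ℕ∞) ≤ {z : ℂ | z ∈ ball (0 : ℂ) 1 ∧ f z = 0}.encard)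
    (by
      intro f g hf hg hfg hP
      refine hP.trans (Set.encard_le_encard fun z hz => ⟨hz.1, ?_⟩)
      have h1 : analyticOrderAt f z ≠ 0 :=
        (hf.analyticAt (isOpen_ball.mem_nhds hz.1)).analyticOrderAt_ne_zero.2 hz.2
      rw [hfg z hz.1] at h1
      exact apply_eq_zero_of_analyticOrderAt_ne_zero h1)
    (fun l F f hF hf hlim hord hP => eventually_le_encard_zeros isOpen_ball hF hf hlim hord hP)
  simpa only [mem_ball_zero_iff] using this

lemma isOpen_le_sum_analyticOrderAt (N : ℕ) :
    IsOpen {β : Ioi (1 : ℝ) | ∃ S : Finset ℂ, (∀ z ∈ S, ‖z‖ < 1) ∧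
      (N : ℕ∞) ≤ ∑ z ∈ S, analyticOrderAt (fun w : ℂ => 1 - phi β (β * w)) z} := by
  have := isOpen_of_stable (P := HasZeros N)
    (by
      intro f g hf hg hfg hP
      obtain ⟨S, hS, hle⟩ := (hasZeros_iff hf).1 hP
      refine (hasZeros_iff hg).2 ⟨S, hS, hle.trans_eq ?_⟩
      exact Finset.sum_congr rfl fun z hz => hfg z (mem_ball_zero_iff.2 (hS z hz)))
    (fun l F f hF hf hlim hord hP => HasZeros.eventually hF hf hlim hord hP)
  convert this using 2
  ext β
  exact (hasZeros_iff (differentiableOn_one_sub_phi β.2)).symm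

lemma exists_finset_of_le_encard_zeros {N : ℕ} {β : ℝ} (hβ : 1 < β)
    (h : (N : ℕ∞) ≤ {z : ℂ | ‖z‖ < 1 ∧ 1 - phi β (β * z) = 0}.encard) :
    ∃ S : Finset ℂ, (∀ z ∈ S, ‖z‖ < 1) ∧
      (N : ℕ∞) ≤ ∑ z ∈ S, analyticOrderAt (fun w : ℂ => 1 - phi β (β * w)) z := by
  obtain ⟨T, hT, hTN⟩ := Set.exists_subset_encard_eq h
  have hTfin : T.Finite := Set.finite_of_encard_eq_coe hTN
  refine ⟨hTfin.toFinset, fun z hz => (hT (by simpa using hz)).1, ?_⟩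
  have hcard : (N : ℕ∞) = ∑ z ∈ hTfin.toFinset, (1 : ℕ∞) := by
    rw [← hTN, hTfin.encard_eq_coe_toFinset_card]
    simp
  rw [hcard]
  refine Finset.sum_le_sum fun z hz => ?_
  have hz' := hT (by simpa using hz : z ∈ T)
  rw [Order.one_le_iff_ne_zero]
  exact ((differentiableOn_one_sub_phi hβ).analyticAt
    (isOpen_ball.mem_nhds (mem_ball_zero_iff.2 hz'.1))).analyticOrderAt_ne_zero.2 hz'.2

/-! ### Parameters for which the orbit of `1` hits `0` are dense -/

/-- If the orbit of `1` avoided `0` for all parameters in `[c, d]`, then its digits would be constant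
there, and `τ_d^n(1) - τ_c^n(1)` would grow exponentially. -/
lemma exists_orbit_eq_zero {c d : ℝ} (hc : 1 < c) (hcd : c < d) :
    ∃ β ∈ Icc c d, ∃ n, orbit β n = 0 := by
  by_contra! hne
  have hfloor : ∀ n, ContinuousOn (fun β => orbit β n) (Icc c d) →
      ∀ β ∈ Icc c d, ⌊β * orbit β n⌋ = ⌊c * orbit c n⌋ := by
    intro n hn β hβ
    have hcont : ContinuousOn (fun β => β * orbit β n) (Icc c β) :=
      (continuousOn_id.mul hn).mono (Icc_subset_Icc_right hβ.2)
    -- an integer value of `x * orbit x n` would make `orbit x (n + 1)` vanish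
    have hint : ∀ k : ℤ, (k : ℝ) ∉ (fun β => β * orbit β n) '' Icc c β := by
      rintro k ⟨x, hx, hxk⟩
      apply hne x ⟨hx.1, hx.2.trans hβ.2⟩ (n + 1)
      rw [orbit_succ, show x * orbit x n = k from hxk, Int.fract_intCast]
    rcases lt_trichotomy ⌊β * orbit β n⌋ ⌊c * orbit c n⌋ with h | h | h
    · refine absurd (intermediate_value_Icc' hβ.1 hcont ⟨?_, Int.floor_le _⟩) (hint ⌊c * orbit c n⌋)
      have h1 := Int.lt_floor_add_one (β * orbit β n)
      have h2 : (⌊β * orbit β n⌋ : ℝ) + 1 ≤ ⌊c * orbit c n⌋ := by exact_mod_cast h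
      exact (h1.trans_le h2).le
    · exact h
    · refine absurd (intermediate_value_Icc hβ.1 hcont ⟨?_, Int.floor_le _⟩) (hint ⌊β * orbit β n⌋)
      have h1 := Int.lt_floor_add_one (c * orbit c n)
      have h2 : (⌊c * orbit c n⌋ : ℝ) + 1 ≤ ⌊β * orbit β n⌋ := by exact_mod_cast h
      exact (h1.trans_le h2).le
  have hsucc : ∀ n, ContinuousOn (fun β => orbit β n) (Icc c d) →
      ∀ β ∈ Icc c d, orbit β (n + 1) = β * orbit β n - ⌊c * orbit c n⌋ := by
    intro n hn β hβ
    rw [orbit_succ, Int.fract, hfloor n hn β hβ]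
  have hcont : ∀ n, ContinuousOn (fun β => orbit β n) (Icc c d) := by
    intro n
    induction n with
    | zero => exact continuousOn_const
    | succ n ih =>
      refine ContinuousOn.congr (f := fun β => β * orbit β n - ⌊c * orbit c n⌋) ?_ (hsucc n ih)
      exact (continuousOn_id.mul ih).sub continuousOn_const
  have hcI : c ∈ Icc c d := left_mem_Icc.2 hcd.le
  have hdI : d ∈ Icc c d := right_mem_Icc.2 hcd.le
  have hgrow : ∀ n, c ^ n * (d - c) ≤ orbit d (n + 1) - orbit c (n + 1) := by
    intro n
    rw [hsucc n (hcont n) d hdI, hsucc n (hcont n) c hcI]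
    induction n with
    | zero =>
      simp only [orbit_zero, pow_zero, one_mul, mul_one]
      linarith
    | succ n ih =>
      rw [← hsucc n (hcont n) d hdI, ← hsucc n (hcont n) c hcI] at ih
      have h1 := mul_le_mul_of_nonneg_left ih (by linarith : 0 ≤ c)
      have h2 := mul_nonneg (sub_nonneg.2 hcd.le) (orbit_nonneg d (n + 1))
      rw [pow_succ]
      nlinarith
  obtain ⟨n, hn⟩ := pow_unbounded_of_one_lt (1 / (d - c)) hc
  rw [div_lt_iff₀ (sub_pos.2 hcd)] at hn
  have := hgrow n
  linarith [orbit_le_one d (n + 1), orbit_nonneg c (n + 1)]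

/-! ### Prolonging a finite expansion of `1` -/

/-- The `n`-th point of the orbit of `1` under the digits of `β`, as a polynomial in the base `γ`. -/
def prefixPoly (β : ℝ) : ℕ → ℝ → ℝ
  | 0, _ => 1
  | n + 1, γ => γ * prefixPoly β n γ - greedyDigit β 1 n

lemma continuous_prefixPoly (β : ℝ) (n : ℕ) : Continuous (prefixPoly β n) := by
  induction n with
  | zero => exact continuous_const
  | succ n ih => exact (continuous_id.mul ih).sub continuous_const

lemma prefixPoly_eq_orbit {β γ : ℝ} (hγ : 0 ≤ γ) {n : ℕ}
    (h : ∀ k < n, greedyDigit γ 1 k = greedyDigit β 1 k) : prefixPoly β n γ = orbit γ n := by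
  induction n with
  | zero => rfl
  | succ n ih =>
    rw [prefixPoly, ih fun k hk => h k (hk.trans n.lt_succ_self), ← h n n.lt_succ_self, digit_eq hγ]
    ring

lemma orbit_lt_prefixPoly {β γ : ℝ} (hβ : 1 < β) (hγ : β < γ) (n : ℕ) :
    orbit β (n + 1) < prefixPoly β (n + 1) γ := by
  rw [← prefixPoly_eq_orbit (β := β) (by linarith) fun _ _ => rfl]
  induction n with
  | zero => simpa [prefixPoly] using hγ
  | succ n ih =>
    have h0 : 0 ≤ prefixPoly β (n + 1) β := by
      rw [prefixPoly_eq_orbit (by linarith) fun _ _ => rfl]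
      exact orbit_nonneg _ _
    have : β * prefixPoly β (n + 1) β < γ * prefixPoly β (n + 1) γ :=
      mul_lt_mul'' hγ ih (by linarith) h0
    exact sub_lt_sub_right this _

lemma eventually_greedyDigit_eq {β : ℝ} (hβ : 1 < β) (n : ℕ) :
    ∀ᶠ γ in 𝓝[≥] β, greedyDigit γ 1 n = greedyDigit β 1 n := by
  have hlim : Tendsto (fun γ => γ * orbit γ n - orbit γ (n + 1)) (𝓝[≥] β)
      (𝓝 (β * orbit β n - orbit β (n + 1))) :=
    ((tendsto_id.mono_left nhdsWithin_le_nhds).mul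
      ((tendsto_orbit_right hβ n).mono_right nhdsWithin_le_nhds)).sub
      ((tendsto_orbit_right hβ (n + 1)).mono_right nhdsWithin_le_nhds)
  filter_upwards [Metric.tendsto_nhds.1 hlim 1 one_pos,
    nhdsWithin_le_nhds (lt_mem_nhds hβ)] with γ h1 h2
  have h2 : 1 < γ := h2
  rw [← digit_eq (by linarith), ← digit_eq (by linarith), Nat.dist_cast_real] at h1
  have h3 : dist (greedyDigit γ 1 n) (greedyDigit β 1 n) = 0 := by
    rw [Nat.dist_eq] at h1 ⊢
    have : |((greedyDigit γ 1 n : ℤ) - (greedyDigit β 1 n : ℤ))| < 1 := by exact_mod_cast h1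
    rw [Int.abs_lt_one_iff] at this
    have h4 : (greedyDigit γ 1 n : ℝ) = greedyDigit β 1 n := by
      exact_mod_cast (sub_eq_zero.1 this)
    simp [h4]
  exact dist_eq_zero.1 h3

/-- Near any parameter there are parameters `γ` for which the greedy expansion of `1` is a fixed finite
word, followed by a block of zeros of arbitrary length, followed by the word `0…01` repeated
periodically. For these `1 - φ_γ(γz)` vanishes where `G(z) = z^K`, with `G` independent of `K`. -/
lemma exists_family {c d : ℝ} (hc : 1 < c) (hcd : c < d) :
    ∃ G : ℂ → ℂ, Differentiable ℂ G ∧ G 1 = 0 ∧ G 0 = 1 ∧ ∃ K₀ : ℕ, ∀ K ≥ K₀, ∃ γ ∈ Ioo c d,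
      ∀ z : ℂ, ‖z‖ < 1 → G z = z ^ K → 1 - phi γ (γ * z) = 0 := by
  obtain ⟨β, ⟨hcβ, hβd⟩, m, hm⟩ := exists_orbit_eq_zero hc (left_lt_add_div_two.2 hcd)
  have hβd : β < d := hβd.trans_lt (add_div_two_lt_right.2 hcd)
  have hβ : 1 < β := hc.trans_le hcβ
  obtain ⟨m, rfl⟩ : ∃ k, m = k + 1 := Nat.exists_eq_succ_of_ne_zero (by rintro rfl; simp at hm)
  obtain ⟨η, hη, hdig⟩ : ∃ η > 0, ∀ γ, β ≤ γ → γ < β + η →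
      ∀ k < m + 1, greedyDigit γ 1 k = greedyDigit β 1 k := by
    have hev : ∀ᶠ γ in 𝓝[≥] β, ∀ k ∈ Iio (m + 1), greedyDigit γ 1 k = greedyDigit β 1 k :=
      (eventually_all_finite (finite_Iio (m + 1))).2 fun k _ => eventually_greedyDigit_eq hβ k
    obtain ⟨u, hu, hsub⟩ := mem_nhdsGE_iff_exists_Ico_subset.1 hev
    exact ⟨u - β, sub_pos.2 hu, fun γ h1 h2 => hsub ⟨h1, by linarith⟩⟩
  obtain ⟨γ₂, hγ₂, hγ₂'⟩ := exists_between (lt_min hβd (lt_add_of_pos_right β hη))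
  have hγ₂d : γ₂ < d := hγ₂'.trans_le (min_le_left _ _)
  have hγ₂η : γ₂ < β + η := hγ₂'.trans_le (min_le_right _ _)
  -- the period `P + 1`: the orbit of `1 / (γ^(P+1) - 1)` stays below `1` for `P` steps
  obtain ⟨P, hP⟩ := pow_unbounded_of_one_lt (1 / (β - 1)) hβ
  rw [div_lt_iff₀ (sub_pos.2 hβ)] at hP
  have hper : ∀ γ, β ≤ γ → 0 < γ ^ (P + 1) - 1 ∧ γ ^ P / (γ ^ (P + 1) - 1) < 1 := by
    intro γ hγ
    have h1 : 1 < γ ^ P * (γ - 1) := by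
      exact hP.trans_le (mul_le_mul (pow_le_pow_left₀ (by linarith) hγ P) (by linarith)
        (by linarith) (pow_nonneg (by linarith) P))
    have h2 : 1 ≤ γ ^ P := one_le_pow₀ (by linarith)
    have h3 : γ ^ P < γ ^ (P + 1) - 1 := by
      rw [pow_succ]
      linarith
    have h4 : 0 < γ ^ (P + 1) - 1 := by linarith
    exact ⟨h4, (div_lt_one h4).2 h3⟩
  have hpos₂ : 0 < prefixPoly β (m + 1) γ₂ := hm ▸ orbit_lt_prefixPoly hβ hγ₂ m
  obtain ⟨M₀, hM₀⟩ := pow_unbounded_of_one_lt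
    (1 / (prefixPoly β (m + 1) γ₂ * (γ₂ ^ (P + 1) - 1))) (hβ.trans hγ₂)
  rw [div_lt_iff₀ (mul_pos hpos₂ (hper γ₂ hγ₂.le).1)] at hM₀
  refine ⟨fun z => (1 - z ^ (P + 1)) *
    (1 - ∑ k ∈ Finset.range (m + 1), (greedyDigit β 1 k : ℂ) * z ^ (k + 1)), by fun_prop,
    by simp, by simp, m + 1 + M₀ + (P + 1), fun K hK => ?_⟩
  obtain ⟨M, hMM, rfl⟩ : ∃ M ≥ M₀, K = m + 1 + M + (P + 1) :=
    ⟨K - (m + 1) - (P + 1), by omega, by omega⟩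
  obtain ⟨γ, hγI, hγ⟩ : (1 : ℝ) ∈ (fun γ => γ ^ M * prefixPoly β (m + 1) γ * (γ ^ (P + 1) - 1)) ''
      Icc β γ₂ := by
    refine intermediate_value_Icc hγ₂.le ?_ ⟨?_, ?_⟩
    · have := continuous_prefixPoly β (m + 1)
      exact Continuous.continuousOn (by fun_prop)
    · change β ^ M * prefixPoly β (m + 1) β * (β ^ (P + 1) - 1) ≤ 1
      rw [prefixPoly_eq_orbit (by linarith) fun _ _ => rfl, hm]
      simp
    · change 1 ≤ γ₂ ^ M * prefixPoly β (m + 1) γ₂ * (γ₂ ^ (P + 1) - 1)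
      rw [mul_assoc]
      refine hM₀.le.trans ?_
      have := mul_pos hpos₂ (hper γ₂ hγ₂.le).1
      gcongr
      linarith
  have hγ : γ ^ M * prefixPoly β (m + 1) γ * (γ ^ (P + 1) - 1) = 1 := hγ
  have hγβ : β < γ := by
    refine lt_of_le_of_ne hγI.1 ?_
    rintro rfl
    rw [prefixPoly_eq_orbit (by linarith) fun _ _ => rfl, hm] at hγ
    simp at hγ
  refine ⟨γ, ⟨hcβ.trans_lt hγβ, hγI.2.trans_lt hγ₂d⟩, fun z hz hG => ?_⟩
  have hγ1 : 1 < γ := hβ.trans hγβ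
  have hγ0 : 0 ≤ γ := by linarith
  have hdigγ := hdig γ hγβ.le (hγI.2.trans_lt hγ₂η)
  have horb : orbit γ (m + 1) = prefixPoly β (m + 1) γ := (prefixPoly_eq_orbit hγ0 hdigγ).symm
  obtain ⟨hQ, hQ1⟩ := hper γ hγβ.le
  set y := 1 / (γ ^ (P + 1) - 1) with hy
  have hy0 : 0 < y := by positivity
  have hMy : γ ^ M * orbit γ (m + 1) = y := by
    rw [hy, eq_div_iff hQ.ne', horb, hγ]
  have hPy : γ ^ P * y < 1 := by
    rw [hy, mul_one_div]
    exact hQ1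
  have hy1 : y < 1 := by
    refine lt_of_le_of_lt ?_ hPy
    exact le_mul_of_one_le_left hy0.le (one_le_pow₀ hγ1.le)
  -- an orbit point is multiplied by `γ` as long as the result is below `1`
  have hstep : ∀ k j, γ ^ j * orbit γ k < 1 → ∀ i ≤ j, orbit γ (k + i) = γ ^ i * orbit γ k := by
    intro k j hj i hi
    induction i with
    | zero => simp
    | succ i ih =>
      have hlt : γ ^ (i + 1) * orbit γ k < 1 := by
        refine lt_of_le_of_lt ?_ hj
        have := orbit_nonneg γ k
        gcongr
        exact hγ1.le
      rw [← add_assoc, orbit_succ, ih (by omega), ← mul_assoc, ← pow_succ']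
      exact Int.fract_eq_self.2 ⟨mul_nonneg (by positivity) (orbit_nonneg γ k), hlt⟩
  have hzero : ∀ k j, γ ^ j * orbit γ k < 1 → ∀ i < j,
      γ * orbit γ (k + i) - orbit γ (k + i + 1) = 0 := by
    intro k j hj i hi
    rw [add_assoc, hstep k j hj i hi.le, hstep k j hj (i + 1) hi, pow_succ]
    ring
  have hyM : orbit γ (m + 1 + M) = y := by
    rw [hstep (m + 1) M (by rw [hMy]; exact hy1) M le_rfl, hMy]
  set k₀ := m + 1 + M with hk₀
  have hPy' : γ ^ P * orbit γ k₀ < 1 := by rw [hyM]; exact hPy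
  have hγy : γ ^ (P + 1) * y = 1 + y := by
    rw [hy]
    field_simp
    ring
  have hret : orbit γ (k₀ + (P + 1)) = y := by
    rw [← add_assoc, orbit_succ, hstep k₀ P hPy' P le_rfl, hyM, ← mul_assoc, ← pow_succ', hγy,
      add_comm, Int.fract_add_one]
    exact Int.fract_eq_self.2 ⟨hy0.le, hy1⟩
  have hperiod : ∀ n, orbit γ (n + (P + 1) + k₀) = orbit γ (n + k₀) := by
    intro n
    induction n with
    | zero => rw [zero_add, zero_add, add_comm, hret, hyM]
    | succ n ih =>
      rw [show n + 1 + (P + 1) + k₀ = n + (P + 1) + k₀ + 1 by ring, orbit_succ, ih,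
        show n + 1 + k₀ = n + k₀ + 1 by ring, orbit_succ]
  set D : ℕ → ℝ := fun n => γ * orbit γ n - orbit γ (n + 1) with hD
  have hDb : ∀ n, |D n| ≤ γ + 1 := fun n =>
    abs_mul_sub_le hγ0 (abs_orbit_le_one γ n) (abs_orbit_le_one γ (n + 1))
  have hDper : ∀ n, D (n + (P + 1) + k₀) = D (n + k₀) := by
    intro n
    have := hperiod (n + 1)
    rw [show n + 1 + (P + 1) + k₀ = n + (P + 1) + k₀ + 1 by ring,
      show n + 1 + k₀ = n + k₀ + 1 by ring] at this
    simp only [hD, hperiod n, this]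
  have hS := summable_digit_mul_pow hDb hz
  -- the tail of the series after the word and the block of zeros
  set R : ℂ := ∑' n, (D (n + k₀) : ℂ) * z ^ (n + 1) with hR
  have hSR : Summable fun n => (D (n + k₀) : ℂ) * z ^ (n + 1) :=
    summable_digit_mul_pow (fun n => hDb (n + k₀)) hz
  have e1 : ∑' n, (D n : ℂ) * z ^ (n + 1) =
      ∑ k ∈ Finset.range (m + 1), (greedyDigit β 1 k : ℂ) * z ^ (k + 1) + z ^ k₀ * R := by
    rw [← hS.sum_add_tsum_nat_add k₀, hk₀, Finset.sum_range_add, ← hk₀]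
    have h1 : ∀ i ∈ Finset.range M, (D (m + 1 + i) : ℂ) * z ^ (m + 1 + i + 1) = 0 := by
      intro i hi
      have := hzero (m + 1) M (by rw [hMy]; exact hy1) i (Finset.mem_range.1 hi)
      simp only [hD, this]
      simp
    rw [Finset.sum_eq_zero h1, add_zero, hR, ← tsum_mul_left]
    congr 1
    · refine Finset.sum_congr rfl fun k hk => ?_
      have hk' := hdigγ k (Finset.mem_range.1 hk)
      have : D k = greedyDigit β 1 k := by rw [← hk', digit_eq hγ0]
      rw [this]
      push_cast
      ring
    · exact tsum_congr fun n => by ring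
  have e2 : R = z ^ (P + 1) + z ^ (P + 1) * R := by
    conv_lhs => rw [hR, ← hSR.sum_add_tsum_nat_add (P + 1)]
    congr 1
    · rw [Finset.sum_range_succ]
      have h1 : ∀ i ∈ Finset.range P, (D (i + k₀) : ℂ) * z ^ (i + 1) = 0 := by
        intro i hi
        have := hzero k₀ P hPy' i (Finset.mem_range.1 hi)
        rw [add_comm k₀ i] at this
        simp only [hD, this]
        simp
      have h2 : D (P + k₀) = 1 := by
        have h3 := hret
        rw [← add_assoc] at h3
        simp only [hD]
        rw [add_comm P k₀, h3, hstep k₀ P hPy' P le_rfl, hyM, ← mul_assoc, ← pow_succ', hγy]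
        ring
      rw [Finset.sum_eq_zero h1, h2]
      simp
    · rw [hR, ← tsum_mul_left]
      refine tsum_congr fun n => ?_
      rw [hDper]
      ring
  have hne : 1 - z ^ (P + 1) ≠ 0 := by
    intro h
    have h1 : ‖z ^ (P + 1)‖ < 1 := by
      rw [norm_pow]
      exact pow_lt_one₀ (norm_nonneg z) hz (by omega)
    rw [← sub_eq_zero.1 h, norm_one] at h1
    exact lt_irrefl _ h1
  have hG' : (1 - z ^ (P + 1)) *
      (1 - ∑ k ∈ Finset.range (m + 1), (greedyDigit β 1 k : ℂ) * z ^ (k + 1)) =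
      z ^ (k₀ + (P + 1)) := hG
  rw [one_sub_phi_eq hγ1, digitSeries, e1]
  refine (mul_eq_zero.1 ?_).resolve_left hne
  rw [pow_add] at hG'
  linear_combination hG' - z ^ k₀ * e2

/-! ### Zeros of `G(z) - z^K` near the unit circle -/

lemma exists_root_of_unity {G : ℂ → ℂ} (hG : Differentiable ℂ G) (h1 : G 1 = 0) (h0 : G 0 = 1) :
    ∃ q : ℕ, 0 < q ∧ ∃ z₀ : ℂ, z₀ ^ q = 1 ∧ ‖z₀‖ = 1 ∧ G z₀ ≠ 0 ∧ ‖G z₀‖ < 1 := by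
  have hlim : Tendsto (fun q : ℕ => Complex.exp (2 * Real.pi * Complex.I / q)) atTop (𝓝 1) := by
    have h := (Complex.continuous_exp.tendsto 0).comp
      (tendsto_const_div_atTop_nhds_zero_nat (2 * Real.pi * Complex.I))
    simpa [Function.comp_def] using h
  have hne1 : ∀ᶠ q : ℕ in atTop, Complex.exp (2 * Real.pi * Complex.I / q) ≠ 1 := by
    filter_upwards [eventually_ge_atTop 2] with q hq
    exact (Complex.isPrimitiveRoot_exp q (by omega)).ne_one (by omega)
  have hiso : ∀ᶠ z in 𝓝[≠] (1 : ℂ), G z ≠ 0 := by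
    rcases (hG.analyticAt 1).eventually_eq_zero_or_eventually_ne_zero with h | h
    · exfalso
      have han : AnalyticOnNhd ℂ G univ := fun z _ => hG.analyticAt z
      have := han.eqOn_of_preconnected_of_eventuallyEq (analyticOnNhd_const (v := (0 : ℂ)))
        isPreconnected_univ (mem_univ 1) h (mem_univ 0)
      simp [h0] at this
    · exact h
  have hsmall : ∀ᶠ z in 𝓝 (1 : ℂ), ‖G z‖ < 1 := by
    have := (hG.continuous.norm.tendsto 1)
    rw [h1, norm_zero] at this
    exact this.eventually (gt_mem_nhds one_pos)
  obtain ⟨q, hq1, hq2, hq3⟩ := ((eventually_gt_atTop 0).and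
    (((tendsto_nhdsWithin_iff.2 ⟨hlim, hne1⟩).eventually hiso).and (hlim.eventually hsmall))).exists
  have hpow := (Complex.isPrimitiveRoot_exp q hq1.ne').pow_eq_one
  exact ⟨q, hq1, _, hpow, Complex.norm_eq_one_of_pow_eq_one hpow hq1.ne', hq2, hq3⟩

/-- If `0 < |G(z₀)| < 1` at a root of unity `z₀`, then `G(z) = z^K` has many solutions in the open unit
disc for suitable large `K`: with `z = z₀ e^{ζ/K}` and `z₀^K = 1` the equation becomes
`G(z₀ e^{ζ/K}) = e^ζ`, and its solutions converge to the logarithms of `G(z₀)`. -/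
lemma eventually_many_solutions {G : ℂ → ℂ} (hG : Differentiable ℂ G) {q : ℕ} (hq : 0 < q) {z₀ : ℂ}
    (hz₀ : z₀ ^ q = 1) (hz₀1 : ‖z₀‖ = 1) (hne : G z₀ ≠ 0) (hlt : ‖G z₀‖ < 1) (N : ℕ) :
    ∀ᶠ l : ℕ in atTop, (N : ℕ∞) ≤ {z : ℂ | ‖z‖ < 1 ∧ G z = z ^ (q * l)}.encard := by
  set B : ℝ := 2 * Real.pi * (N + 1) with hB
  have hB0 : 0 < B := by positivity
  set U : Set ℂ := {ζ | ζ.re < 0 ∧ |ζ.im| < B} with hU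
  have hUo : IsOpen U := (isOpen_lt Complex.continuous_re continuous_const).inter
    (isOpen_lt (Complex.continuous_im.abs) continuous_const)
  set F : ℕ → ℂ → ℂ := fun l ζ => G (z₀ * Complex.exp (ζ / (q * l : ℕ))) - Complex.exp ζ with hF
  set f : ℂ → ℂ := fun ζ => G z₀ - Complex.exp ζ with hf
  have hlim : TendstoLocallyUniformlyOn F f atTop U := by
    rw [Metric.tendstoLocallyUniformlyOn_iff]
    intro ε hε x _
    have hcont : Continuous fun w : ℂ => G (z₀ * Complex.exp w) := by
      have := hG.continuous
      fun_prop
    obtain ⟨δ, hδ, hδ'⟩ := Metric.continuous_iff.1 hcont 0 ε hε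
    refine ⟨ball x 1, mem_nhdsWithin_of_mem_nhds (ball_mem_nhds x one_pos), ?_⟩
    have hsmall : Tendsto (fun l : ℕ => (‖x‖ + 1) / l) atTop (𝓝 0) :=
      tendsto_const_div_atTop_nhds_zero_nat _
    filter_upwards [hsmall.eventually (gt_mem_nhds hδ), eventually_gt_atTop 0] with l hl hl0 y hy
    have hy' : ‖y‖ ≤ ‖x‖ + 1 := by
      have h1 := norm_le_norm_add_norm_sub' y x
      rw [mem_ball, dist_eq_norm] at hy
      linarith
    have h := hδ' (y / (q * l : ℕ)) (by
      rw [dist_zero_right, norm_div, Complex.norm_natCast]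
      refine lt_of_le_of_lt ?_ hl
      have hl' : (0 : ℝ) < l := by exact_mod_cast hl0
      gcongr
      exact Nat.le_mul_of_pos_left l hq)
    simp only [hF, hf, dist_eq_norm, Complex.exp_zero, mul_one, sub_sub_sub_cancel_right] at h ⊢
    rwa [norm_sub_rev]
  have hN : (N : ℕ∞) ≤ {ζ | ζ ∈ U ∧ f ζ = 0}.encard := by
    have hinj : Function.Injective fun k : ℕ => Complex.log (G z₀) + k * (2 * Real.pi * Complex.I) := by
      intro j k hjk
      have h1 := add_left_cancel hjk
      exact_mod_cast mul_right_cancel₀ Complex.two_pi_I_ne_zero h1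
    have hsub : (fun k : ℕ => Complex.log (G z₀) + k * (2 * Real.pi * Complex.I)) '' (Finset.range N) ⊆
        {ζ | ζ ∈ U ∧ f ζ = 0} := by
      rintro _ ⟨k, hk, rfl⟩
      have hk' : (k : ℝ) + 1 ≤ N := by
        exact_mod_cast (Finset.mem_range.1 hk)
      refine ⟨⟨?_, ?_⟩, ?_⟩
      · have : Real.log ‖G z₀‖ < 0 := Real.log_neg (norm_pos_iff.2 hne) hlt
        simpa [Complex.log_re] using this
      · have h1 : (Complex.log (G z₀) + k * (2 * Real.pi * Complex.I)).im =
            Complex.arg (G z₀) + k * (2 * Real.pi) := by simp [Complex.log_im]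
        have h2 := Complex.arg_le_pi (G z₀)
        have h3 := Complex.neg_pi_lt_arg (G z₀)
        have h4 : (0 : ℝ) ≤ k := k.cast_nonneg
        rw [h1, abs_lt, hB]
        have hpi := Real.pi_pos
        constructor <;> nlinarith
      · simp only [hf]
        rw [Complex.exp_add, Complex.exp_log hne, Complex.exp_nat_mul_two_pi_mul_I]
        ring
    calc (N : ℕ∞) = ((Finset.range N : Finset ℕ) : Set ℕ).encard := by
          rw [Set.encard_coe_eq_coe_finsetCard, Finset.card_range]
      _ = _ := (hinj.encard_image _).symm
      _ ≤ _ := Set.encard_le_encard hsub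
  have hord : ∀ z ∈ U, analyticOrderAt f z ≠ ⊤ := by
    intro z _ htop
    have h1 : f =ᶠ[𝓝 z] fun _ => 0 := analyticOrderAt_eq_top.1 htop
    have h2 := h1.deriv_eq
    have h3 : HasDerivAt f (-Complex.exp z) z := (Complex.hasDerivAt_exp z).const_sub _
    rw [h3.deriv] at h2
    simp [Complex.exp_ne_zero] at h2
  have hFd : ∀ l, Differentiable ℂ (F l) := by
    intro l
    simp only [hF]
    fun_prop
  have hfd : Differentiable ℂ f := by
    simp only [hf]
    fun_prop
  filter_upwards [eventually_le_encard_zeros hUo (Eventually.of_forall fun l =>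
    (hFd l).differentiableOn) hfd.differentiableOn hlim hord hN,
    eventually_ge_atTop (2 * (N + 1))] with l hl hlN
  have hK0 : (0 : ℝ) < (q * l : ℕ) := by
    have : 0 < l := by omega
    exact_mod_cast Nat.mul_pos hq this
  have hKB : B ≤ Real.pi * (q * l : ℕ) := by
    have h1 : 2 * (N + 1) ≤ q * l := hlN.trans (Nat.le_mul_of_pos_left l hq)
    have h2 : (2 * (N + 1) : ℝ) ≤ (q * l : ℕ) := by exact_mod_cast h1
    rw [hB]
    nlinarith [Real.pi_pos]
  have hKc : ((q * l : ℕ) : ℂ) ≠ 0 := by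
    have : (q * l : ℕ) ≠ 0 := by
      rintro h
      simp [h] at hK0
    exact_mod_cast this
  have hz₀ne : z₀ ≠ 0 := norm_pos_iff.1 (by rw [hz₀1]; exact one_pos)
  have hinj : InjOn (fun ζ : ℂ => z₀ * Complex.exp (ζ / (q * l : ℕ))) {ζ | ζ ∈ U ∧ F l ζ = 0} := by
    intro ζ hζ ξ hξ h
    have him : ∀ ζ ∈ U, |(ζ / (q * l : ℕ)).im| < Real.pi := by
      intro ζ hζ
      rw [Complex.div_natCast_im, abs_div, Nat.abs_cast, div_lt_iff₀ hK0]
      exact hζ.2.trans_le hKB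
    have h1 := abs_lt.1 (him ζ hζ.1)
    have h2 := abs_lt.1 (him ξ hξ.1)
    have h3 := Complex.exp_inj_of_neg_pi_lt_of_le_pi h1.1 h1.2.le h2.1 h2.2.le
      (mul_left_cancel₀ hz₀ne h)
    exact (div_left_inj' hKc).1 h3
  refine hl.trans ?_
  rw [← hinj.encard_image]
  refine Set.encard_le_encard ?_
  rintro _ ⟨ζ, ⟨hζ, hζ0⟩, rfl⟩
  constructor
  · change ‖z₀ * Complex.exp (ζ / (q * l : ℕ))‖ < 1
    rw [norm_mul, hz₀1, one_mul, Complex.norm_exp, Real.exp_lt_one_iff, Complex.div_natCast_re]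
    exact div_neg_of_neg_of_pos hζ.1 hK0
  · change G (z₀ * Complex.exp (ζ / (q * l : ℕ))) = (z₀ * Complex.exp (ζ / (q * l : ℕ))) ^ (q * l)
    rw [mul_pow, pow_mul, hz₀, one_pow, one_mul, ← Complex.exp_nat_mul, mul_div_cancel₀ _ hKc]
    exact sub_eq_zero.1 hζ0

lemma dense_le_encard_zeros (N : ℕ) :
    Dense {β : Ioi (1 : ℝ) | (N : ℕ∞) ≤ {z : ℂ | ‖z‖ < 1 ∧ 1 - phi β (β * z) = 0}.encard} := by
  rw [Metric.dense_iff]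
  rintro ⟨β, hβ⟩ r hr
  obtain ⟨G, hG, hG1, hG0, K₀, hK₀⟩ := exists_family hβ (lt_add_of_pos_right β hr)
  obtain ⟨q, hq, z₀, hz₀, hz₀1, hne, hlt⟩ := exists_root_of_unity hG hG1 hG0
  obtain ⟨l, hl, hlK⟩ := ((eventually_many_solutions hG hq hz₀ hz₀1 hne hlt N).and
    (eventually_ge_atTop K₀)).exists
  obtain ⟨γ, hγ, hzero⟩ := hK₀ (q * l) (hlK.trans (Nat.le_mul_of_pos_left l hq))
  refine ⟨⟨γ, lt_trans hβ hγ.1⟩, ?_, ?_⟩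
  · rw [mem_ball, Subtype.dist_eq, Real.dist_eq, abs_lt]
    constructor <;> simp only <;> linarith [hγ.1, hγ.2]
  · exact hl.trans (Set.encard_le_encard fun z hz => ⟨hz.1, hzero z hz.1 hz.2⟩)

/-! ### Rank-one perturbations and the essential spectral radius -/

/-- `T = A + ρ ℓ(·) e` is a rank-one perturbation of an operator `A` whose spectrum lies in the disc of
radius `ρ`, the functionals `ℓ ∘ Aⁿ` being bounded by multiples of `ρⁿ` and
`ℓ (Aⁿ e) = ρⁿ a_n`. All conditions are algebraic, so that they pass to quotients. -/
structure IsRankOnePerturbation {V : Type*} [AddCommGroup V] [Module ℂ V] (T A : Module.End ℂ V)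
    (e : V) (ℓ : V →ₗ[ℂ] ℂ) (ρ : ℝ) (a : ℕ → ℝ) : Prop where
  pos : 0 < ρ
  apply_eq : ∀ f, T f = A f + (ρ * ℓ f) • e
  bijective : ∀ μ : ℂ, ρ < ‖μ‖ → Function.Bijective fun f => μ • f - A f
  bound : ∀ f, ∃ C : ℝ, ∀ n, ‖ℓ ((A ^ n) f)‖ ≤ C * ρ ^ n
  coeff : ∀ n, ℓ ((A ^ n) e) = (ρ : ℂ) ^ n * a n

namespace IsRankOnePerturbation

variable {V : Type*} [AddCommGroup V] [Module ℂ V] {T A : Module.End ℂ V} {e : V}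
  {ℓ : V →ₗ[ℂ] ℂ} {ρ : ℝ} {a : ℕ → ℝ}

lemma norm_term_le (h : IsRankOnePerturbation T A e ℓ ρ a) {μ : ℂ} (hμ : ρ < ‖μ‖) {f : V} {C : ℝ}
    (hC : ∀ n, ‖ℓ ((A ^ n) f)‖ ≤ C * ρ ^ n) (n : ℕ) :
    ‖μ⁻¹ ^ n * ℓ ((A ^ n) f)‖ ≤ C * (ρ / ‖μ‖) ^ n := by
  have hμ0 : 0 < ‖μ‖ := h.pos.trans hμ
  rw [norm_mul, norm_pow, norm_inv, div_pow, inv_pow, inv_mul_eq_div, ← mul_div_assoc]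
  gcongr
  exact hC n

/-- The Neumann series for `(μ - A)⁻¹ f`, seen through `ℓ`. It comes from telescoping, so that no
topology on the space is needed. -/
lemma hasSum (h : IsRankOnePerturbation T A e ℓ ρ a) {μ : ℂ} (hμ : ρ < ‖μ‖) {f g : V}
    (hg : μ • g - A g = f) : HasSum (fun n => μ⁻¹ ^ (n + 1) * ℓ ((A ^ n) f)) (ℓ g) := by
  have hμ0 : 0 < ‖μ‖ := h.pos.trans hμ
  have hμ1 : μ ≠ 0 := norm_pos_iff.1 hμ0
  have hq0 : 0 ≤ ρ / ‖μ‖ := div_nonneg h.pos.le hμ0.le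
  have hq1 : ρ / ‖μ‖ < 1 := (div_lt_one hμ0).2 hμ
  obtain ⟨C, hC⟩ := h.bound f
  obtain ⟨C', hC'⟩ := h.bound g
  have hsum : Summable fun n => μ⁻¹ ^ (n + 1) * ℓ ((A ^ n) f) := by
    refine Summable.of_norm_bounded (g := fun n => ‖μ⁻¹‖ * (C * (ρ / ‖μ‖) ^ n))
      (((summable_geometric_of_lt_one hq0 hq1).mul_left C).mul_left _) fun n => ?_
    rw [pow_succ', mul_assoc, norm_mul]
    gcongr
    exact h.norm_term_le hμ hC n
  rw [hsum.hasSum_iff_tendsto_nat]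
  have hterm : ∀ n, μ⁻¹ ^ (n + 1) * ℓ ((A ^ n) f) =
      μ⁻¹ ^ n * ℓ ((A ^ n) g) - μ⁻¹ ^ (n + 1) * ℓ ((A ^ (n + 1)) g) := by
    intro n
    rw [← hg, map_sub, map_smul, map_sub, map_smul, smul_eq_mul, pow_succ A, Module.End.mul_apply,
      pow_succ]
    field_simp
  simp only [hterm]
  have htele : ∀ N, ∑ n ∈ Finset.range N,
      (μ⁻¹ ^ n * ℓ ((A ^ n) g) - μ⁻¹ ^ (n + 1) * ℓ ((A ^ (n + 1)) g)) =
      ℓ g - μ⁻¹ ^ N * ℓ ((A ^ N) g) := by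
    intro N
    rw [Finset.sum_range_sub' fun n => μ⁻¹ ^ n * ℓ ((A ^ n) g)]
    simp
  simp only [htele]
  have hz : Tendsto (fun N => μ⁻¹ ^ N * ℓ ((A ^ N) g)) atTop (𝓝 0) := by
    refine squeeze_zero_norm (h.norm_term_le hμ hC') ?_
    simpa using (tendsto_pow_atTop_nhds_zero_of_lt_one hq0 hq1).const_mul C'
  simpa using hz.const_sub (ℓ g)

lemma mul_apply_resolvent (h : IsRankOnePerturbation T A e ℓ ρ a) {μ : ℂ} (hμ : ρ < ‖μ‖) {g : V}
    (hg : μ • g - A g = e) : ρ * ℓ g = 1 - digitSeries a (ρ / μ) := by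
  have hμ1 : μ ≠ 0 := norm_pos_iff.1 (h.pos.trans hμ)
  rw [digitSeries, sub_sub_cancel, ← (h.hasSum hμ hg).tsum_eq, ← tsum_mul_left]
  refine tsum_congr fun n => ?_
  rw [h.coeff, div_pow, inv_pow, pow_succ (ρ : ℂ)]
  field_simp

lemma exists_abs_le (h : IsRankOnePerturbation T A e ℓ ρ a) : ∃ B, ∀ n, |a n| ≤ B := by
  obtain ⟨C, hC⟩ := h.bound e
  refine ⟨C, fun n => ?_⟩
  have h1 := hC n
  have h2 : 0 < ρ ^ n := pow_pos h.pos n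
  rw [h.coeff, norm_mul, norm_pow, Complex.norm_real, Complex.norm_real, Real.norm_eq_abs,
    Real.norm_eq_abs, abs_of_pos h.pos, mul_comm] at h1
  exact le_of_mul_le_mul_right h1 h2

lemma norm_div_lt_one (h : IsRankOnePerturbation T A e ℓ ρ a) {μ : ℂ} (hμ : ρ < ‖μ‖) :
    ‖(ρ : ℂ) / μ‖ < 1 := by
  rw [norm_div, Complex.norm_real, Real.norm_eq_abs, abs_of_pos h.pos]
  exact (div_lt_one (h.pos.trans hμ)).2 hμ

lemma hasEigenvalue (h : IsRankOnePerturbation T A e ℓ ρ a) {μ : ℂ} (hμ : ρ < ‖μ‖)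
    (h0 : digitSeries a (ρ / μ) = 0) : T.HasEigenvalue μ := by
  obtain ⟨g, hg⟩ := (h.bijective μ hμ).2 e
  have h1 : ρ * ℓ g = 1 := by rw [h.mul_apply_resolvent hμ hg, h0, sub_zero]
  refine Module.End.hasEigenvalue_of_hasEigenvector (x := g) ⟨?_, ?_⟩
  · rw [Module.End.mem_eigenspace_iff, h.apply_eq, h1, one_smul, ← show μ • g - A g = e from hg]
    abel
  · rintro rfl
    simp at h1

lemma mem_spectrum_iff (h : IsRankOnePerturbation T A e ℓ ρ a) {μ : ℂ} (hμ : ρ < ‖μ‖) :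
    μ ∈ spectrum ℂ T ↔ digitSeries a (ρ / μ) = 0 := by
  refine ⟨fun hs => ?_, fun h0 => (h.hasEigenvalue hμ h0).mem_spectrum⟩
  by_contra hD
  apply hs
  change IsUnit (algebraMap ℂ (Module.End ℂ V) μ - T)
  rw [Module.End.isUnit_iff]
  obtain ⟨g, hg⟩ := (h.bijective μ hμ).2 e
  have hg : μ • g - A g = e := hg
  have h1 := h.mul_apply_resolvent hμ hg
  have happ : ∀ f, (algebraMap ℂ (Module.End ℂ V) μ - T) f = μ • f - A f - (ρ * ℓ f) • e := by
    intro f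
    rw [LinearMap.sub_apply, Module.algebraMap_end_apply, h.apply_eq]
    abel
  constructor
  · rw [← LinearMap.ker_eq_bot, LinearMap.ker_eq_bot']
    intro f hf
    rw [happ, sub_eq_zero] at hf
    have h2 : f = (ρ * ℓ f) • g := by
      apply (h.bijective μ hμ).1
      simp only
      rw [hf, map_smul, smul_comm μ, ← smul_sub, hg]
    have h3 : ℓ f = (ρ * ℓ f) * ℓ g := by
      conv_lhs => rw [h2, map_smul, smul_eq_mul]
    have h4 : ℓ f * digitSeries a (ρ / μ) = 0 := by linear_combination h3 + ℓ f * h1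
    rw [h2, (mul_eq_zero.1 h4).resolve_right hD, mul_zero, zero_smul]
  · intro y
    obtain ⟨f, hf⟩ := (h.bijective μ hμ).2 y
    have hf : μ • f - A f = y := hf
    -- correct the solution `f` of `(μ - A) f = y` by a multiple of `g`
    refine ⟨f + (ρ * ℓ f / digitSeries a (ρ / μ)) • g, ?_⟩
    set c := ρ * ℓ f / digitSeries a (ρ / μ) with hc
    have hcD : c * digitSeries a (ρ / μ) = ρ * ℓ f := div_mul_cancel₀ _ hD
    rw [happ]
    have h5 : μ • (f + c • g) - A (f + c • g) = y + c • e := by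
      rw [← hf, ← hg, map_add, map_smul, smul_add, smul_sub, smul_comm μ c]
      abel
    have h6 : ρ * ℓ (f + c • g) = c := by
      rw [map_add, map_smul, smul_eq_mul]
      linear_combination c * h1 - hcD
    rw [h5, h6]
    abel

lemma analyticAt_digitSeries_div (h : IsRankOnePerturbation T A e ℓ ρ a) {μ : ℂ} (hμ : ρ < ‖μ‖) :
    AnalyticAt ℂ (fun μ => digitSeries a (ρ / μ)) μ := by
  obtain ⟨B, hB⟩ := h.exists_abs_le
  have hμ1 : μ ≠ 0 := norm_pos_iff.1 (h.pos.trans hμ)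
  have h1 : AnalyticAt ℂ (digitSeries a) (ρ / μ) :=
    (differentiableOn_digitSeries hB).analyticAt
      (isOpen_ball.mem_nhds (mem_ball_zero_iff.2 (h.norm_div_lt_one hμ)))
  have h2 : AnalyticAt ℂ (fun μ : ℂ => (ρ : ℂ) / μ) μ := analyticAt_const.div analyticAt_id hμ1
  exact h1.comp_of_eq h2 rfl

lemma analyticOrderAt_digitSeries_div_ne_top (h : IsRankOnePerturbation T A e ℓ ρ a) {μ : ℂ}
    (hμ : ρ < ‖μ‖) : analyticOrderAt (fun μ => digitSeries a (ρ / μ)) μ ≠ ⊤ := by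
  obtain ⟨B, hB⟩ := h.exists_abs_le
  have hμ1 : μ ≠ 0 := norm_pos_iff.1 (h.pos.trans hμ)
  have hρ : (ρ : ℂ) ≠ 0 := by exact_mod_cast h.pos.ne'
  intro htop
  refine analyticOrderAt_digitSeries_ne_top hB (mem_ball_zero_iff.2 (h.norm_div_lt_one hμ)) ?_
  rw [analyticOrderAt_eq_top] at htop ⊢
  have hlim : Tendsto (fun w : ℂ => (ρ : ℂ) / w) (𝓝 (ρ / μ)) (𝓝 μ) := by
    have : ContinuousAt (fun w : ℂ => (ρ : ℂ) / w) (ρ / μ) :=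
      continuousAt_const.div continuousAt_id (div_ne_zero hρ hμ1)
    have h2 := this.tendsto
    rwa [div_div_cancel₀ hρ] at h2
  filter_upwards [hlim.eventually htop] with w hw
  rwa [div_div_cancel₀ hρ] at hw

/-- A Jordan chain of length `n + 1` at `lam` forces a zero of order at least `n + 1`: the vectors
`p_μ = ∑ (μ - lam)^{n-j} S^j f`, `S = T - lam`, satisfy `(μ - T) p_μ = (μ - lam)^{n+1} f`, and applying
`ℓ (μ - A)⁻¹` gives `ℓ(p_μ) D(μ) = O((μ - lam)^{n+1})`, while `ℓ(p_μ) → ℓ(Sⁿ f) ≠ 0`. -/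
lemma lt_analyticOrderAt_of_chain (h : IsRankOnePerturbation T A e ℓ ρ a) {lam : ℂ}
    (hlam : ρ < ‖lam‖) {f : V} {n : ℕ} (hn : ((T - lam • 1) ^ n) f ≠ 0)
    (hn1 : ((T - lam • 1) ^ (n + 1)) f = 0) :
    (n : ℕ∞) < analyticOrderAt (fun μ => digitSeries a (ρ / μ)) lam := by
  set S := T - lam • (1 : Module.End ℂ V) with hS
  set H : ℂ → ℂ := fun μ => digitSeries a (ρ / μ) with hH
  have hSapp : ∀ v, S v = T v - lam • v := fun v => by simp [hS]
  have hℓ : ℓ ((S ^ n) f) ≠ 0 := by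
    intro h0
    apply hn
    apply (h.bijective lam hlam).1
    have h1 : S ((S ^ n) f) = 0 := by rwa [← Module.End.mul_apply, ← pow_succ']
    rw [hSapp, h.apply_eq, h0, mul_zero, zero_smul, add_zero, sub_eq_zero] at h1
    simp only
    rw [h1]
    simp
  set p : ℂ → V := fun μ => ∑ j ∈ Finset.range (n + 1), (μ - lam) ^ j • (S ^ (n - j)) f with hp
  have hpeq : ∀ μ, μ • p μ - T (p μ) = (μ - lam) ^ (n + 1) • f := by
    intro μ
    have hcomm : Commute (algebraMap ℂ (Module.End ℂ V) (μ - lam)) S :=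
      Algebra.commute_algebraMap_left _ _
    have h1 := congrArg (fun X : Module.End ℂ V => X f) (hcomm.mul_geom_sum₂ (n + 1))
    simp only [Module.End.mul_apply, LinearMap.sub_apply, hn1, sub_zero, ← map_pow,
      Module.algebraMap_end_apply, LinearMap.sum_apply, Nat.add_sub_cancel] at h1
    rw [← h1, hSapp, sub_smul]
    simp only [hp]
    abel
  have hLcont : Continuous fun μ => ℓ (p μ) := by
    simp only [hp, map_sum, map_smul, smul_eq_mul]
    fun_prop
  have hLlam : ℓ (p lam) = ℓ ((S ^ n) f) := by
    simp [hp, Finset.sum_range_succ']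
  obtain ⟨C, hC⟩ := h.bound f
  have hC0 : 0 ≤ C := by
    have := (norm_nonneg _).trans (hC 0)
    simpa using this
  obtain ⟨δ, hδ, hδlam⟩ := exists_between hlam
  have hδ0 : 0 < δ := h.pos.trans hδ
  have hq0 : 0 ≤ ρ / δ := div_nonneg h.pos.le hδ0.le
  have hq1 : ρ / δ < 1 := (div_lt_one hδ0).2 hδ
  have hbound : ∀ μ : ℂ, δ < ‖μ‖ →
      ‖ℓ (p μ) * H μ‖ ≤ ‖μ - lam‖ ^ (n + 1) * (δ⁻¹ * (C * (1 - ρ / δ)⁻¹)) := by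
    intro μ hμδ
    have hμ : ρ < ‖μ‖ := hδ.trans hμδ
    have hμ0 : 0 < ‖μ‖ := h.pos.trans hμ
    obtain ⟨g, hg⟩ := (h.bijective μ hμ).2 e
    obtain ⟨r, hr⟩ := (h.bijective μ hμ).2 f
    have hg : μ • g - A g = e := hg
    have hr : μ • r - A r = f := hr
    have h1 := h.mul_apply_resolvent hμ hg
    have h2 : p μ = (ρ * ℓ (p μ)) • g + (μ - lam) ^ (n + 1) • r := by
      apply (h.bijective μ hμ).1
      simp only
      have h3 := hpeq μ
      rw [h.apply_eq, ← hr] at h3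
      have h4 : μ • p μ - A (p μ) =
          (ρ * ℓ (p μ)) • e + (μ - lam) ^ (n + 1) • (μ • r - A r) := by
        rw [← h3]
        abel
      rw [h4, ← hg, map_add, map_smul, map_smul, smul_add, smul_sub, smul_sub, smul_comm μ,
        smul_comm μ]
      abel
    have h3 : ℓ (p μ) = (ρ * ℓ (p μ)) * ℓ g + (μ - lam) ^ (n + 1) * ℓ r := by
      conv_lhs => rw [h2, map_add, map_smul, map_smul, smul_eq_mul, smul_eq_mul]
    have h5 : ℓ (p μ) * H μ = (μ - lam) ^ (n + 1) * ℓ r := by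
      simp only [hH]
      linear_combination h3 + ℓ (p μ) * h1
    have h6 : ‖ℓ r‖ ≤ δ⁻¹ * (C * (1 - ρ / δ)⁻¹) := by
      rw [← (h.hasSum hμ hr).tsum_eq]
      refine tsum_of_norm_bounded (((hasSum_geometric_of_lt_one hq0 hq1).mul_left C).mul_left δ⁻¹)
        fun m => ?_
      rw [pow_succ', mul_assoc, norm_mul, norm_inv]
      refine mul_le_mul (inv_anti₀ hδ0 hμδ.le) ((h.norm_term_le hμ hC m).trans ?_) (norm_nonneg _)
        (by positivity)
      have := h.pos
      gcongr
    rw [h5, norm_mul, norm_pow]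
    gcongr
  by_contra! hle
  obtain ⟨k, hk⟩ := ENat.ne_top_iff_exists.1 (h.analyticOrderAt_digitSeries_div_ne_top hlam)
  obtain ⟨g, hg, hg0, hgH⟩ :=
    (h.analyticAt_digitSeries_div hlam).analyticOrderAt_eq_natCast.1 hk.symm
  rw [← hk] at hle
  have hkn : k ≤ n := by exact_mod_cast hle
  have hne : ℓ (p lam) * g lam ≠ 0 := mul_ne_zero (hLlam ▸ hℓ) hg0
  have hlim1 : Tendsto (fun μ => ℓ (p μ) * g μ) (𝓝[≠] lam) (𝓝 (ℓ (p lam) * g lam)) :=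
    ((hLcont.continuousAt.mul hg.continuousAt).tendsto).mono_left nhdsWithin_le_nhds
  have hlim2 : Tendsto (fun μ => ℓ (p μ) * g μ) (𝓝[≠] lam) (𝓝 0) := by
    have hpow : Tendsto (fun μ : ℂ => ‖μ - lam‖ ^ (n + 1 - k) * (δ⁻¹ * (C * (1 - ρ / δ)⁻¹)))
        (𝓝[≠] lam) (𝓝 0) := by
      have hc : Continuous fun μ : ℂ =>
          ‖μ - lam‖ ^ (n + 1 - k) * (δ⁻¹ * (C * (1 - ρ / δ)⁻¹)) := by fun_prop
      have := (hc.tendsto lam).mono_left (nhdsWithin_le_nhds (s := {lam}ᶜ))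
      simpa [show n + 1 - k ≠ 0 by omega] using this
    refine squeeze_zero_norm' ?_ hpow
    have hnear : ∀ᶠ μ : ℂ in 𝓝[≠] lam, δ < ‖μ‖ :=
      nhdsWithin_le_nhds (continuous_norm.continuousAt.eventually (lt_mem_nhds hδlam))
    filter_upwards [hnear, nhdsWithin_le_nhds hgH, self_mem_nhdsWithin] with μ h1 h2 h3
    have h4 : 0 < ‖μ - lam‖ := norm_pos_iff.2 (sub_ne_zero.2 h3)
    have h5 := hbound μ h1
    have h2 : H μ = (μ - lam) ^ k • g μ := h2
    rw [h2, smul_eq_mul, mul_left_comm, norm_mul, norm_pow,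
      show n + 1 = k + (n + 1 - k) by omega, pow_add, mul_assoc] at h5
    exact le_of_mul_le_mul_left h5 (pow_pos h4 k)
  exact hne (tendsto_nhds_unique hlim1 hlim2)

lemma isIsolatedEigenvalue (h : IsRankOnePerturbation T A e ℓ ρ a) {lam : ℂ} (hlam : ρ < ‖lam‖)
    (h0 : digitSeries a (ρ / lam) = 0) : IsIsolatedEigenvalue T lam := by
  classical
  obtain ⟨k, hk⟩ := ENat.ne_top_iff_exists.1 (h.analyticOrderAt_digitSeries_div_ne_top hlam)
  refine ⟨h.hasEigenvalue hlam h0, ?_, ?_⟩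
  · set S := T - lam • (1 : Module.End ℂ V) with hS
    have hSapp : ∀ v, S v = T v - lam • v := fun v => by simp [hS]
    -- a generalized eigenvector is determined by the values of `ℓ` on its Jordan chain
    let Φ : V →ₗ[ℂ] (Fin k → ℂ) := LinearMap.pi fun j => ℓ ∘ₗ (S ^ (j : ℕ))
    refine Module.Finite.of_injective (Φ.domRestrict (T.maxGenEigenspace lam)) ?_
    rw [← LinearMap.ker_eq_bot, LinearMap.ker_eq_bot']
    rintro ⟨f, hf⟩ hΦ
    have hex : ∃ n, (S ^ n) f = 0 := (Module.End.mem_maxGenEigenspace T lam f).1 hf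
    rw [Submodule.mk_eq_zero]
    by_contra hf0
    obtain ⟨n, hn⟩ : ∃ n, Nat.find hex = n + 1 := by
      apply Nat.exists_eq_succ_of_ne_zero
      intro hz
      have := Nat.find_spec hex
      rw [hz] at this
      exact hf0 (by simpa using this)
    have hn1 : (S ^ (n + 1)) f = 0 := hn ▸ Nat.find_spec hex
    have hn0 : (S ^ n) f ≠ 0 := Nat.find_min hex (by omega)
    have hlt := h.lt_analyticOrderAt_of_chain hlam hn0 hn1
    rw [← hk] at hlt
    have hnk : n < k := by exact_mod_cast hlt
    have hℓ : ℓ ((S ^ n) f) = 0 := congrFun hΦ ⟨n, hnk⟩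
    apply hn0
    apply (h.bijective lam hlam).1
    have h1 : S ((S ^ n) f) = 0 := by rwa [← Module.End.mul_apply, ← pow_succ']
    rw [hSapp, h.apply_eq, hℓ, mul_zero, zero_smul, add_zero, sub_eq_zero] at h1
    simp only
    rw [h1]
    simp
  · have hiso : ∀ᶠ μ in 𝓝[≠] lam, digitSeries a (ρ / μ) ≠ 0 := by
      rcases (h.analyticAt_digitSeries_div hlam).eventually_eq_zero_or_eventually_ne_zero with h1 | h1
      · exact absurd (analyticOrderAt_eq_top.2 h1) (h.analyticOrderAt_digitSeries_div_ne_top hlam)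
      · exact h1
    have hnear : ∀ᶠ μ : ℂ in 𝓝 lam, ρ < ‖μ‖ :=
      continuous_norm.continuousAt.eventually (lt_mem_nhds hlam)
    rw [eventually_nhdsWithin_iff] at hiso
    obtain ⟨ε, hε, hball⟩ := Metric.eventually_nhds_iff.1 (hiso.and hnear)
    refine ⟨ε, hε, fun μ hμ hd => ?_⟩
    by_contra hne
    exact (hball hd).1 hne ((h.mem_spectrum_iff (hball hd).2).1 hμ)

lemma essSpectralRadius_eq (h : IsRankOnePerturbation T A e ℓ ρ a)
    (hdisc : ∀ μ : ℂ, ‖μ‖ < ρ → μ ∈ spectrum ℂ T) : essSpectralRadius T = ρ := by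
  have hmem : ρ ∈ {r : ℝ | 0 ≤ r ∧ ∀ μ ∈ spectrum ℂ T, r < ‖μ‖ → IsIsolatedEigenvalue T μ} :=
    ⟨h.pos.le, fun μ hμ hr => h.isIsolatedEigenvalue hr ((h.mem_spectrum_iff hr).1 hμ)⟩
  refine le_antisymm (csInf_le ⟨0, fun r hr => hr.1⟩ hmem) (le_csInf ⟨ρ, hmem⟩ ?_)
  rintro r ⟨hr0, hr⟩
  by_contra! hlt
  obtain ⟨s, hs, hs'⟩ := exists_between hlt
  have hs0 : 0 < s := hr0.trans_lt hs
  have hns : ‖(s : ℂ)‖ = s := by rw [Complex.norm_real, Real.norm_eq_abs, abs_of_pos hs0]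
  obtain ⟨-, -, ε, hε, hiso⟩ := hr s (hdisc _ (by rwa [hns])) (by rwa [hns])
  -- the whole disc of radius `ρ` consists of spectral values, so that `s` is not isolated
  obtain ⟨t, ht, ht'⟩ := exists_between (lt_min hs' (lt_add_of_pos_right s hε))
  have ht1 : t < ρ := ht'.trans_le (min_le_left _ _)
  have ht2 : t < s + ε := ht'.trans_le (min_le_right _ _)
  have hnt : ‖(t : ℂ)‖ = t := by rw [Complex.norm_real, Real.norm_eq_abs, abs_of_pos (hs0.trans ht)]
  have := hiso t (hdisc _ (by rwa [hnt])) (by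
    rw [dist_eq_norm, ← Complex.ofReal_sub, Complex.norm_real, Real.norm_eq_abs,
      abs_of_pos (sub_pos.2 ht)]
    linarith)
  exact ht.ne' (by exact_mod_cast this)

lemma exists_isNonLeadingEigenvalue_iff (h : IsRankOnePerturbation T A e ℓ ρ a)
    (hdisc : ∀ μ : ℂ, ‖μ‖ < ρ → μ ∈ spectrum ℂ T) :
    (∃ lam, IsNonLeadingEigenvalue T lam) ↔ ∃ w : ℂ, ‖w‖ < 1 ∧ digitSeries a w = 0 ∧ w ≠ ρ := by
  have hρ : (ρ : ℂ) ≠ 0 := by exact_mod_cast h.pos.ne'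
  have hess := h.essSpectralRadius_eq hdisc
  constructor
  · rintro ⟨lam, hne, hiso, hr⟩
    rw [hess] at hr
    have hlam0 : lam ≠ 0 := norm_pos_iff.1 (h.pos.trans hr)
    refine ⟨ρ / lam, h.norm_div_lt_one hr, (h.mem_spectrum_iff hr).1 hiso.1.mem_spectrum, ?_⟩
    intro heq
    rw [div_eq_iff hlam0] at heq
    exact hne (mul_left_cancel₀ hρ (by rw [← heq, mul_one]))
  · rintro ⟨w, hw, hw0, hne⟩
    have hwz : w ≠ 0 := by
      rintro rfl
      rw [digitSeries_zero] at hw0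
      exact one_ne_zero hw0
    have hr : ρ < ‖(ρ : ℂ) / w‖ := by
      rw [norm_div, Complex.norm_real, Real.norm_eq_abs, abs_of_pos h.pos,
        lt_div_iff₀ (norm_pos_iff.2 hwz)]
      exact mul_lt_of_lt_one_right h.pos hw
    refine ⟨ρ / w, ?_, h.isIsolatedEigenvalue hr (by rwa [div_div_cancel₀ hρ]), by rwa [hess]⟩
    intro heq
    rw [div_eq_iff hwz, one_mul] at heq
    exact hne heq.symm

/-- A rank-one perturbation descends to the quotient by a subspace on which `ℓ` vanishes and on which
`μ - A` is onto for `|μ| > ρ`. -/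
lemma mapQ (h : IsRankOnePerturbation T A e ℓ ρ a) {W : Submodule ℂ V} (hT : W ≤ W.comap T)
    (hℓ : ∀ f ∈ W, ℓ f = 0)
    (hsurj : ∀ μ : ℂ, ρ < ‖μ‖ → ∀ g ∈ W, ∃ f ∈ W, μ • f - A f = g) :
    ∃ (A' : Module.End ℂ (V ⧸ W)) (ℓ' : (V ⧸ W) →ₗ[ℂ] ℂ),
      IsRankOnePerturbation (W.mapQ W T hT) A' (W.mkQ e) ℓ' ρ a := by
  have hA : W ≤ W.comap A := by
    intro f hf
    have h1 : T f ∈ W := hT hf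
    rw [h.apply_eq, hℓ f hf, mul_zero, zero_smul, add_zero] at h1
    exact h1
  have hpow : ∀ n f, ((W.mapQ W A hA) ^ n) (W.mkQ f) = W.mkQ ((A ^ n) f) := by
    intro n
    induction n with
    | zero => intro f; rfl
    | succ n ih =>
      intro f
      rw [pow_succ, Module.End.mul_apply, pow_succ, Module.End.mul_apply, ← ih]
      rfl
  refine ⟨W.mapQ W A hA, W.liftQ ℓ fun f hf => hℓ f hf, h.pos, ?_, ?_, ?_, ?_⟩
  · intro f
    obtain ⟨f, rfl⟩ := W.mkQ_surjective f
    change W.mkQ (T f) = W.mkQ (A f) + (ρ * ℓ f) • W.mkQ e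
    rw [h.apply_eq, map_add, map_smul]
  · intro μ hμ
    constructor
    · intro x y hxy
      obtain ⟨x, rfl⟩ := W.mkQ_surjective x
      obtain ⟨y, rfl⟩ := W.mkQ_surjective y
      have h1 : W.mkQ (μ • x - A x) = W.mkQ (μ • y - A y) := hxy
      have h2 : (μ • x - A x) - (μ • y - A y) ∈ W := (Submodule.Quotient.eq W).1 h1
      obtain ⟨f, hf, hf'⟩ := hsurj μ hμ _ h2
      have h3 : f = x - y := by
        apply (h.bijective μ hμ).1
        simp only
        rw [hf', map_sub, smul_sub]
        abel
      exact (Submodule.Quotient.eq W).2 (h3 ▸ hf)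
    · intro y
      obtain ⟨y, rfl⟩ := W.mkQ_surjective y
      obtain ⟨f, hf⟩ := (h.bijective μ hμ).2 y
      exact ⟨W.mkQ f, congrArg W.mkQ hf⟩
  · intro f
    obtain ⟨f, rfl⟩ := W.mkQ_surjective f
    obtain ⟨C, hC⟩ := h.bound f
    refine ⟨C, fun n => ?_⟩
    rw [hpow]
    exact hC n
  · intro n
    rw [hpow]
    exact h.coeff n

end IsRankOnePerturbation

end

section

open Filter ENNReal

/-! ### Total variation on `[0,1]` -/

/-- The extension of a function on `[0,1]` to the real line by `0`. -/
def extByZero (f : unitInterval → ℂ) (t : ℝ) : ℂ :=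
  if h : t ∈ Icc (0 : ℝ) 1 then f ⟨t, h⟩ else 0

/-- The total variation on `[0,∞)` of the extension of `f` by zero, that is `var(f) + |f(1)|`. The jump
at `1` is included in order that this be a norm on `BV`, and one that the branches of `τ_β` do not
increase. -/
def totalVar (f : unitInterval → ℂ) : ℝ≥0∞ := eVariationOn (extByZero f) (Ici 0)

lemma eVariationOn_add_le {α : Type*} [LinearOrder α] (f g : α → ℂ) (s : Set α) :
    eVariationOn (f + g) s ≤ eVariationOn f s + eVariationOn g s := by
  apply iSup_le
  rintro ⟨n, u, hu, hmem⟩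
  calc ∑ i ∈ Finset.range n, edist ((f + g) (u (i + 1))) ((f + g) (u i))
      ≤ ∑ i ∈ Finset.range n, (edist (f (u (i + 1))) (f (u i)) + edist (g (u (i + 1))) (g (u i))) :=
        Finset.sum_le_sum fun i _ => edist_add_add_le _ _ _ _
    _ = _ := Finset.sum_add_distrib
    _ ≤ _ := add_le_add (eVariationOn.sum_le hu hmem) (eVariationOn.sum_le hu hmem)

lemma eVariationOn_smul_le {α : Type*} [LinearOrder α] (c : ℂ) (f : α → ℂ) (s : Set α) :
    eVariationOn (c • f) s ≤ ‖c‖ₑ * eVariationOn f s := by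
  apply iSup_le
  rintro ⟨n, u, hu, hmem⟩
  calc ∑ i ∈ Finset.range n, edist ((c • f) (u (i + 1))) ((c • f) (u i))
      = ∑ i ∈ Finset.range n, ‖c‖ₑ * edist (f (u (i + 1))) (f (u i)) := by
        refine Finset.sum_congr rfl fun i _ => ?_
        rw [Pi.smul_apply, Pi.smul_apply, edist_eq_enorm_sub, edist_eq_enorm_sub, ← smul_sub,
          enorm_smul]
    _ = ‖c‖ₑ * ∑ i ∈ Finset.range n, edist (f (u (i + 1))) (f (u i)) := Finset.mul_sum .. |>.symm
    _ ≤ _ := by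
        gcongr
        exact eVariationOn.sum_le hu hmem

/-- A function that takes one value on a lower set and another value on the complement has finite
variation. -/
lemma boundedVariationOn_of_step {α : Type*} [LinearOrder α] {f : α → ℂ} {s t : Set α}
    (ht : IsLowerSet t) {c d : ℂ} (hc : ∀ x ∈ s, x ∈ t → f x = c) (hd : ∀ x ∈ s, x ∉ t → f x = d) :
    BoundedVariationOn f s := by
  classical
  let g : ℝ → ℂ := fun x => if x = 0 then c else d
  let φ : α → ℝ := fun x => if x ∈ t then 0 else 1
  have hφ : Monotone φ := by
    intro x y hxy
    by_cases hy : y ∈ t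
    · simp [φ, hy, ht hxy hy]
    · by_cases hx : x ∈ t <;> simp [φ, hx, hy]
  have hmaps : MapsTo φ s {0, 1} := by
    intro x _
    by_cases hx : x ∈ t <;> simp [φ, hx]
  have heq : EqOn f (g ∘ φ) s := by
    intro x hx
    by_cases hxt : x ∈ t
    · simp [g, φ, hxt, hc x hx hxt]
    · simp [g, φ, hxt, hd x hx hxt]
  rw [BoundedVariationOn, eVariationOn.congr heq]
  refine ne_top_of_le_ne_top ?_ (eVariationOn.comp_le_of_monotoneOn g φ (hφ.monotoneOn s) hmaps)
  rw [eVariationOn.pair]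
  exact edist_ne_top _ _

lemma extByZero_coe (f : unitInterval → ℂ) (x : unitInterval) : extByZero f x = f x := by
  rw [extByZero, dif_pos x.2]

lemma extByZero_of_one_lt (f : unitInterval → ℂ) {t : ℝ} (ht : 1 < t) : extByZero f t = 0 := by
  rw [extByZero, dif_neg]
  rintro ⟨-, h⟩
  linarith

lemma extByZero_add (f g : unitInterval → ℂ) : extByZero (f + g) = extByZero f + extByZero g := by
  ext t
  by_cases h : t ∈ Icc (0 : ℝ) 1 <;> simp only [extByZero, h, Pi.add_apply, dite_true, dite_false,
    add_zero]

lemma extByZero_smul (c : ℂ) (f : unitInterval → ℂ) : extByZero (c • f) = c • extByZero f := by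
  ext t
  by_cases h : t ∈ Icc (0 : ℝ) 1 <;> simp only [extByZero, h, Pi.smul_apply, dite_true, dite_false,
    smul_zero]

lemma totalVar_add_le (f g : unitInterval → ℂ) : totalVar (f + g) ≤ totalVar f + totalVar g := by
  rw [totalVar, extByZero_add]
  exact eVariationOn_add_le _ _ _

lemma totalVar_smul_le (c : ℂ) (f : unitInterval → ℂ) : totalVar (c • f) ≤ ‖c‖ₑ * totalVar f := by
  rw [totalVar, extByZero_smul]
  exact eVariationOn_smul_le _ _ _

lemma totalVar_sub_le (f g : unitInterval → ℂ) : totalVar (f - g) ≤ totalVar f + totalVar g := by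
  have h := totalVar_smul_le (-1) g
  rw [enorm_neg, enorm_one, one_mul] at h
  have h2 : f - g = f + (-1 : ℂ) • g := by ext; simp [sub_eq_add_neg]
  rw [h2]
  exact (totalVar_add_le _ _).trans (by gcongr)

lemma totalVar_zero : totalVar 0 = 0 := by
  have h := totalVar_smul_le 0 (0 : unitInterval → ℂ)
  simpa using h

lemma totalVar_sum_le {ι : Type*} (s : Finset ι) (f : ι → unitInterval → ℂ) :
    totalVar (∑ i ∈ s, f i) ≤ ∑ i ∈ s, totalVar (f i) :=
  Finset.le_sum_of_subadditive totalVar totalVar_zero.le totalVar_add_le s f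

lemma enorm_le_totalVar (f : unitInterval → ℂ) (x : unitInterval) : ‖f x‖ₑ ≤ totalVar f := by
  have h := eVariationOn.edist_le (extByZero f) (s := Ici 0) (x := x) (y := 2) x.2.1
    (show (0 : ℝ) ≤ 2 by norm_num)
  rwa [extByZero_coe, extByZero_of_one_lt f (by norm_num), edist_zero_right] at h

lemma eq_zero_of_totalVar_eq_zero {f : unitInterval → ℂ} (h : totalVar f = 0) : f = 0 := by
  ext x
  have := enorm_le_totalVar f x
  rw [h] at this
  simpa using this

/-- If `f` vanishes at `1`, then there is no jump at `1` to be counted. -/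
lemma totalVar_le_of_apply_one {f : unitInterval → ℂ} (h : f 1 = 0) :
    totalVar f ≤ eVariationOn f univ := by
  have heq : EqOn (extByZero f) (f ∘ projIcc 0 1 zero_le_one) (Ici 0) := by
    intro t ht
    by_cases h1 : t ≤ 1
    · rw [extByZero, dif_pos ⟨ht, h1⟩, Function.comp_apply, projIcc_of_mem zero_le_one ⟨ht, h1⟩]
    · rw [extByZero_of_one_lt f (not_le.1 h1), Function.comp_apply,
        projIcc_of_right_le _ (not_le.1 h1).le]
      exact h.symm
  rw [totalVar, eVariationOn.congr heq]
  exact eVariationOn.comp_le_of_monotoneOn f _ ((monotone_projIcc _).monotoneOn _)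
    fun _ _ => mem_univ _

lemma mem_BV_iff {f : unitInterval → ℂ} : f ∈ BV ↔ totalVar f ≠ ∞ := by
  constructor
  · intro hf
    have hunion : Icc (0 : ℝ) 1 ∪ Ici 1 = Ici 0 := Icc_union_Ici_eq_Ici zero_le_one
    rw [totalVar, ← hunion, eVariationOn.union _ (isGreatest_Icc zero_le_one) isLeast_Ici]
    refine ENNReal.add_ne_top.2 ⟨?_, ?_⟩
    · have heq : EqOn (extByZero f) (f ∘ projIcc 0 1 zero_le_one) (Icc 0 1) := by
        intro t ht
        rw [extByZero, dif_pos ht, Function.comp_apply, projIcc_of_mem zero_le_one ht]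
      rw [eVariationOn.congr heq]
      exact ne_top_of_le_ne_top hf (eVariationOn.comp_le_of_monotoneOn f _
        ((monotone_projIcc _).monotoneOn _) fun _ _ => mem_univ _)
    · refine boundedVariationOn_of_step (isLowerSet_Iic (1 : ℝ)) (c := f 1) (d := 0) ?_ ?_
      · intro t ht ht'
        obtain rfl : t = 1 := le_antisymm ht' ht
        exact extByZero_coe f 1
      · intro t _ ht'
        exact extByZero_of_one_lt f (not_le.1 ht')
  · intro hf
    have heq : f = extByZero f ∘ fun x : unitInterval => (x : ℝ) := by
      ext x
      exact (extByZero_coe f x).symm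
    refine ne_top_of_le_ne_top hf ?_
    conv_lhs => rw [heq]
    exact eVariationOn.comp_le_of_monotoneOn _ _ (fun x _ y _ hxy => hxy) fun x _ => x.2.1

/-- Lower semicontinuity of the total variation under pointwise limits. -/
lemma totalVar_le_of_tendsto {ι : Type*} {l : Filter ι} [l.NeBot] {F : ι → unitInterval → ℂ}
    {f : unitInterval → ℂ} (h : ∀ x, Tendsto (fun i => F i x) l (𝓝 (f x))) {C : ℝ≥0∞}
    (hC : ∀ᶠ i in l, totalVar (F i) ≤ C) : totalVar f ≤ C := by
  by_contra! hlt
  have h' : ∀ t ∈ Ici (0 : ℝ), Tendsto (fun i => extByZero (F i) t) l (𝓝 (extByZero f t)) := by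
    intro t _
    by_cases ht : t ∈ Icc (0 : ℝ) 1
    · simpa only [extByZero, ht, dite_true] using h ⟨t, ht⟩
    · simpa only [extByZero, ht, dite_false] using tendsto_const_nhds
  obtain ⟨i, hi, hi'⟩ := ((eVariationOn.lowerSemicontinuous_aux h' hlt).and hC).exists
  exact absurd hi (not_lt.2 hi')

/-- Completeness of `BV`: a series that converges absolutely in total variation converges pointwise,
and in total variation to the same limit. -/
lemma exists_hasSum_of_totalVar {f : ℕ → unitInterval → ℂ} (hf : ∑' n, totalVar (f n) ≠ ∞) :
    ∃ F : unitInterval → ℂ, (∀ x, HasSum (fun n => f n x) (F x)) ∧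
      ∀ N, totalVar (F - ∑ n ∈ Finset.range N, f n) ≤ ∑' n, totalVar (f (n + N)) := by
  have hs : ∀ x, Summable fun n => f n x := by
    intro x
    refine Summable.of_nnnorm (tsum_enorm_ne_top_iff_summable_nnnorm.1
      (ne_top_of_le_ne_top hf (ENNReal.tsum_le_tsum fun n => enorm_le_totalVar (f n) x)))
  refine ⟨fun x => ∑' n, f n x, fun x => (hs x).hasSum, fun N => ?_⟩
  refine totalVar_le_of_tendsto (l := atTop)
    (F := fun M => ∑ n ∈ Finset.range M, f (n + N)) (fun x => ?_) (Eventually.of_forall fun M => ?_)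
  · have h1 := ((summable_nat_add_iff N).2 (hs x)).hasSum.tendsto_sum_nat
    have h2 := (hs x).sum_add_tsum_nat_add N
    have h3 : (∑' n, f n x) - ∑ n ∈ Finset.range N, f n x = ∑' n, f (n + N) x := by
      rw [← h2]
      ring
    simp only [Pi.sub_apply, Finset.sum_apply, h3]
    exact h1
  · exact (totalVar_sum_le _ _).trans (ENNReal.sum_le_tsum _)

/-- If `B` is a strict contraction of `BV` for the total variation, then `1 - B` is onto, the solution of
`F - B F = g` being the Neumann series `∑ Bⁿ g`. -/
lemma exists_sub_apply_eq {B : Module.End ℂ BV} {r : ℝ≥0∞} (hr : r < 1)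
    (hB : ∀ f : BV, totalVar (B f) ≤ r * totalVar f) (g : BV) :
    ∃ F : BV, F - B F = g ∧ ∀ x, (∀ n, ((B ^ n) g : unitInterval → ℂ) x = 0) →
      (F : unitInterval → ℂ) x = 0 := by
  have hpow : ∀ n, totalVar ((B ^ n) g : unitInterval → ℂ) ≤ r ^ n * totalVar g := by
    intro n
    induction n with
    | zero => simp
    | succ n ih =>
      rw [pow_succ', Module.End.mul_apply, pow_succ', mul_assoc]
      exact (hB _).trans (by gcongr)
  have hg : totalVar (g : unitInterval → ℂ) ≠ ∞ := mem_BV_iff.1 g.2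
  have hsum : ∑' n, totalVar ((B ^ n) g : unitInterval → ℂ) ≠ ∞ := by
    refine ne_top_of_le_ne_top ?_ (ENNReal.tsum_le_tsum hpow)
    rw [ENNReal.tsum_mul_right, ENNReal.tsum_geometric]
    refine ENNReal.mul_ne_top (ENNReal.inv_ne_top.2 ?_) hg
    exact (tsub_pos_of_lt hr).ne'
  obtain ⟨F, hF, htail⟩ := exists_hasSum_of_totalVar hsum
  have hFBV : F ∈ BV := by
    rw [mem_BV_iff]
    have := htail 0
    simp only [Finset.range_zero, Finset.sum_empty, sub_zero, add_zero] at this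
    exact ne_top_of_le_ne_top hsum this
  refine ⟨⟨F, hFBV⟩, ?_, fun x hx => ?_⟩
  · set S : ℕ → BV := fun N => ∑ n ∈ Finset.range N, (B ^ n) g with hS
    have hScoe : ∀ N, (S N : unitInterval → ℂ) =
        ∑ n ∈ Finset.range N, ((B ^ n) g : unitInterval → ℂ) := fun N => by
      simp [hS]
    have hSB : ∀ N, S N - B (S N) = g - (B ^ N) g := by
      intro N
      have := congrArg (fun X : Module.End ℂ BV => X g) (mul_neg_geom_sum B N)
      simpa [hS, LinearMap.sum_apply, Module.End.mul_apply] using this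
    set F' : BV := ⟨F, hFBV⟩ with hF'
    have hle : ∀ N, totalVar ((F' - B F' - g : BV) : unitInterval → ℂ) ≤
        2 * ∑' n, totalVar ((B ^ (n + N)) g : unitInterval → ℂ) + r ^ N * totalVar g := by
      intro N
      have h1 : F' - B F' - g = (F' - S N) - B (F' - S N) - (B ^ N) g := by
        have h2 := hSB N
        rw [map_sub]
        have h3 : g = S N - B (S N) + (B ^ N) g := by rw [h2]; abel
        nth_rewrite 1 [h3]
        abel
      have h4 : totalVar ((F' - S N : BV) : unitInterval → ℂ) ≤
          ∑' n, totalVar ((B ^ (n + N)) g : unitInterval → ℂ) := by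
        have := htail N
        rwa [← hScoe] at this
      rw [h1]
      refine (totalVar_sub_le _ _).trans (add_le_add ((totalVar_sub_le _ _).trans ?_) (hpow N))
      rw [two_mul]
      refine add_le_add h4 ((hB _).trans ?_)
      exact (mul_le_of_le_one_left (by positivity) hr.le).trans h4
    have hlim : Tendsto (fun N => 2 * ∑' n, totalVar ((B ^ (n + N)) g : unitInterval → ℂ) +
        r ^ N * totalVar g) atTop (𝓝 0) := by
      have h1 := ENNReal.Tendsto.const_mul (ENNReal.tendsto_sum_nat_add _ hsum)
        (Or.inr (by simp : (2 : ℝ≥0∞) ≠ ∞))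
      have h2 := ENNReal.Tendsto.mul_const (ENNReal.tendsto_pow_atTop_nhds_zero_of_lt_one hr)
        (Or.inr hg)
      simpa using h1.add h2
    have hz := le_antisymm (ge_of_tendsto' hlim hle) (by positivity)
    have h0 := eq_zero_of_totalVar_eq_zero hz
    exact sub_eq_zero.1 (Subtype.ext h0)
  · have h1 := hF x
    simp only [hx] at h1
    exact h1.unique hasSum_zero

lemma eq_zero_of_sub_apply_eq_zero {B : Module.End ℂ BV} {r : ℝ≥0∞} (hr : r < 1)
    (hB : ∀ f : BV, totalVar (B f) ≤ r * totalVar f) {f : BV} (hf : f - B f = 0) : f = 0 := by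
  have h1 := hB f
  rw [← sub_eq_zero.1 hf] at h1
  have hfin : totalVar (f : unitInterval → ℂ) ≠ ∞ := mem_BV_iff.1 f.2
  have h0 : totalVar (f : unitInterval → ℂ) = 0 := by
    by_contra hne
    have h2 := ENNReal.mul_lt_mul_left hne hfin hr
    rw [one_mul] at h2
    exact absurd h1 (not_le.2 h2)
  exact Subtype.ext (eq_zero_of_totalVar_eq_zero h0)

/-! ### The transfer operator as a rank-one perturbation of a contraction -/

instance nhdsLT_one_neBot : (𝓝[<] (1 : unitInterval)).NeBot :=
  nhdsLT_neBot_of_exists_lt ⟨0, zero_lt_one⟩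

/-- The contribution of the branch of index `k` to the transfer operator (without the factor `β⁻¹`). -/
def branchOp (β : Ioi (1 : ℝ)) (k : ℕ) : Module.End ℂ BV where
  toFun f := ⟨(branchDom β k).indicator fun x => (f : unitInterval → ℂ) (branch β k x),
    branch_indicator_mem_BV β.2 f.2 k⟩
  map_add' _ _ := Subtype.ext (indicator_add _ _ _)
  map_smul' c _ := Subtype.ext (indicator_const_smul (branchDom β k) c _)

lemma branchOp_coe (β : Ioi (1 : ℝ)) (k : ℕ) (f : BV) :
    (branchOp β k f : unitInterval → ℂ) =
      (branchDom β k).indicator fun x => (f : unitInterval → ℂ) (branch β k x) := rfl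

lemma branchOp_apply_one (β : Ioi (1 : ℝ)) (k : ℕ) (f : BV) :
    (branchOp β k f : unitInterval → ℂ) 1 = 0 := by
  rw [branchOp_coe]
  exact indicator_of_notMem (fun h : (1 : unitInterval) ∈ branchDom β k => lt_irrefl _ h.1) _

lemma branchOp_apply_of_lt_one (β : Ioi (1 : ℝ)) (k : ℕ) (f : BV) {x : unitInterval} (hx : x < 1) :
    (branchOp β k f : unitInterval → ℂ) x = extByZero f (((x : ℝ) + k) / β) := by
  have h0 : (0 : ℝ) < β := one_pos.trans β.2
  by_cases h : (x : ℝ) + k ≤ β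
  · have hdom : x ∈ branchDom β k := ⟨hx, h⟩
    rw [branchOp_coe, indicator_of_mem hdom, ← branch_coe β.2 hdom, extByZero_coe]
  · rw [branchOp_coe, indicator_of_notMem fun hdom => h hdom.2, extByZero_of_one_lt]
    rw [one_lt_div h0]
    exact not_le.1 h

lemma perronFrobenius_eq_sum (β : Ioi (1 : ℝ)) (f : BV) :
    perronFrobenius β f = ((β : ℝ) : ℂ)⁻¹ • ∑ k ∈ Finset.range (⌊(β : ℝ)⌋₊ + 1), branchOp β k f := by
  apply Subtype.ext
  change transfer β f = _
  rw [transfer_eq_sum β.2]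
  simp only [Submodule.coe_smul, Submodule.coe_sum]
  rfl

/-- The left limit at `1`, as a linear functional on `BV`. -/
def leftLimOne : BV →ₗ[ℂ] ℂ where
  toFun f := Function.leftLim (f : unitInterval → ℂ) 1
  map_add' f g := tendsto_nhds_unique (BoundedVariationOn.tendsto_leftLim (f + g).2 1)
    ((BoundedVariationOn.tendsto_leftLim f.2 1).add (BoundedVariationOn.tendsto_leftLim g.2 1))
  map_smul' c f := tendsto_nhds_unique (BoundedVariationOn.tendsto_leftLim (c • f).2 1)
    ((BoundedVariationOn.tendsto_leftLim f.2 1).const_smul c)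

lemma tendsto_leftLimOne (f : BV) :
    Tendsto (f : unitInterval → ℂ) (𝓝[<] 1) (𝓝 (leftLimOne f)) :=
  BoundedVariationOn.tendsto_leftLim f.2 1

lemma leftLimOne_eq {f : BV} {c : ℂ} (h : ∀ᶠ x in 𝓝[<] (1 : unitInterval),
    (f : unitInterval → ℂ) x = c) : leftLimOne f = c :=
  tendsto_nhds_unique (tendsto_leftLimOne f) (tendsto_const_nhds.congr' (h.mono fun _ hx => hx.symm))

/-- The indicator function of `[0, y)`. -/
def stepBV (y : unitInterval) : BV :=
  ⟨(Iio y).indicator 1, boundedVariationOn_of_step (isLowerSet_Iio y) (c := 1) (d := 0)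
    (fun _ _ hx => indicator_of_mem hx _) fun _ _ hx => indicator_of_notMem hx _⟩

lemma stepBV_of_lt {x y : unitInterval} (h : x < y) : (stepBV y : unitInterval → ℂ) x = 1 :=
  indicator_of_mem (show x ∈ Iio y from h) _

lemma stepBV_of_le {x y : unitInterval} (h : y ≤ x) : (stepBV y : unitInterval → ℂ) x = 0 :=
  indicator_of_notMem (show x ∉ Iio y from not_lt.2 h) _

/-- The sum of the left limits of `f` at the right ends of the branches of `τ_β`. -/
def branchSum (β : Ioi (1 : ℝ)) : BV →ₗ[ℂ] ℂ :=
  ∑ k ∈ Finset.range (⌊(β : ℝ)⌋₊ + 1), leftLimOne ∘ₗ branchOp β k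

/-- The transfer operator with the branches normalized to tend to `0` at their right ends. -/
def contractionPart (β : Ioi (1 : ℝ)) : Module.End ℂ BV :=
  perronFrobenius β - (((β : ℝ)⁻¹ : ℝ) : ℂ) • (branchSum β).smulRight (stepBV 1)

lemma branchSum_apply (β : Ioi (1 : ℝ)) (f : BV) :
    branchSum β f = ∑ k ∈ Finset.range (⌊(β : ℝ)⌋₊ + 1), leftLimOne (branchOp β k f) := by
  simp [branchSum]

lemma perronFrobenius_eq (β : Ioi (1 : ℝ)) (f : BV) :
    perronFrobenius β f =
      contractionPart β f + ((((β : ℝ)⁻¹ : ℝ) : ℂ) * branchSum β f) • stepBV 1 := by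
  simp [contractionPart, mul_smul]

lemma contractionPart_apply (β : Ioi (1 : ℝ)) (f : BV) :
    contractionPart β f = ((β : ℝ) : ℂ)⁻¹ • ∑ k ∈ Finset.range (⌊(β : ℝ)⌋₊ + 1),
      (branchOp β k f - leftLimOne (branchOp β k f) • stepBV 1) := by
  simp only [contractionPart, LinearMap.sub_apply, LinearMap.smul_apply, LinearMap.smulRight_apply,
    perronFrobenius_eq_sum, branchSum_apply, Finset.sum_sub_distrib, smul_sub, Finset.sum_smul,
    Complex.ofReal_inv]

/-- Normalizing a function to tend to `0` at `1` removes the jump there. -/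
lemma totalVar_sub_leftLimOne_le (g : BV) (hg : (g : unitInterval → ℂ) 1 = 0) :
    totalVar ((g - leftLimOne g • stepBV 1 : BV) : unitInterval → ℂ) ≤
      eVariationOn (g : unitInterval → ℂ) (Iio 1) := by
  set h : BV := g - leftLimOne g • stepBV 1 with hh
  have hlt : ∀ x : unitInterval, x < 1 →
      (h : unitInterval → ℂ) x = (g : unitInterval → ℂ) x - leftLimOne g := by
    intro x hx
    simp [hh, stepBV_of_lt hx]
  have h1 : (h : unitInterval → ℂ) 1 = 0 := by
    simp [hh, stepBV_of_le le_rfl, hg]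
  have hcont : ContinuousWithinAt (h : unitInterval → ℂ) (univ ∩ Iic 1) 1 := by
    have hlim : Tendsto (h : unitInterval → ℂ) (𝓝[<] 1) (𝓝 0) := by
      have := (tendsto_leftLimOne g).sub_const (leftLimOne g)
      rw [sub_self] at this
      refine this.congr' ?_
      filter_upwards [self_mem_nhdsWithin] with x hx using (hlt x hx).symm
    have h2 : ContinuousWithinAt (h : unitInterval → ℂ) (Iio 1) 1 := by
      rw [ContinuousWithinAt, h1]
      exact hlim
    have h3 := h2.insert
    rwa [Iio_insert, ← univ_inter (Iic (1 : unitInterval))] at h3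
  have hvar := eVariationOn.eVariationOn_inter_Iio_eq_inter_Iic_of_continuousWithinAt
    (by rw [univ_inter]; infer_instance) hcont
  rw [univ_inter, univ_inter] at hvar
  refine (totalVar_le_of_apply_one h1).trans ?_
  have huniv : (univ : Set unitInterval) = Iic 1 := (eq_univ_of_forall fun x => x.2.2).symm
  rw [huniv, ← hvar, eVariationOn.congr (g := (g : unitInterval → ℂ) + fun _ => -leftLimOne g)
    fun x hx => by rw [hlt x hx, Pi.add_apply, sub_eq_add_neg]]
  refine (eVariationOn_add_le _ _ _).trans ?_
  rw [eVariationOn.constant_on (f := fun _ : unitInterval => -leftLimOne g)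
    (by rintro _ ⟨_, _, rfl⟩ _ ⟨_, _, rfl⟩; rfl), add_zero]

/-- The branches of `f` have together at most the total variation of `f`. -/
lemma totalVar_contractionPart_le (β : Ioi (1 : ℝ)) (f : BV) :
    totalVar (contractionPart β f) ≤ ENNReal.ofReal (β : ℝ)⁻¹ * totalVar f := by
  have h0 : (0 : ℝ) < β := one_pos.trans β.2
  rw [contractionPart_apply, Submodule.coe_smul, Submodule.coe_sum]
  refine (totalVar_smul_le _ _).trans ?_
  have hnorm : ‖((β : ℝ) : ℂ)⁻¹‖ₑ = ENNReal.ofReal (β : ℝ)⁻¹ := by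
    rw [← ofReal_norm, norm_inv, Complex.norm_real, Real.norm_eq_abs, abs_of_pos h0]
  rw [hnorm]
  gcongr
  refine (totalVar_sum_le _ _).trans ?_
  have hI : Monotone fun k : ℕ => (k : ℝ) / β := by
    intro j k hjk
    have : (j : ℝ) ≤ k := by exact_mod_cast hjk
    simp only
    gcongr
  calc ∑ k ∈ Finset.range (⌊(β : ℝ)⌋₊ + 1),
        totalVar ((branchOp β k f - leftLimOne (branchOp β k f) • stepBV 1 : BV) : unitInterval → ℂ)
      ≤ ∑ k ∈ Finset.range (⌊(β : ℝ)⌋₊ + 1),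
        eVariationOn (extByZero f) (Icc ((k : ℝ) / β) (((k + 1 : ℕ) : ℝ) / β)) := by
        refine Finset.sum_le_sum fun k _ => ?_
        refine (totalVar_sub_leftLimOne_le _ (branchOp_apply_one β k f)).trans ?_
        have heq : EqOn (branchOp β k f : unitInterval → ℂ)
            (extByZero f ∘ fun x : unitInterval => ((x : ℝ) + k) / β) (Iio 1) :=
          fun x hx => branchOp_apply_of_lt_one β k f hx
        rw [eVariationOn.congr heq]
        refine eVariationOn.comp_le_of_monotoneOn _ _ ?_ ?_
        · intro x _ y _ hxy
          have : (x : ℝ) ≤ y := hxy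
          simp only
          gcongr
        · intro x hx
          have h1 : 0 ≤ (x : ℝ) := x.2.1
          have h2 : (x : ℝ) ≤ 1 := x.2.2
          exact ⟨div_le_div_of_nonneg_right (by linarith) h0.le,
            div_le_div_of_nonneg_right (by push_cast; linarith) h0.le⟩
    _ = eVariationOn (extByZero f) (Icc (((0 : ℕ) : ℝ) / β) (((⌊(β : ℝ)⌋₊ + 1 : ℕ) : ℝ) / β)) :=
        eVariationOn.sum' _ hI
    _ ≤ _ := eVariationOn.mono _ fun t ht => by simpa using ht.1

lemma enorm_leftLimOne_le (g : BV) {C : ℝ≥0∞} (hg : ∀ x, ‖(g : unitInterval → ℂ) x‖ₑ ≤ C) :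
    ‖leftLimOne g‖ₑ ≤ C :=
  le_of_tendsto (tendsto_leftLimOne g).enorm (Eventually.of_forall hg)

lemma enorm_branchSum_le (β : Ioi (1 : ℝ)) (f : BV) :
    ‖branchSum β f‖ₑ ≤ (⌊(β : ℝ)⌋₊ + 1 : ℕ) * totalVar f := by
  rw [branchSum_apply]
  refine (enorm_sum_le _ _).trans ?_
  have h : ∀ k ∈ Finset.range (⌊(β : ℝ)⌋₊ + 1), ‖leftLimOne (branchOp β k f)‖ₑ ≤ totalVar f := by
    intro k _
    refine enorm_leftLimOne_le _ fun x => ?_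
    rw [branchOp_coe]
    exact (enorm_indicator_le_enorm_self _ _).trans (enorm_le_totalVar _ _)
  refine (Finset.sum_le_sum h).trans ?_
  simp

/-! ### The action on indicator functions of intervals, and the greedy digits -/

lemma branchOp_stepBV (β : Ioi (1 : ℝ)) (k : ℕ) (y : unitInterval) {x : unitInterval} (hx : x < 1) :
    (branchOp β k (stepBV y) : unitInterval → ℂ) x =
      if (x : ℝ) + k < β * y then 1 else 0 := by
  have h0 : (0 : ℝ) < β := one_pos.trans β.2
  rw [branchOp_apply_of_lt_one β k _ hx]
  have hx0 : (0 : ℝ) ≤ x := x.2.1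
  have hy1 : (y : ℝ) ≤ 1 := y.2.2
  have hiff : (x : ℝ) + k < β * y ↔ ((x : ℝ) + k) / β < y := by
    rw [div_lt_iff₀ h0, mul_comm]
  by_cases h1 : ((x : ℝ) + k) / β ≤ 1
  · have hmem : ((x : ℝ) + k) / β ∈ Icc (0 : ℝ) 1 := ⟨by positivity, h1⟩
    simp only [extByZero, dif_pos hmem, hiff]
    split_ifs with h
    · exact stepBV_of_lt h
    · exact stepBV_of_le (not_lt.1 h)
  · rw [extByZero_of_one_lt _ (not_le.1 h1), if_neg]
    intro h
    exact h1 ((hiff.1 h).le.trans hy1)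

lemma leftLimOne_branchOp_stepBV (β : Ioi (1 : ℝ)) (k : ℕ) (y : unitInterval) :
    leftLimOne (branchOp β k (stepBV y)) = if k < ⌊(β : ℝ) * y⌋₊ then 1 else 0 := by
  have h0 : (0 : ℝ) < β := one_pos.trans β.2
  have hy0 : 0 ≤ (β : ℝ) * y := mul_nonneg h0.le y.2.1
  split_ifs with h
  · apply leftLimOne_eq
    filter_upwards [self_mem_nhdsWithin] with x hx
    have hx1 : (x : ℝ) < 1 := hx
    have h2 : ((k + 1 : ℕ) : ℝ) ≤ β * y := (Nat.le_floor_iff hy0).1 h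
    rw [branchOp_stepBV β k y hx, if_pos]
    push_cast at h2
    linarith
  · apply leftLimOne_eq
    have h1 : (β : ℝ) * y < k + 1 := by
      have := (Nat.floor_lt hy0).1 (Nat.lt_succ_of_le (not_lt.1 h))
      exact_mod_cast this
    have hnear : ∀ᶠ x : unitInterval in 𝓝[<] 1, (β : ℝ) * y - k < x := by
      refine nhdsWithin_le_nhds (continuous_subtype_val.continuousAt.eventually (lt_mem_nhds ?_))
      change (β : ℝ) * y - k < 1
      linarith
    filter_upwards [self_mem_nhdsWithin, hnear] with x hx hx'
    rw [branchOp_stepBV β k y hx, if_neg]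
    linarith

lemma floor_mul_le (β : Ioi (1 : ℝ)) (y : unitInterval) : ⌊(β : ℝ) * y⌋₊ ≤ ⌊(β : ℝ)⌋₊ :=
  Nat.floor_le_floor (mul_le_of_le_one_right (one_pos.trans β.2).le y.2.2)

lemma branchSum_stepBV (β : Ioi (1 : ℝ)) (y : unitInterval) :
    branchSum β (stepBV y) = (⌊(β : ℝ) * y⌋₊ : ℂ) := by
  rw [branchSum_apply]
  simp only [leftLimOne_branchOp_stepBV]
  have h : (Finset.range (⌊(β : ℝ)⌋₊ + 1)).filter (fun k => k < ⌊(β : ℝ) * y⌋₊) =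
      Finset.range ⌊(β : ℝ) * y⌋₊ := by
    have := floor_mul_le β y
    ext k
    simp only [Finset.mem_filter, Finset.mem_range]
    omega
  rw [Finset.sum_boole, h, Finset.card_range]

lemma contractionPart_stepBV (β : Ioi (1 : ℝ)) (y : unitInterval) :
    contractionPart β (stepBV y) = ((β : ℝ) : ℂ)⁻¹ • stepBV (betaMap β y) := by
  have h0 : (0 : ℝ) < β := one_pos.trans β.2
  have hy0 : 0 ≤ (β : ℝ) * y := mul_nonneg h0.le y.2.1
  rw [contractionPart_apply]
  congr 1
  apply Subtype.ext
  funext x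
  simp only [Submodule.coe_sum, Finset.sum_apply, Submodule.coe_sub, Submodule.coe_smul,
    Pi.sub_apply, Pi.smul_apply, leftLimOne_branchOp_stepBV]
  rcases lt_or_eq_of_le (show x ≤ 1 from x.2.2) with hx | rfl
  · have hx0 : (0 : ℝ) ≤ x := x.2.1
    have hx1 : (x : ℝ) < 1 := hx
    have hfl := Nat.floor_le hy0
    have hfl' := Nat.lt_floor_add_one ((β : ℝ) * y)
    simp only [branchOp_stepBV β _ y hx, stepBV_of_lt hx, smul_eq_mul, mul_one]
    -- only the branch containing `y` contributes
    rw [Finset.sum_eq_single ⌊(β : ℝ) * y⌋₊]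
    · have hτ : ((betaMap β y : unitInterval) : ℝ) = β * y - ⌊(β : ℝ) * y⌋₊ := by
        change Int.fract ((β : ℝ) * y) = _
        rw [Int.fract, natCast_floor_eq_intCast_floor hy0]
      rw [if_neg (lt_irrefl _), sub_zero]
      split_ifs with h
      · refine (stepBV_of_lt (show (x : ℝ) < _ from ?_)).symm
        rw [hτ]
        linarith
      · refine (stepBV_of_le (show _ ≤ (x : ℝ) from ?_)).symm
        rw [hτ]
        linarith
    · intro k _ hk
      rcases lt_or_gt_of_ne hk with hk | hk
      · have : (k : ℝ) + 1 ≤ ⌊(β : ℝ) * y⌋₊ := by exact_mod_cast hk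
        rw [if_pos (by linarith), if_pos hk, sub_self]
      · have : (⌊(β : ℝ) * y⌋₊ : ℝ) + 1 ≤ k := by exact_mod_cast hk
        rw [if_neg (by linarith), if_neg hk.not_gt, sub_self]
    · intro h
      exact absurd (Finset.mem_range.2 (Nat.lt_succ_of_le (floor_mul_le β y))) h
  · rw [stepBV_of_le (show betaMap β y ≤ 1 from (betaMap β y).2.2)]
    simp [branchOp_apply_one, stepBV_of_le]

lemma contractionPart_pow_stepBV (β : Ioi (1 : ℝ)) (n : ℕ) :
    (contractionPart β ^ n) (stepBV 1) =
      (((β : ℝ) : ℂ)⁻¹) ^ n • stepBV ((betaMap β)^[n] 1) := by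
  induction n with
  | zero => simp
  | succ n ih =>
    rw [pow_succ', Module.End.mul_apply, ih, map_smul, contractionPart_stepBV, smul_smul, pow_succ,
      Function.iterate_succ_apply']

lemma totalVar_smul_contractionPart_le (β : Ioi (1 : ℝ)) (c : ℂ) (f : BV) :
    totalVar ((c • contractionPart β) f : BV) ≤ (‖c‖ₑ * ENNReal.ofReal (β : ℝ)⁻¹) * totalVar f := by
  rw [LinearMap.smul_apply, Submodule.coe_smul, mul_assoc]
  refine (totalVar_smul_le _ _).trans ?_
  gcongr
  exact totalVar_contractionPart_le β f

lemma enorm_inv_mul_lt_one {β : Ioi (1 : ℝ)} {μ : ℂ} (hμ : (β : ℝ)⁻¹ < ‖μ‖) :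
    ‖μ⁻¹‖ₑ * ENNReal.ofReal (β : ℝ)⁻¹ < 1 := by
  have h0 : (0 : ℝ) < (β : ℝ)⁻¹ := inv_pos.2 (one_pos.trans β.2)
  rw [← ofReal_norm, ← ENNReal.ofReal_mul (norm_nonneg _), ENNReal.ofReal_lt_one, norm_inv,
    inv_mul_lt_one₀ (h0.trans hμ)]
  exact hμ

lemma bijective_sub_contractionPart (β : Ioi (1 : ℝ)) {μ : ℂ} (hμ : (β : ℝ)⁻¹ < ‖μ‖) :
    Function.Bijective fun f => μ • f - contractionPart β f := by
  have h0 : (0 : ℝ) < (β : ℝ)⁻¹ := inv_pos.2 (one_pos.trans β.2)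
  have hμ0 : μ ≠ 0 := norm_pos_iff.1 (h0.trans hμ)
  have hr := enorm_inv_mul_lt_one hμ
  have hB := totalVar_smul_contractionPart_le β μ⁻¹
  have hfac : ∀ f, μ • f - contractionPart β f = μ • (f - (μ⁻¹ • contractionPart β) f) := by
    intro f
    rw [LinearMap.smul_apply, smul_sub, smul_inv_smul₀ hμ0]
  constructor
  · intro f g hfg
    simp only [hfac] at hfg
    have h1 := smul_right_injective BV hμ0 hfg
    rw [← sub_eq_zero]
    refine eq_zero_of_sub_apply_eq_zero hr hB ?_
    rw [map_sub, sub_sub_sub_comm, h1, sub_self]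
  · intro g
    obtain ⟨F, hF, -⟩ := exists_sub_apply_eq hr hB (μ⁻¹ • g)
    refine ⟨F, ?_⟩
    simp only [hfac, hF, smul_inv_smul₀ hμ0]

lemma isRankOnePerturbation_perronFrobenius (β : Ioi (1 : ℝ)) :
    IsRankOnePerturbation (perronFrobenius β) (contractionPart β) (stepBV 1) (branchSum β)
      (β : ℝ)⁻¹ fun n => greedyDigit β 1 n where
  pos := inv_pos.2 (one_pos.trans β.2)
  apply_eq := perronFrobenius_eq β
  bijective μ hμ := bijective_sub_contractionPart β hμ
  bound f := by
    have h0 : (0 : ℝ) ≤ (β : ℝ)⁻¹ := (inv_pos.2 (one_pos.trans β.2)).le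
    refine ⟨(⌊(β : ℝ)⌋₊ + 1 : ℕ) * (totalVar f).toReal, fun n => ?_⟩
    have hpow : totalVar ((contractionPart β ^ n) f : BV) ≤
        ENNReal.ofReal (β : ℝ)⁻¹ ^ n * totalVar f := by
      induction n with
      | zero => simp
      | succ n ih =>
        rw [pow_succ', Module.End.mul_apply, pow_succ', mul_assoc]
        exact (totalVar_contractionPart_le β _).trans (by gcongr)
    have h1 := (enorm_branchSum_le β ((contractionPart β ^ n) f)).trans
      (mul_le_mul_right hpow _)
    have hfin : totalVar (f : unitInterval → ℂ) ≠ ∞ := mem_BV_iff.1 f.2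
    have h2 := ENNReal.toReal_mono (by finiteness) h1
    rw [toReal_enorm, ENNReal.toReal_mul, ENNReal.toReal_mul, ENNReal.toReal_pow,
      ENNReal.toReal_ofReal h0, ENNReal.toReal_natCast] at h2
    linarith
  coeff n := by
    rw [contractionPart_pow_stepBV, map_smul, branchSum_stepBV, smul_eq_mul, greedyDigit]
    push_cast
    rfl

/-! ### Functions that vanish outside a countable set -/

lemma not_countable_of_Ioo_subset {N : Set unitInterval} {s t : ℝ} (hst : s < t) (hs : 0 ≤ s)
    (ht : t ≤ 1) (h : ∀ x : unitInterval, s < x → (x : ℝ) < t → x ∈ N) : ¬ N.Countable := by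
  intro hN
  have hsub : Ioo s t ⊆ (fun x : unitInterval => (x : ℝ)) '' N := fun x hx =>
    ⟨⟨x, hs.trans hx.1.le, hx.2.le.trans ht⟩, h _ hx.1 hx.2, rfl⟩
  exact not_le.2 hst (Cardinal.Real.Ioo_countable_iff.1 ((hN.image _).mono hsub))

lemma leftLimOne_eq_zero_of_mem_nullBV {g : BV} (hg : g ∈ nullBV) : leftLimOne g = 0 := by
  obtain ⟨N, hN, hg⟩ := hg
  by_contra hne
  have hev := (tendsto_leftLimOne g).eventually_ne hne
  obtain ⟨a, ha, hsub⟩ := (mem_nhdsLT_iff_exists_Ioo_subset' (zero_lt_one (α := unitInterval))).1 hev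
  refine not_countable_of_Ioo_subset (show (a : ℝ) < 1 from ha) a.2.1 le_rfl (fun x h1 h2 => ?_) hN
  by_contra hx
  exact hsub (show x ∈ Ioo a 1 from ⟨h1, h2⟩) (hg x hx)

lemma branchSum_eq_zero_of_mem_nullBV (β : Ioi (1 : ℝ)) {f : BV} (hf : f ∈ nullBV) :
    branchSum β f = 0 := by
  have h0 : (0 : ℝ) < β := one_pos.trans β.2
  rw [branchSum_apply]
  refine Finset.sum_eq_zero fun k _ => leftLimOne_eq_zero_of_mem_nullBV ?_
  obtain ⟨N, hN, hf⟩ := hf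
  refine ⟨betaMap β '' N, hN.image _, fun x hx => ?_⟩
  rw [branchOp_coe, indicator_apply_eq_zero]
  intro hdom
  refine hf _ fun hmem => hx ⟨_, hmem, Subtype.ext ?_⟩
  change Int.fract ((β : ℝ) * branch β k x) = x
  rw [branch_coe β.2 hdom, mul_div_cancel₀ _ h0.ne', Int.fract_add_natCast]
  exact Int.fract_eq_self.2 ⟨x.2.1, hdom.1⟩

lemma contractionPart_mem_nullBV (β : Ioi (1 : ℝ)) {f : BV} (hf : f ∈ nullBV) :
    contractionPart β f ∈ nullBV := by
  have h1 : perronFrobenius β f ∈ nullBV := nullBV_le_comap β hf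
  rwa [perronFrobenius_eq, branchSum_eq_zero_of_mem_nullBV β hf, mul_zero, zero_smul, add_zero] at h1

lemma exists_mem_nullBV_sub_eq (β : Ioi (1 : ℝ)) {μ : ℂ} (hμ : (β : ℝ)⁻¹ < ‖μ‖) {g : BV}
    (hg : g ∈ nullBV) : ∃ f ∈ nullBV, μ • f - contractionPart β f = g := by
  have h0 : (0 : ℝ) < (β : ℝ)⁻¹ := inv_pos.2 (one_pos.trans β.2)
  have hμ0 : μ ≠ 0 := norm_pos_iff.1 (h0.trans hμ)
  obtain ⟨F, hF, hF0⟩ := exists_sub_apply_eq (enorm_inv_mul_lt_one hμ)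
    (totalVar_smul_contractionPart_le β μ⁻¹) (μ⁻¹ • g)
  have hmem : ∀ n, ((μ⁻¹ • contractionPart β) ^ n) (μ⁻¹ • g) ∈ nullBV := by
    intro n
    induction n with
    | zero => exact nullBV.smul_mem _ hg
    | succ n ih =>
      rw [pow_succ', Module.End.mul_apply, LinearMap.smul_apply]
      exact nullBV.smul_mem _ (contractionPart_mem_nullBV β ih)
  choose N hN hN0 using hmem
  refine ⟨F, ⟨⋃ n, N n, countable_iUnion hN, fun x hx => hF0 x fun n => hN0 n x fun h => hx ?_⟩, ?_⟩
  · exact mem_iUnion.2 ⟨n, h⟩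
  · have h1 := congrArg (fun v => μ • v) hF
    simpa only [smul_sub, LinearMap.smul_apply, smul_inv_smul₀ hμ0] using h1

lemma exists_isRankOnePerturbation_hat (β : Ioi (1 : ℝ)) :
    ∃ (A : Module.End ℂ BVHat) (ℓ : BVHat →ₗ[ℂ] ℂ),
      IsRankOnePerturbation (perronFrobeniusHat β) A (nullBV.mkQ (stepBV 1)) ℓ
        (β : ℝ)⁻¹ fun n => greedyDigit β 1 n :=
  (isRankOnePerturbation_perronFrobenius β).mapQ (nullBV_le_comap β)
    (fun _ hf => branchSum_eq_zero_of_mem_nullBV β hf)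
    fun _ hμ _ hg => exists_mem_nullBV_sub_eq β hμ hg

/-! ### Eigenfunctions for small eigenvalues -/

lemma boundedVariationOn_indicator_Ioo (a b : ℝ) (s : Set ℝ) :
    BoundedVariationOn ((Ioo a b).indicator (1 : ℝ → ℂ)) s := by
  have h1 : BoundedVariationOn ((Iio b).indicator (1 : ℝ → ℂ)) s :=
    boundedVariationOn_of_step (isLowerSet_Iio b) (c := 1) (d := 0)
      (fun _ _ hx => indicator_of_mem hx _) fun _ _ hx => indicator_of_notMem hx _
  have h2 : BoundedVariationOn ((Ioi a).indicator (1 : ℝ → ℂ)) s :=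
    boundedVariationOn_of_step (isLowerSet_Iic a) (c := 0) (d := 1)
      (fun _ _ hx => indicator_of_notMem (by simpa using hx) _)
      fun _ _ hx => indicator_of_mem (by simpa using hx) _
  have h3 := h1.smul h2
  convert h3 using 1
  ext x
  by_cases h : x < b <;> by_cases h' : a < x <;> simp [indicator, h, h']

/-- The difference of the indicator functions of two intervals of the same image under `τ_β`, one in the
first branch and one in the second. -/
def bump (a b c : ℝ) (t : ℝ) : ℂ := (Ioo a b).indicator 1 t - (Ioo a b).indicator 1 (t - c)

lemma bump_eq_zero {a b c t : ℝ} (hab : t ≤ a ∨ b ≤ t) (hc : t - c ≤ a ∨ b ≤ t - c) :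
    bump a b c t = 0 := by
  have h1 : t ∉ Ioo a b := fun h => by rcases hab with h' | h' <;> linarith [h.1, h.2]
  have h2 : t - c ∉ Ioo a b := fun h => by rcases hc with h' | h' <;> linarith [h.1, h.2]
  rw [bump, indicator_of_notMem h1, indicator_of_notMem h2, sub_zero]

lemma norm_bump_le (a b c t : ℝ) : ‖bump a b c t‖ ≤ 2 := by
  have h : ∀ u : ℝ, ‖(Ioo a b).indicator (1 : ℝ → ℂ) u‖ ≤ 1 := fun u =>
    (norm_indicator_le_norm_self _ _).trans (by simp)
  exact (norm_sub_le _ _).trans (by linarith [h t, h (t - c)])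

lemma boundedVariationOn_bump (a b c : ℝ) : BoundedVariationOn (bump a b c) univ := by
  have h1 := boundedVariationOn_indicator_Ioo a b univ
  have h2 := boundedVariationOn_indicator_Ioo (a + c) (b + c) univ
  have heq : bump a b c = (Ioo a b).indicator 1 + (-1 : ℂ) • (Ioo (a + c) (b + c)).indicator 1 := by
    ext t
    have hiff : t - c ∈ Ioo a b ↔ t ∈ Ioo (a + c) (b + c) := by
      simp only [mem_Ioo, lt_sub_iff_add_lt, sub_lt_iff_lt_add]
    rw [Pi.add_apply, Pi.smul_apply, bump, smul_eq_mul, neg_one_mul, ← sub_eq_add_neg]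
    congr 1
    by_cases h : t ∈ Ioo (a + c) (b + c)
    · rw [indicator_of_mem h, indicator_of_mem (hiff.2 h)]
      rfl
    · rw [indicator_of_notMem h, indicator_of_notMem fun h' => h (hiff.1 h')]
  rw [BoundedVariationOn, heq]
  refine ne_top_of_le_ne_top ?_ (eVariationOn_add_le _ _ _)
  exact ENNReal.add_ne_top.2 ⟨h1, ne_top_of_le_ne_top (ENNReal.mul_ne_top enorm_ne_top h2)
    (eVariationOn_smul_le _ _ _)⟩

/-- Every `μ` with `|μ| < β⁻¹` is an eigenvalue: if `f` is supported in `(0,1)` and `L_β f = 0`, then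
`∑ (μβ)ⁿ f(βⁿ x)` is an eigenfunction. With `f` the difference of the indicator functions of two
intervals, it equals `-1` on an interval, so that it is an eigenfunction in the quotient as well. -/
lemma exists_eigenfunction (β : Ioi (1 : ℝ)) {μ : ℂ} (hμ : ‖μ‖ < (β : ℝ)⁻¹) :
    ∃ g : BV, perronFrobenius β g = μ • g ∧ g ∉ nullBV := by
  have hβ : (1 : ℝ) < β := β.2
  obtain ⟨β, hβ'⟩ := β
  simp only at hμ hβ
  have h0 : 0 < β := one_pos.trans hβ
  have hinv : 0 < β⁻¹ := inv_pos.2 h0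
  have hinv1 : β⁻¹ < 1 := inv_lt_one_of_one_lt₀ hβ
  obtain ⟨b, hb0, hb⟩ := exists_between (lt_min hinv (sub_pos.2 hinv1))
  have hb1 : b < β⁻¹ := hb.trans_le (min_le_left _ _)
  have hb2 : b + β⁻¹ < 1 := by linarith [hb.trans_le (min_le_right β⁻¹ (1 - β⁻¹))]
  obtain ⟨a, ha0, hab⟩ := exists_between hb0
  set φ := bump a b β⁻¹ with hφ
  have hφ1 : ∀ t, 1 ≤ t → φ t = 0 := fun t ht =>
    bump_eq_zero (Or.inr (by linarith)) (Or.inr (by linarith))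
  set q : ℂ := μ * β with hq
  have hβ0 : (β : ℂ) ≠ 0 := by exact_mod_cast h0.ne'
  have hq1 : ‖q‖ < 1 := by
    rw [hq, norm_mul, Complex.norm_real, Real.norm_eq_abs, abs_of_pos h0]
    have := mul_lt_mul_of_pos_right hμ h0
    rwa [inv_mul_cancel₀ h0.ne'] at this
  -- the eigenfunction, as a function on the half-line
  set G : ℝ → ℂ := fun t => ∑' n : ℕ, q ^ n * φ (β ^ n * t) with hG
  have hsum : ∀ t, Summable fun n : ℕ => q ^ n * φ (β ^ n * t) := fun t => by
    refine Summable.of_norm_bounded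
      ((summable_geometric_of_lt_one (norm_nonneg q) hq1).mul_right 2) fun n => ?_
    rw [norm_mul, norm_pow]
    gcongr
    exact norm_bump_le _ _ _ _
  have hGrec : ∀ t, G t = φ t + q * G (β * t) := by
    intro t
    simp only [hG]
    rw [(hsum t).tsum_eq_zero_add, ← tsum_mul_left]
    simp only [pow_zero, one_mul]
    congr 1
    refine tsum_congr fun n => ?_
    rw [pow_succ, pow_succ, mul_assoc (β ^ n)]
    ring
  have hG1 : ∀ t, 1 ≤ t → G t = 0 := by
    intro t ht
    have : ∀ n : ℕ, q ^ n * φ (β ^ n * t) = 0 := fun n => by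
      rw [hφ1 _ (one_le_mul_of_one_le_of_one_le (one_le_pow₀ hβ.le) ht), mul_zero]
    simp only [hG, this, tsum_zero]
  have hGφ : ∀ t, β⁻¹ ≤ t → G t = φ t := by
    intro t ht
    rw [hGrec, hG1 (β * t), mul_zero, add_zero]
    have := mul_le_mul_of_nonneg_left ht h0.le
    rwa [mul_inv_cancel₀ h0.ne'] at this
  have hBV : (fun x : unitInterval => G x) ∈ BV := by
    set f : ℕ → unitInterval → ℂ := fun n x => q ^ n * φ (β ^ n * x) with hf
    have hfV : ∀ n, totalVar (f n) ≤ ‖q‖ₑ ^ n * eVariationOn φ univ := by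
      intro n
      have h1 : f n 1 = 0 := by
        simp only [hf]
        rw [hφ1, mul_zero]
        simpa using one_le_pow₀ (n := n) hβ.le
      refine (totalVar_le_of_apply_one h1).trans ?_
      have h2 : f n = q ^ n • (φ ∘ fun x : unitInterval => β ^ n * (x : ℝ)) := rfl
      rw [h2]
      refine (eVariationOn_smul_le _ _ _).trans ?_
      rw [enorm_pow]
      gcongr
      refine eVariationOn.comp_le_of_monotoneOn _ _ ?_ fun _ _ => mem_univ _
      intro x _ y _ hxy
      have : (x : ℝ) ≤ y := hxy
      simp only
      gcongr
    have hfin : ∑' n, totalVar (f n) ≠ ∞ := by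
      refine ne_top_of_le_ne_top ?_ (ENNReal.tsum_le_tsum hfV)
      rw [ENNReal.tsum_mul_right, ENNReal.tsum_geometric]
      refine ENNReal.mul_ne_top (ENNReal.inv_ne_top.2 ?_) (boundedVariationOn_bump _ _ _)
      have : ‖q‖ₑ < 1 := by
        rw [← ofReal_norm]
        exact ENNReal.ofReal_lt_one.2 hq1
      exact (tsub_pos_of_lt this).ne'
    obtain ⟨F, hF, hFV⟩ := exists_hasSum_of_totalVar hfin
    have hFG : F = fun x : unitInterval => G x := by
      ext x
      exact (hF x).tsum_eq.symm
    have h3 := hFV 0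
    simp only [Finset.range_zero, Finset.sum_empty, sub_zero, add_zero] at h3
    rw [← hFG, mem_BV_iff]
    exact ne_top_of_le_ne_top hfin h3
  refine ⟨⟨_, hBV⟩, ?_, ?_⟩
  · rw [perronFrobenius_eq_sum]
    apply Subtype.ext
    funext x
    simp only [Submodule.coe_smul, Submodule.coe_sum, Pi.smul_apply, Finset.sum_apply, smul_eq_mul]
    rcases lt_or_eq_of_le (show x ≤ 1 from x.2.2) with hx | rfl
    · have hx0 : (0 : ℝ) ≤ x := x.2.1
      have hx1 : (x : ℝ) < 1 := hx
      have hterm : ∀ k : ℕ, (branchOp ⟨β, hβ'⟩ k ⟨fun x : unitInterval => G x, hBV⟩ :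
          unitInterval → ℂ) x = φ ((x + k) / β) + q * G (x + k) := by
        intro k
        have hG' : extByZero (fun x : unitInterval => G x) (((x : ℝ) + k) / β) =
            G (((x : ℝ) + k) / β) := by
          by_cases h1 : ((x : ℝ) + k) / β ≤ 1
          · rw [extByZero, dif_pos ⟨by positivity, h1⟩]
          · rw [extByZero_of_one_lt _ (not_le.1 h1), hG1 _ (not_le.1 h1).le]
        rw [branchOp_apply_of_lt_one _ _ _ hx]
        simp only
        rw [hG', hGrec, mul_div_cancel₀ _ h0.ne']
      simp only [hterm]
      rw [Finset.sum_add_distrib, ← Finset.mul_sum]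
      obtain ⟨m, hm⟩ : ∃ m, ⌊β⌋₊ = m + 1 :=
        Nat.exists_eq_succ_of_ne_zero (Nat.floor_pos.2 hβ.le).ne'
      have hxβ : (x : ℝ) / β < β⁻¹ := by
        rw [← one_div]
        gcongr
      -- the first two branches cancel, the others miss the support of `φ`
      have hφsum : ∑ k ∈ Finset.range (⌊β⌋₊ + 1), φ ((x + k) / β) = 0 := by
        rw [hm, Finset.sum_range_succ', Finset.sum_range_succ', Finset.sum_eq_zero, zero_add]
        · have e1 : ((x : ℝ) + ((0 + 1 : ℕ) : ℝ)) / β = x / β + β⁻¹ := by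
            push_cast
            field_simp
          have e2 : ((x : ℝ) + ((0 : ℕ) : ℝ)) / β = x / β := by simp
          have n1 : (x : ℝ) / β + β⁻¹ ∉ Ioo a b := fun h => by
            have : 0 ≤ (x : ℝ) / β := by positivity
            linarith [h.2]
          have n2 : (x : ℝ) / β - β⁻¹ ∉ Ioo a b := fun h => by linarith [h.1]
          rw [e1, e2, hφ, bump, bump, add_sub_cancel_right, indicator_of_notMem n1,
            indicator_of_notMem n2]
          ring
        · intro k _
          have e3 : ((x : ℝ) + ((k + 1 + 1 : ℕ) : ℝ)) / β = (x + k) / β + β⁻¹ + β⁻¹ := by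
            push_cast
            field_simp
            ring
          have : 0 ≤ ((x : ℝ) + k) / β := by positivity
          rw [e3]
          exact bump_eq_zero (Or.inr (by linarith)) (Or.inr (by linarith))
      have hGsum : ∑ k ∈ Finset.range (⌊β⌋₊ + 1), G (x + k) = G x := by
        rw [Finset.sum_range_succ', Finset.sum_eq_zero, zero_add]
        · simp
        · intro k _
          apply hG1
          push_cast
          have : (0 : ℝ) ≤ k := k.cast_nonneg
          linarith
      rw [hφsum, hGsum, zero_add, hq]
      field_simp
    · simp [branchOp_apply_one, hG1 1 le_rfl]
  · rintro ⟨N, hN, hN0⟩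
    refine not_countable_of_Ioo_subset (s := a + β⁻¹) (t := b + β⁻¹) (by linarith) (by linarith)
      hb2.le (fun x h1 h2 => ?_) hN
    by_contra hx
    have h3 : G x = 0 := hN0 x hx
    have h4 : (x : ℝ) ∉ Ioo a b := fun h => by linarith [h.2]
    have h5 : (x : ℝ) - β⁻¹ ∈ Ioo a b := ⟨by linarith, by linarith⟩
    rw [hGφ x (by linarith), hφ, bump, indicator_of_notMem h4, indicator_of_mem h5] at h3
    simp at h3

lemma mem_spectrum_perronFrobenius (β : Ioi (1 : ℝ)) {μ : ℂ} (hμ : ‖μ‖ < (β : ℝ)⁻¹) :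
    μ ∈ spectrum ℂ (perronFrobenius β) := by
  obtain ⟨g, hg, hg0⟩ := exists_eigenfunction β hμ
  refine (Module.End.hasEigenvalue_of_hasEigenvector (x := g)
    ⟨Module.End.mem_eigenspace_iff.2 hg, ?_⟩).mem_spectrum
  rintro rfl
  exact hg0 nullBV.zero_mem

lemma mem_spectrum_perronFrobeniusHat (β : Ioi (1 : ℝ)) {μ : ℂ} (hμ : ‖μ‖ < (β : ℝ)⁻¹) :
    μ ∈ spectrum ℂ (perronFrobeniusHat β) := by
  obtain ⟨g, hg, hg0⟩ := exists_eigenfunction β hμ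
  refine (Module.End.hasEigenvalue_of_hasEigenvector (x := nullBV.mkQ g)
    ⟨Module.End.mem_eigenspace_iff.2 ?_, ?_⟩).mem_spectrum
  · change nullBV.mkQ (perronFrobenius β g) = _
    rw [hg, map_smul]
  · intro h
    exact hg0 ((Submodule.Quotient.mk_eq_zero _).1 h)

/-! ### Non-leading eigenvalues and zeros of the digit series -/

lemma two_le_encard_zeros_iff (β : Ioi (1 : ℝ)) :
    (2 : ℕ∞) ≤ {z : ℂ | ‖z‖ < 1 ∧ 1 - phi β ((β : ℝ) * z) = 0}.encard ↔
      ∃ w : ℂ, ‖w‖ < 1 ∧ digitSeries (fun n => (greedyDigit β 1 n : ℝ)) w = 0 ∧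
        w ≠ (((β : ℝ)⁻¹ : ℝ) : ℂ) := by
  have hβ : (1 : ℝ) < β := β.2
  have h0 : (0 : ℝ) < β := one_pos.trans hβ
  have hser : ∀ z : ℂ, 1 - phi β ((β : ℝ) * z) =
      digitSeries (fun n => (greedyDigit β 1 n : ℝ)) z := fun z => by
    rw [one_sub_phi_eq hβ, funext fun n => digit_eq h0.le n]
  simp only [hser]
  set ρ : ℂ := (((β : ℝ)⁻¹ : ℝ) : ℂ) with hρ
  have hρ1 : ‖ρ‖ < 1 := by
    rw [hρ, Complex.norm_real, Real.norm_eq_abs, abs_of_pos (inv_pos.2 h0)]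
    exact inv_lt_one_of_one_lt₀ hβ
  -- the zero at `β⁻¹` that corresponds to the leading eigenvalue
  have hρ0 : digitSeries (fun n => (greedyDigit β 1 n : ℝ)) ρ = 0 := by
    rw [funext fun n => digit_eq h0.le n,
      digitSeries_of_orbit (orbit_zero β) (abs_orbit_le_one β) hρ1, hρ, ← Complex.ofReal_mul,
      mul_inv_cancel₀ h0.ne']
    simp
  constructor
  · intro h
    by_contra! hcon
    have hsub : {z : ℂ | ‖z‖ < 1 ∧ digitSeries (fun n => (greedyDigit β 1 n : ℝ)) z = 0} ⊆ {ρ} :=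
      fun z hz => hcon z hz.1 hz.2
    have h1 := h.trans (Set.encard_le_encard hsub)
    rw [Set.encard_singleton] at h1
    exact absurd h1 (by norm_num)
  · rintro ⟨w, hw, hw0, hne⟩
    rw [← Set.encard_pair hne]
    refine Set.encard_le_encard ?_
    rintro z (rfl | rfl)
    · exact ⟨hw, hw0⟩
    · exact ⟨hρ1, hρ0⟩

lemma exists_isNonLeadingEigenvalue_perronFrobenius_iff (β : Ioi (1 : ℝ)) :
    (∃ lam, IsNonLeadingEigenvalue (perronFrobenius β) lam) ↔
      ((2 : ℕ) : ℕ∞) ≤ {z : ℂ | ‖z‖ < 1 ∧ 1 - phi β ((β : ℝ) * z) = 0}.encard :=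
  ((isRankOnePerturbation_perronFrobenius β).exists_isNonLeadingEigenvalue_iff
    fun _ => mem_spectrum_perronFrobenius β).trans (two_le_encard_zeros_iff β).symm

lemma exists_isNonLeadingEigenvalue_perronFrobeniusHat_iff (β : Ioi (1 : ℝ)) :
    (∃ lam, IsNonLeadingEigenvalue (perronFrobeniusHat β) lam) ↔
      ((2 : ℕ) : ℕ∞) ≤ {z : ℂ | ‖z‖ < 1 ∧ 1 - phi β ((β : ℝ) * z) = 0}.encard := by
  obtain ⟨A, ℓ, h⟩ := exists_isRankOnePerturbation_hat β
  exact (h.exists_isNonLeadingEigenvalue_iff fun _ => mem_spectrum_perronFrobeniusHat β).trans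
    (two_le_encard_zeros_iff β).symm

end

end

end BetaMap

theorem theorem2p9 :
    (∀ N : ℕ, 1 ≤ N →
      -- at least `N` distinct zeros in the open unit disk
      (IsOpen {β : Set.Ioi (1 : ℝ) |
          (N : ℕ∞) ≤ {z : ℂ | ‖z‖ < 1 ∧ 1 - BetaMap.phi β (β * z) = 0}.encard} ∧
        Dense {β : Set.Ioi (1 : ℝ) |
          (N : ℕ∞) ≤ {z : ℂ | ‖z‖ < 1 ∧ 1 - BetaMap.phi β (β * z) = 0}.encard}) ∧
      -- at least `N` zeros in the open unit disk, counted with multiplicity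
      (IsOpen {β : Set.Ioi (1 : ℝ) |
          ∃ S : Finset ℂ, (∀ z ∈ S, ‖z‖ < 1) ∧
            (N : ℕ∞) ≤ ∑ z ∈ S, analyticOrderAt (fun w : ℂ => 1 - BetaMap.phi β (β * w)) z} ∧
        Dense {β : Set.Ioi (1 : ℝ) |
          ∃ S : Finset ℂ, (∀ z ∈ S, ‖z‖ < 1) ∧
            (N : ℕ∞) ≤ ∑ z ∈ S, analyticOrderAt (fun w : ℂ => 1 - BetaMap.phi β (β * w)) z})) ∧
    -- existence of a non-leading eigenvalue, on `BV` and on its quotient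
    (IsOpen {β : Set.Ioi (1 : ℝ) |
        ∃ lam : ℂ, BetaMap.IsNonLeadingEigenvalue (BetaMap.perronFrobenius β) lam} ∧
      Dense {β : Set.Ioi (1 : ℝ) |
        ∃ lam : ℂ, BetaMap.IsNonLeadingEigenvalue (BetaMap.perronFrobenius β) lam}) ∧
    (IsOpen {β : Set.Ioi (1 : ℝ) |
        ∃ lam : ℂ, BetaMap.IsNonLeadingEigenvalue (BetaMap.perronFrobeniusHat β) lam} ∧
      Dense {β : Set.Ioi (1 : ℝ) |
        ∃ lam : ℂ, BetaMap.IsNonLeadingEigenvalue (BetaMap.perronFrobeniusHat β) lam}) := by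
  have hdense := BetaMap.dense_le_encard_zeros
  refine ⟨fun N _ => ⟨⟨BetaMap.isOpen_le_encard_zeros N, hdense N⟩,
    BetaMap.isOpen_le_sum_analyticOrderAt N,
    (hdense N).mono fun β hβ => BetaMap.exists_finset_of_le_encard_zeros β.2 hβ⟩, ?_, ?_⟩
  · simp only [BetaMap.exists_isNonLeadingEigenvalue_perronFrobenius_iff]
    exact ⟨BetaMap.isOpen_le_encard_zeros 2, hdense 2⟩
  · simp only [BetaMap.exists_isNonLeadingEigenvalue_perronFrobeniusHat_iff]
    exact ⟨BetaMap.isOpen_le_encard_zeros 2, hdense 2⟩
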